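/- **Languages and logics.** Let $\Theta$ be a finite non-empty set of atoms, with a chosen atom $\theta_0\in\Theta$. $\mathcal L_C$ is the language generated from $\Theta$ by $\neg,\to$, and $\mathcal L\supset\mathcal L_C$ is the language generated from $\Theta$ by $\neg,\to,\Box$ and the conditional $(\psi|\phi)$. Write $\phi\vee\psi=\neg\phi\to\psi$, $\phi\wedge\psi=\neg(\neg\phi\vee\neg\psi)$, $\phi\leftrightarrow\psi=(\phi\to\psi)\wedge(\psi\to\phi)$, $\top=\theta_0\to\theta_0$, $\bot=\neg\top$, $\psi\times\phi=\Box((\psi|\phi)\leftrightarrow\psi)$. Classical logic $C$ (on $\mathcal L_C$) has modus ponens and the axioms $\phi\to(\psi\to\phi)$; $(\eta\to(\phi\to\psi))\to((\eta\to\phi)\to(\eta\to\psi))$; $(\neg\phi\to\neg\psi)\to((\neg\phi\to\psi)\to\phi)$. The logic DmBL$_*$ (on $\mathcal L$) has these and: $\vdash\phi$ implies $\vdash\Box\phi$; $\Box(\phi\to\psi)\to(\Box\phi\to\Box\psi)$; $\Box\phi\to\phi$; $\Box(\phi\to\psi)\to(\Box\neg\phi\vee\Box(\psi|\phi))$; $(\psi\to\eta|\phi)\to((\psi|\phi)\to(\eta|\phi))$;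 $(\psi|\phi)\to(\phi\to\psi)$; $\neg(\neg\psi|\phi)\leftrightarrow(\psi|\phi)$; $(\psi\times\neg\phi)\leftrightarrow(\psi\times\phi)$; $\Box(\psi\leftrightarrow\eta)\to\Box((\phi|\psi)\leftrightarrow(\phi|\eta))$. Write $\phi\equiv_C\psi$ (resp. $\phi\equiv\psi$) if $\phi\leftrightarrow\psi$ is provable in $C$ (resp. in DmBL$_*$). **Probabilities.** A probability over $C$ is $\pi:\mathcal L_C\to[0,\infty)$ that is invariant under $\equiv_C$ and satisfies $\pi(\phi\wedge\psi)+\pi(\phi\vee\psi)=\pi(\phi)+\pi(\psi)$, $\pi(\bot)=0$, $\pi(\top)=1$; it is strictly positive if $\pi(\phi)>0$ whenever $\phi\not\equiv_C\bot$. A multiplicative probability over DmBL$_*$ is $P:\mathcal L\to[0,\infty)$ with the same properties for $\mathcal L$ and $\equiv$, and such that $\vdash\phi\times\psi$ implies $P(\phi\wedge\psi)=P(\phi)P(\psi)$. For $\delta\in\{0,1\}^\Theta$ let $\sigma_\delta\in\mathcal L_C$ be the conjunction over $\theta\in\Theta$ of $\theta$ (if $\delta_\theta=1$) or $\neg\theta$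 (if $\delta_\theta=0$), and let $\Sigma$ be the set of the $2^{|\Theta|}$ propositions $\sigma_\delta$. **Partial models.** Finite sets $\Omega_n$, partial functions $f_n$ on pairs of subsets of $\Omega_n$, and maps $\mu_n$ from subsets of $\Omega_n$ to subsets of $\Omega_{n+1}$ are built as follows; $M_n=\mathcal P(\Omega_n)$, $\sim A=\Omega_n\setminus A$, and $A_{[m]}=\mu_{m-1}\circ\dots\circ\mu_n(A)$ for $A\in M_n$, $m\ge n$. Start: $\Omega_0=\{0,1\}^\Theta$, and $f_0(B,A)$ is defined only for $A\in\{\emptyset,\Omega_0\}$, with value $B$. A list $\lambda_n$ is a bijection from the integers $2n\le t<2n+\mathrm{card}(M_n)-2=:e_n$ to $M_n\setminus\{\emptyset,\Omega_n\}$, with $\lambda_n(2t)=\sim\lambda_n(2t+1)$ for all $t$ such that both indices are in the range, $\lambda_{n+1}(t)=\mu_n(\lambda_n(t))$ for $2n+2\le t<e_n$, and $\lambda_{n+1}(e_{n+1}-2)=\mu_n(b_n)$, where $b_n=\lambda_n(2n)$. A family of pairs $(\Pi_n(i),\Gamma_n(i))_{i\in I_n}$ is defined thus: if there is $m<n$ with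 $\{b_{m[n]},\sim b_{m[n]}\}=\{b_n,\sim b_n\}$, let $\nu$ be the greatest such $m$, $I_n=\mu_\nu(b_\nu)\times\sim\mu_\nu(b_\nu)$, $\Pi_n(\omega,\omega')=f_n(\{\omega'\}_{[n]},\sim b_n)\cap\{\omega\}_{[n]}$ and $\Gamma_n(\omega,\omega')=f_n(\{\omega\}_{[n]},b_n)\cap\{\omega'\}_{[n]}$; otherwise the family consists of the single pair $(b_n,\sim b_n)$. Then $$\mu_n(A)=\bigcup_{i\in I_n}\bigl((A\cap\Pi_n(i))\times\Gamma_n(i)\bigr)\cup\bigl((A\cap\Gamma_n(i))\times\Pi_n(i)\bigr),\qquad \Omega_{n+1}=\mu_n(\Omega_n).$$ With $T(x,y)=(y,x)$, $f_{n+1}$ is defined exactly as follows, for $A\in M_{n+1}$: $f_{n+1}(A,\emptyset)=f_{n+1}(A,\Omega_{n+1})=A$; $f_{n+1}(A,\mu_n(b_n))=D\cup T(D)$ with $D=A\cap\bigcup_i\Pi_n(i)\times\Gamma_n(i)$; $f_{n+1}(A,\sim\mu_n(b_n))=D'\cup T(D')$ with $D'=A\cap\bigcup_i\Gamma_n(i)\times\Pi_n(i)$;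 and $f_{n+1}(\mu_n(B),\mu_n(A'))=\mu_n(f_n(B,A'))$ for $A'\in M_n\setminus\{b_n,\sim b_n,\emptyset,\Omega_n\}$ and $B\in M_n$ such that $f_n(B,A')$ is defined. **Limit.** $\Omega_\infty$ is the set of sequences $(\omega_n)$ with $\omega_n\in\Omega_n$ and $\omega_{n+1}\in\mu_n(\{\omega_n\})$ for all $n$; $A_\infty=\{(\omega_k)\in\Omega_\infty:\omega_n\in A\}$ for $A\in M_n$; $M_\infty=\{A_\infty: n\in\mathbb N, A\in M_n\}$; $h_\infty(\theta)=\{\delta\in\Omega_0:\delta_\theta=1\}_\infty$; $f_\infty(b_\infty,a_\infty)=(f_n(b,a))_\infty$ for $a,b\in M_n$ with $f_n(b,a)$ defined. Define $H$ on $\mathcal L$ by $H(\theta)=h_\infty(\theta)$, $H(\neg\phi)=\Omega_\infty\setminus H(\phi)$, $H(\phi\to\psi)=(\Omega_\infty\setminus H(\phi))\cup H(\psi)$, $H(\Box\phi)=\Omega_\infty$ if $H(\phi)=\Omega_\infty$ and $\emptyset$ otherwise, $H((\psi|\phi))=f_\infty(H(\psi),H(\phi))$. **Extension.** For a probability $\pi$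 over $C$, let $P_0(\{\delta\})=\pi(\sigma_\delta)$ for $\delta\in\Omega_0$, let $P_n(A)=\sum_{\omega\in A}P_n(\{\omega\})$ for $A\in M_n$, and for $(\omega,\omega')\in\Pi_n(i)\times\Gamma_n(i)$ let $$P_{n+1}(\{(\omega,\omega')\})=\frac{P_n(\{\omega\})P_n(\{\omega'\})}{P_n(\Gamma_n(i))},\qquad P_{n+1}(\{(\omega',\omega)\})=\frac{P_n(\{\omega\})P_n(\{\omega'\})}{P_n(\Pi_n(i))}.$$ Let $P_\infty(A_\infty)=P_n(A)$ for $A\in M_n$, and $\overline\pi(\phi)=P_\infty(H(\phi))$ for $\phi\in\mathcal L$. **Theorem.** Lists $\lambda_n$ as required exist, and for every choice of them: 1. $f_\infty$ is well defined on all of $M_\infty\times M_\infty$, and $(\Omega_\infty,M_\infty,h_\infty,f_\infty)$ is a conditional model for DmBL$_*$: $M_\infty$ is closed under intersection and complement, $h_\infty$ and $f_\infty$ take values in $M_\infty$, and for all $A,B,C\in M_\infty$: $A\subset B$ and $A\neq\emptyset$ imply $f_\infty(B,A)=\Omega_\infty$; $f_\infty(B\cup C,A)\subset f_\infty(B,A)\cup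 f_\infty(C,A)$; $A\cap f_\infty(B,A)\subset B$; $f_\infty(\Omega_\infty\setminus B,A)=\Omega_\infty\setminus f_\infty(B,A)$; $f_\infty(B,A)=B$ implies $f_\infty(B,\Omega_\infty\setminus A)=B$. 2. Let $\pi$ be a strictly positive probability over $C$. Then the recursion for $P_n$ and the definition of $P_\infty$ are consistent, $P_\infty$ is a finitely additive probability on $M_\infty$, $P_\infty(A\cap B)=P_\infty(A)\,P_\infty(f_\infty(B,A))$ for all $A,B\in M_\infty$, and $\overline\pi$ is a multiplicative probability over DmBL$_*$ with $\overline\pi(\phi)=\pi(\phi)$ for all $\phi\in\mathcal L_C$. 3. Let $\pi$ be any probability over $C$. For $0<e\le1$ there is a (unique) probability $\pi_e$ over $C$ with $\pi_e(\sigma)=\frac{e}{\mathrm{card}(\Sigma)}+(1-e)\pi(\sigma)$ for $\sigma\in\Sigma$, and it is strictly positive. For each $\phi\in\mathcal L$ there are real polynomials $p,q$ with $q(e)\ne0$ and $\overline{\pi_e}(\phi)=p(e)/q(e)$ for all $e\in(0,1]$. The limit $\lim_{e\to0+}\overline{\pi_e}(\phi)$ exists for every $\phi\in\mathcal L$ and,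 as a function of $\phi$, is a multiplicative probability over DmBL$_*$ that agrees with $\pi$ on $\mathcal L_C$. In particular every probability over $C$ extends to a multiplicative probability over DmBL$_*$. -/

import Mathlib

open Set Filter Topology Polynomial

universe u

/-! ### Languages -/

/-- The classical language over the atoms `Θ`. -/
inductive CForm (Θ : Type u) : Type u
  | atom (θ : Θ) : CForm Θ
  | neg (φ : CForm Θ) : CForm Θ
  | imp (φ ψ : CForm Θ) : CForm Θ

namespace CForm

variable {Θ : Type u}

def or (φ ψ : CForm Θ) : CForm Θ := imp (neg φ) ψ

def and (φ ψ : CForm Θ) : CForm Θ := neg (or (neg φ) (neg ψ))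

def iff (φ ψ : CForm Θ) : CForm Θ := and (imp φ ψ) (imp ψ φ)

/-- The tautology built on the chosen atom. -/
def top [Inhabited Θ] : CForm Θ := imp (atom default) (atom default)

def bot [Inhabited Θ] : CForm Θ := neg top

/-- Truth value under a valuation. -/
def Holds (δ : Θ → Bool) : CForm Θ → Prop
  | atom θ => δ θ = true
  | neg φ => ¬ Holds δ φ
  | imp φ ψ => Holds δ φ → Holds δ ψ

/-- The literal `θ` or `¬θ`, according to the valuation. -/
def literal (δ : Θ → Bool) (θ : Θ) : CForm Θ := if δ θ = true then atom θ else neg (atom θ)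

/-- The complete conjunction `⋀_θ ε_θ` of the literals selected by a valuation. -/
noncomputable def state [Fintype Θ] [Inhabited Θ] (δ : Θ → Bool) : CForm Θ :=
  (Finset.univ : Finset Θ).toList.foldr (fun θ φ => and (literal δ θ) φ) top

end CForm

/-- Provability in the classical logic `C`. -/
inductive ProvC {Θ : Type u} : CForm Θ → Prop
  | c1 (φ ψ : CForm Θ) : ProvC (.imp φ (.imp ψ φ))
  | c2 (η φ ψ : CForm Θ) :
      ProvC (.imp (.imp η (.imp φ ψ)) (.imp (.imp η φ) (.imp η ψ)))
  | c3 (φ ψ : CForm Θ) :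
      ProvC (.imp (.imp (.neg φ) (.neg ψ)) (.imp (.imp (.neg φ) ψ) φ))
  | mp (φ ψ : CForm Θ) : ProvC φ → ProvC (.imp φ ψ) → ProvC ψ

/-- The language of DmBL; `cond ψ φ` is `(ψ|φ)`. -/
inductive Form (Θ : Type u) : Type u
  | atom (θ : Θ) : Form Θ
  | neg (φ : Form Θ) : Form Θ
  | imp (φ ψ : Form Θ) : Form Θ
  | box (φ : Form Θ) : Form Θ
  | cond (ψ φ : Form Θ) : Form Θ

namespace Form

variable {Θ : Type u}

def or (φ ψ : Form Θ) : Form Θ := imp (neg φ) ψ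

def and (φ ψ : Form Θ) : Form Θ := neg (or (neg φ) (neg ψ))

def iff (φ ψ : Form Θ) : Form Θ := and (imp φ ψ) (imp ψ φ)

def top [Inhabited Θ] : Form Θ := imp (atom default) (atom default)

def bot [Inhabited Θ] : Form Θ := neg top

/-- Logical independence `ψ × φ = □((ψ|φ) ↔ ψ)`. -/
def indep (ψ φ : Form Θ) : Form Θ := box (iff (cond ψ φ) ψ)

end Form

/-- The inclusion of the classical language in the language of DmBL. -/
def CForm.toForm {Θ : Type u} : CForm Θ → Form Θ
  | .atom θ => .atom θ
  | .neg φ => .neg φ.toForm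
  | .imp φ ψ => .imp φ.toForm ψ.toForm

/-- Provability in DmBL∗. -/
inductive ProvStar {Θ : Type u} : Form Θ → Prop
  | c1 (φ ψ : Form Θ) : ProvStar (.imp φ (.imp ψ φ))
  | c2 (η φ ψ : Form Θ) :
      ProvStar (.imp (.imp η (.imp φ ψ)) (.imp (.imp η φ) (.imp η ψ)))
  | c3 (φ ψ : Form Θ) :
      ProvStar (.imp (.imp (.neg φ) (.neg ψ)) (.imp (.imp (.neg φ) ψ) φ))
  | mp (φ ψ : Form Θ) : ProvStar φ → ProvStar (.imp φ ψ) → ProvStar ψ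
  | m1 (φ : Form Θ) : ProvStar φ → ProvStar (.box φ)
  | m2 (φ ψ : Form Θ) : ProvStar (.imp (.box (.imp φ ψ)) (.imp (.box φ) (.box ψ)))
  | m3 (φ : Form Θ) : ProvStar (.imp (.box φ) φ)
  | b1 (φ ψ : Form Θ) :
      ProvStar (.imp (.box (.imp φ ψ)) (.or (.box (.neg φ)) (.box (.cond ψ φ))))
  | b2 (φ ψ η : Form Θ) :
      ProvStar (.imp (.cond (.imp ψ η) φ) (.imp (.cond ψ φ) (.cond η φ)))
  | b3 (φ ψ : Form Θ) : ProvStar (.imp (.cond ψ φ) (.imp φ ψ))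
  | b4 (φ ψ : Form Θ) : ProvStar (.iff (.neg (.cond (.neg ψ) φ)) (.cond ψ φ))
  | b5wA (φ ψ : Form Θ) : ProvStar (.iff (.indep ψ (.neg φ)) (.indep ψ φ))
  | b5wB (φ ψ η : Form Θ) :
      ProvStar (.imp (.box (.iff ψ η)) (.box (.iff (.cond φ ψ) (.cond φ η))))

/-! ### Probabilities on propositions -/

/-- A probability over the classical logic `C`. -/
structure IsProbC {Θ : Type u} [Inhabited Θ] (π : CForm Θ → ℝ) : Prop where
  nonneg : ∀ φ, 0 ≤ π φ
  equivalence : ∀ φ ψ, ProvC (.iff φ ψ) → π φ = π ψ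
  additivity : ∀ φ ψ, π (.and φ ψ) + π (.or φ ψ) = π φ + π ψ
  coherence : π .bot = 0
  finiteness : π .top = 1

/-- `π(φ) > 0` for every `φ` not equivalent to the contradiction. -/
def StrictlyPositive {Θ : Type u} [Inhabited Θ] (π : CForm Θ → ℝ) : Prop :=
  ∀ φ, ¬ ProvC (.iff φ .bot) → 0 < π φ

/-- A (multiplicative) probability over DmBL∗. -/
structure IsProbStar {Θ : Type u} [Inhabited Θ] (P : Form Θ → ℝ) : Prop where
  nonneg : ∀ φ, 0 ≤ P φ
  equivalence : ∀ φ ψ, ProvStar (.iff φ ψ) → P φ = P ψ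
  additivity : ∀ φ ψ, P (.and φ ψ) + P (.or φ ψ) = P φ + P ψ
  coherence : P .bot = 0
  finiteness : P .top = 1
  multiplicativity : ∀ φ ψ, ProvStar (.indep φ ψ) → P (.and φ ψ) = P φ * P ψ

open Classical in
/-- The perturbation `π_e`, with `π_e(σ) = e / card Σ + (1 - e) π(σ)` on complete
conjunctions `σ`; a proposition gets the sum over the complete conjunctions entailing it. -/
noncomputable def perturb {Θ : Type u} [Fintype Θ] [Inhabited Θ]
    (π : CForm Θ → ℝ) (e : ℝ) (φ : CForm Θ) : ℝ :=
  ∑ δ : Θ → Bool, if φ.Holds δ then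
    e / 2 ^ Fintype.card Θ + (1 - e) * π (CForm.state δ) else 0

/-! ### Conditional models -/

/-- A conditional model `(W, M, h, f)` for DmBL∗. -/
structure IsConditionalModelStar {Θ : Type u} {W : Type u} (M : Set (Set W)) (h : Θ → Set W)
    (f : Set W → Set W → Set W) : Prop where
  inter_mem : ∀ A ∈ M, ∀ B ∈ M, A ∩ B ∈ M
  compl_mem : ∀ A ∈ M, Aᶜ ∈ M
  h_mem : ∀ θ, h θ ∈ M
  f_mem : ∀ A ∈ M, ∀ B ∈ M, f B A ∈ M
  beta1 : ∀ A ∈ M, ∀ B ∈ M, A ⊆ B → A ≠ ∅ → f B A = univ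
  beta2 : ∀ A ∈ M, ∀ B ∈ M, ∀ C ∈ M, f (B ∪ C) A ⊆ f B A ∪ f C A
  beta3 : ∀ A ∈ M, ∀ B ∈ M, A ∩ f B A ⊆ B
  beta4 : ∀ A ∈ M, ∀ B ∈ M, f Bᶜ A = (f B A)ᶜ
  beta5w : ∀ A ∈ M, ∀ B ∈ M, f B A = B → f B Aᶜ = B

/-! ### The partial models `(Ω_n, M_n, f_n)` and the morphisms `μ_n`

The elements of `Ω_0` are valuations and those of `Ω_{n+1}` are pairs of elements of `Ω_n`, so
that all the sets `Ω_n` live in one type of binary trees; `M_n` is the set of all subsets of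
`Ω_n`. -/

inductive World (Θ : Type u) : Type u
  | val (δ : Θ → Bool) : World Θ
  | pair (x y : World Θ) : World Θ

namespace World

variable {Θ : Type u}

/-- Cartesian product. -/
def prod (A B : Set (World Θ)) : Set (World Θ) := {w | ∃ x ∈ A, ∃ y ∈ B, w = pair x y}

/-- The exchange `T(x,y) = (y,x)` of the components of a pair. -/
def swap : World Θ → World Θ
  | val δ => val δ
  | pair x y => pair y x

/-- `(id ∪ T)(A)`. -/
def idT (A : Set (World Θ)) : Set (World Θ) := A ∪ swap '' A

end World

/-- The data of step `n`: the set `Ω_n`; the graph of the partial function `f_n`, where `f B A C`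
says that `f_n(B,A)` is defined with value `C`; the proposition `b_n`; and the family
`(Π_n(i), Γ_n(i))`, `i ∈ I_n`, given as a set of pairs. -/
structure Stage (Θ : Type u) : Type u where
  Ω : Set (World Θ)
  f : Set (World Θ) → Set (World Θ) → Set (World Θ) → Prop
  b : Set (World Θ)
  cells : Set (Set (World Θ) × Set (World Θ))

namespace Stage

variable {Θ : Type u}

/-- The morphism `μ_n`. -/
def mu (S : Stage Θ) (A : Set (World Θ)) : Set (World Θ) :=
  ⋃ c ∈ S.cells, World.prod (A ∩ c.1) c.2 ∪ World.prod (A ∩ c.2) c.1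

/-- `Ω_{n+1}`. -/
def nextΩ (S : Stage Θ) : Set (World Θ) := S.mu S.Ω

/-- The graph of `f_{n+1}`. -/
def nextF (S : Stage Θ) (B A C : Set (World Θ)) : Prop :=
  (B ⊆ S.nextΩ ∧ (A = ∅ ∨ A = S.nextΩ) ∧ C = B) ∨
  (B ⊆ S.nextΩ ∧ A = S.mu S.b ∧ C = World.idT (B ∩ ⋃ c ∈ S.cells, World.prod c.1 c.2)) ∨
  (B ⊆ S.nextΩ ∧ A = S.nextΩ \ S.mu S.b ∧
    C = World.idT (B ∩ ⋃ c ∈ S.cells, World.prod c.2 c.1)) ∨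
  (∃ B₀ A₀ C₀, B₀ ⊆ S.Ω ∧ A₀ ⊆ S.Ω ∧ A₀ ≠ S.b ∧ A₀ ≠ S.Ω \ S.b ∧ A₀ ≠ ∅ ∧ A₀ ≠ S.Ω ∧
    S.f B₀ A₀ C₀ ∧ B = S.mu B₀ ∧ A = S.mu A₀ ∧ C = S.mu C₀)

end Stage

section Construction

variable {Θ : Type u}

/-- `A_{[n]} = μ_{n-1} ∘ ⋯ ∘ μ_m (A)` for `A` a subset of `Ω_m` and `m ≤ n`, where `H k` is the
step `k` of the construction. -/
def liftTo (H : ℕ → Stage Θ) (m : ℕ) : ℕ → Set (World Θ) → Set (World Θ)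
  | 0, A => A
  | n + 1, A => if m ≤ n then (H n).mu (liftTo H m n A) else A

/-- The steps `m < n` at which the pair `{b_n, ∼b_n}` was already processed. -/
def earlier (H : ℕ → Stage Θ) (n : ℕ) (Ω b : Set (World Θ)) : Set ℕ :=
  {m | m < n ∧ ({liftTo H m n (H m).b, Ω \ liftTo H m n (H m).b} : Set (Set (World Θ)))
    = {b, Ω \ b}}

/-- The family `(Π_n(i), Γ_n(i))`, `i ∈ I_n`. Case 0: the pair was already processed, most
recently at step `ν`. Case 1: it is processed for the first time. -/
def cellsAt (H : ℕ → Stage Θ) (n : ℕ) (Ω : Set (World Θ))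
    (f : Set (World Θ) → Set (World Θ) → Set (World Θ) → Prop) (b : Set (World Θ)) :
    Set (Set (World Θ) × Set (World Θ)) :=
  {c | (∃ ν, IsGreatest (earlier H n Ω b) ν ∧
          ∃ w ∈ (H ν).mu (H ν).b, ∃ w' ∈ (H ν).nextΩ \ (H ν).mu (H ν).b, ∃ C C',
            f (liftTo H (ν + 1) n {w'}) (Ω \ b) C ∧
            f (liftTo H (ν + 1) n {w}) b C' ∧
            c = (C ∩ liftTo H (ν + 1) n {w}, C' ∩ liftTo H (ν + 1) n {w'})) ∨
       (earlier H n Ω b = ∅ ∧ c = (b, Ω \ b))}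

/-- Step `n`, completed with `b_n` and the family `(Π_n(i), Γ_n(i))`. -/
def mkStage (H : ℕ → Stage Θ) (n : ℕ) (Ω : Set (World Θ))
    (f : Set (World Θ) → Set (World Θ) → Set (World Θ) → Prop) (b : Set (World Θ)) : Stage Θ :=
  ⟨Ω, f, b, cellsAt H n Ω f b⟩

/-- `Ω_0 = {0,1}^Θ`. -/
def initΩ (Θ : Type u) : Set (World Θ) := range World.val

/-- `f_0(B,∅) = f_0(B,Ω_0) = B`. -/
def initF (B A C : Set (World Θ)) : Prop :=
  B ⊆ initΩ Θ ∧ (A = ∅ ∨ A = initΩ Θ) ∧ C = B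

/-- The steps `0, …, n` of the construction, for a given sequence `(b_n)`: `history b n k` is the
step `k`, for `k ≤ n`. -/
def history (b : ℕ → Set (World Θ)) : ℕ → ℕ → Stage Θ
  | 0 => fun _ => ⟨initΩ Θ, initF, b 0, {(b 0, initΩ Θ \ b 0)}⟩
  | n + 1 => fun k =>
      if k ≤ n then history b n k
      else mkStage (history b n) (n + 1) (history b n n).nextΩ (history b n n).nextF (b (n + 1))

/-- Step `n` of the construction driven by the lists `λ_n`; `b_n = λ_n(s_n)` with `s_n = 2n`. -/
def stage (lam : ℕ → ℕ → Set (World Θ)) (n : ℕ) : Stage Θ :=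
  history (fun k => lam k (2 * k)) n n

/-- The end `s_n + card(M_n) - 2` of the index range of the list `λ_n`. -/
noncomputable def listEnd (lam : ℕ → ℕ → Set (World Θ)) (n : ℕ) : ℕ :=
  2 * n + (𝒫 (stage lam n).Ω).ncard - 2

/-- The conditions on the lists `λ_n`, defined on the indices `2n ≤ t < listEnd n`. -/
structure IsTaskList (lam : ℕ → ℕ → Set (World Θ)) : Prop where
  bij : ∀ n, BijOn (lam n) (Ico (2 * n) (listEnd lam n))
    (𝒫 (stage lam n).Ω \ {∅, (stage lam n).Ω})
  paired : ∀ n t, 2 * n ≤ 2 * t → 2 * t + 1 < listEnd lam n →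
    lam n (2 * t) = (stage lam n).Ω \ lam n (2 * t + 1)
  shift : ∀ n t, 2 * (n + 1) ≤ t → t < listEnd lam n →
    lam (n + 1) t = (stage lam n).mu (lam n t)
  last : ∀ n, lam (n + 1) (listEnd lam (n + 1) - 2) = (stage lam n).mu (stage lam n).b

/-! ### The limit model -/

/-- `Ω_∞`: the sequences `(ω_n)` with `ω_n ∈ Ω_n` and `ω_{n+1} ∈ μ_n(ω_n)`. -/
def Limit (lam : ℕ → ℕ → Set (World Θ)) : Type u :=
  {w : ℕ → World Θ // ∀ n, w n ∈ (stage lam n).Ω ∧ w (n + 1) ∈ (stage lam n).mu {w n}}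

/-- `A_∞`, for `A` a subset of `Ω_n`. -/
def atInf (lam : ℕ → ℕ → Set (World Θ)) (n : ℕ) (A : Set (World Θ)) : Set (Limit lam) :=
  {w | w.1 n ∈ A}

/-- `M_∞`. -/
def MInf (lam : ℕ → ℕ → Set (World Θ)) : Set (Set (Limit lam)) :=
  {S | ∃ n, ∃ A ⊆ (stage lam n).Ω, S = atInf lam n A}

/-- `h_∞`. -/
def hInf (lam : ℕ → ℕ → Set (World Θ)) (θ : Θ) : Set (Limit lam) :=
  atInf lam 0 {w | ∃ δ : Θ → Bool, δ θ = true ∧ w = World.val δ}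

/-- `(n, b, a, c)` represents the value at `(B,A)`: `A = a_∞`, `B = b_∞` and `f_n(b,a) = c`. -/
def Represents (lam : ℕ → ℕ → Set (World Θ)) (B A : Set (Limit lam)) (n : ℕ)
    (b a c : Set (World Θ)) : Prop :=
  a ⊆ (stage lam n).Ω ∧ b ⊆ (stage lam n).Ω ∧ A = atInf lam n a ∧ B = atInf lam n b ∧
    (stage lam n).f b a c

/-- `f_∞(B,A) = (f_n(b,a))_∞` for any `n`, `a`, `b` with `A = a_∞`, `B = b_∞` and `f_n(b,a)`
defined. -/
def fInf (lam : ℕ → ℕ → Set (World Θ)) (B A : Set (Limit lam)) : Set (Limit lam) :=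
  {w | ∃ n b a c, Represents lam B A n b a c ∧ w ∈ atInf lam n c}

/-- The assignment `H` of the Kripke model with full accessibility on `Ω_∞`. -/
def interp (lam : ℕ → ℕ → Set (World Θ)) : Form Θ → Set (Limit lam)
  | .atom θ => hInf lam θ
  | .neg φ => (interp lam φ)ᶜ
  | .imp φ ψ => (interp lam φ)ᶜ ∪ interp lam ψ
  | .box φ => {_t | ∀ w, w ∈ interp lam φ}
  | .cond ψ φ => fInf lam (interp lam ψ) (interp lam φ)

/-! ### The extension of a probability -/

open Classical in
/-- One step of the recursion on elementary weights: for `(x,y)` in `Π_n(i) × Γ_n(i)` the weight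
is `p x * p y / P_n(Γ_n(i))`, and for `(x,y)` in `Γ_n(i) × Π_n(i)` it is
`p x * p y / P_n(Π_n(i))`. -/
noncomputable def nextWeight (S : Stage Θ) (p : World Θ → ℝ) : World Θ → ℝ
  | .val _ => 0
  | .pair x y =>
      if h : ∃ c ∈ S.cells, x ∈ c.1 ∧ y ∈ c.2 then
        p x * p y / ∑ᶠ w ∈ h.choose.2, p w
      else if h : ∃ c ∈ S.cells, x ∈ c.2 ∧ y ∈ c.1 then
        p x * p y / ∑ᶠ w ∈ h.choose.1, p w
      else 0

variable [Fintype Θ] [Inhabited Θ]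

/-- `P_0(ω_∞) = π(⋀_θ θ_ω)`. -/
noncomputable def initWeight (π : CForm Θ → ℝ) : World Θ → ℝ
  | .val δ => π (CForm.state δ)
  | .pair _ _ => 0

/-- The elementary weight `P_n(ω_∞)`, for `ω ∈ Ω_n`. -/
noncomputable def weight (lam : ℕ → ℕ → Set (World Θ)) (π : CForm Θ → ℝ) :
    ℕ → World Θ → ℝ
  | 0 => initWeight π
  | n + 1 => nextWeight (stage lam n) (weight lam π n)

/-- `P_n(A_∞)`, for `A` a subset of `Ω_n`. -/
noncomputable def probAt (lam : ℕ → ℕ → Set (World Θ)) (π : CForm Θ → ℝ) (n : ℕ)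
    (A : Set (World Θ)) : ℝ := ∑ᶠ w ∈ A, weight lam π n w

open Classical in
/-- `P_∞`: the union of the `P_n`, with `P_∞(a_∞) = P_n(a_∞)` for any `n` and any subset `a` of
`Ω_n`. -/
noncomputable def probInf (lam : ℕ → ℕ → Set (World Θ)) (π : CForm Θ → ℝ)
    (S : Set (Limit lam)) : ℝ :=
  if h : ∃ q : ℕ × Set (World Θ), q.2 ⊆ (stage lam q.1).Ω ∧ S = atInf lam q.1 q.2 then
    probAt lam π h.choose.1 h.choose.2
  else 0

/-- The extension `P_∞(H(φ))` of `π` to the language of DmBL∗. -/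
noncomputable def extend (lam : ℕ → ℕ → Set (World Θ)) (π : CForm Θ → ℝ) (φ : Form Θ) : ℝ :=
  probInf lam π (interp lam φ)

/-- `P` is a finitely additive probability on the family of sets `M`. -/
structure IsProbOn {W : Type u} (M : Set (Set W)) (P : Set W → ℝ) : Prop where
  nonneg : ∀ A ∈ M, 0 ≤ P A
  additivity : ∀ A ∈ M, ∀ B ∈ M, P (A ∩ B) + P (A ∪ B) = P A + P B
  coherence : P ∅ = 0
  finiteness : P univ = 1

end Construction

/-! The map `μ_n` takes inverse images under the first projection `Ω_{n+1} → Ω_n` (`mem_mu`), so it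
is an injective Boolean morphism. The exchange `T` is an involution of `Ω_{n+1}` that swaps
`μ_n(b_n)` with its complement. For `D` one of these two halves, `f_{n+1}(B, D)` consists of the
points `w` such that the member of `{w, Tw}` lying in `D` belongs to `B` (`mem_idT_half`). In this
form the axioms of a conditional model are propositional: `B ↦ f(B, D)` is a Boolean morphism, `f(B,
D)` agrees with `B` on `D`, and `f(B, D) = B` says that `B` is invariant under `T`, a condition that
does not distinguish `D` from its complement.

The difficulty is coherence when a pair is processed again. If `ν` is the previous time, the
non-empty cells of step `n` are the fibres over `w` and over `Tw`, for `w ∈ μ_ν(b_ν)`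
(`cells_reprocess`). Hence points linked at step `n` lie over points exchanged by the old `T`
(`linked_iterate_fst`), the new conditional extends the old one (`stage_f_mu`), and the cells again
partition `b_n` and its complement (`good_step`). The lists bring every proper non-empty set to the
head after any given step (`exists_half`), so `f_∞` is total.

For the weights, the projection of `P_{n+1}` to `Ω_n` is `P_n` (`sum_mu`), and the two parts of
every cell have weights in the ratio of `b_n` to `∼b_n`. This is trivial when a pair is first
processed and is inherited through the fibres afterwards (`cells_balanced`). So a point `w` of a
half `D` carries the share `P(D)` of the weight of `{w, Tw}` (`weight_half`), and summing over `B ∩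
D` gives `P(B ∩ D) = P(D) P(f(B, D))`. Soundness of the model (`ProvStar.mem_interp`) turns this
into multiplicativity.

For arbitrary `π`, the value of the extension of `π_e` at a formula is a rational function of `e`
with values in `[0,1]`. It therefore has no pole at `0` (`IsRationalOn.exists_tendsto`), and the
conditions defining a multiplicative probability pass to the limit. Completeness of `C` serves to
reduce probabilities over `C` to their values on complete conjunctions. -/

/-! ### Completeness of the classical logic -/

/-- Derivability in `C` from a set of hypotheses. -/
inductive DerivC {Θ : Type u} (Γ : Set (CForm Θ)) : CForm Θ → Prop
  | hyp (φ : CForm Θ) : φ ∈ Γ → DerivC Γ φ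
  | prov (φ : CForm Θ) : ProvC φ → DerivC Γ φ
  | mp (φ ψ : CForm Θ) : DerivC Γ φ → DerivC Γ (.imp φ ψ) → DerivC Γ ψ

namespace DerivC

variable {Θ : Type u} {Γ Δ : Set (CForm Θ)} {φ ψ : CForm Θ}

theorem cut (h : DerivC Γ φ) (hΓ : ∀ χ ∈ Γ, DerivC Δ χ) : DerivC Δ φ := by
  induction h with
  | hyp φ h => exact hΓ φ h
  | prov φ h => exact .prov φ h
  | mp φ ψ _ _ h1 h2 => exact .mp φ ψ h1 h2

theorem mono (h : DerivC Γ φ) (hΓ : Γ ⊆ Δ) : DerivC Δ φ :=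
  h.cut fun χ hχ => .hyp χ (hΓ hχ)

theorem weaken (h : DerivC Γ φ) (ψ : CForm Θ) : DerivC (insert ψ Γ) φ :=
  h.mono (subset_insert _ _)

theorem head (φ : CForm Θ) (Γ : Set (CForm Θ)) : DerivC (insert φ Γ) φ :=
  .hyp _ (mem_insert _ _)

theorem provC (h : DerivC (∅ : Set (CForm Θ)) φ) : ProvC φ := by
  induction h with
  | hyp φ h => exact h.elim
  | prov φ h => exact h
  | mp φ ψ _ _ h1 h2 => exact .mp φ ψ h1 h2

theorem imp_self (φ : CForm Θ) : ProvC (.imp φ φ) :=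
  .mp _ _ (.c1 φ φ) (.mp _ _ (.c1 φ (.imp φ φ)) (.c2 φ (.imp φ φ) φ))

theorem deduction (h : DerivC (insert φ Γ) ψ) : DerivC Γ (.imp φ ψ) := by
  induction h with
  | hyp χ h =>
    rcases h with rfl | h
    · exact .prov _ (imp_self χ)
    · exact .mp _ _ (.hyp χ h) (.prov _ (.c1 χ φ))
  | prov χ h => exact .mp _ _ (.prov χ h) (.prov _ (.c1 χ φ))
  | mp χ η _ _ h1 h2 => exact .mp _ _ h1 (.mp _ _ h2 (.prov _ (.c2 φ χ η)))

theorem by_contra (h1 : DerivC (insert (.neg φ) Γ) ψ)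
    (h2 : DerivC (insert (.neg φ) Γ) (.neg ψ)) : DerivC Γ φ :=
  .mp _ _ h1.deduction (.mp _ _ h2.deduction (.prov _ (.c3 φ ψ)))

theorem double_neg (h : DerivC Γ (.neg (.neg φ))) : DerivC Γ φ :=
  by_contra (head _ _) (h.weaken _)

theorem neg_intro (h1 : DerivC (insert φ Γ) ψ) (h2 : DerivC (insert φ Γ) (.neg ψ)) :
    DerivC Γ (.neg φ) := by
  have key : ∀ χ ∈ insert φ Γ, DerivC (insert (.neg (.neg φ)) Γ) χ := by
    rintro χ (rfl | h)
    · exact double_neg (head _ _)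
    · exact (DerivC.hyp χ h).weaken _
  exact by_contra (h1.cut key) (h2.cut key)

theorem by_cases (h1 : DerivC (insert φ Γ) ψ) (h2 : DerivC (insert (.neg φ) Γ) ψ) :
    DerivC Γ ψ := by
  have h1' : DerivC (insert φ (insert (.neg ψ) Γ)) ψ :=
    h1.mono (insert_subset_insert (subset_insert _ _))
  have h2' : DerivC (insert (.neg φ) (insert (.neg ψ) Γ)) ψ :=
    h2.mono (insert_subset_insert (subset_insert _ _))
  exact by_contra (ψ := φ) (by_contra h2' ((head _ _).weaken _))
    (neg_intro h1' ((head _ _).weaken _))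

/-- Kalmár's lemma. Both halves are proved in one induction because negation exchanges them and
implication uses both. -/
theorem of_literals (δ : Θ → Bool) (φ : CForm Θ) :
    (φ.Holds δ → DerivC (range (CForm.literal δ)) φ) ∧
      (¬ φ.Holds δ → DerivC (range (CForm.literal δ)) (.neg φ)) := by
  induction φ with
  | atom θ =>
    have h := DerivC.hyp (Γ := range (CForm.literal δ)) _ (mem_range_self θ)
    constructor <;> intro hδ <;> simp only [CForm.Holds] at hδ <;>
      simpa [CForm.literal, hδ] using h
  | neg φ ih =>
    refine ⟨fun h => ih.2 h, fun h => ?_⟩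
    exact neg_intro ((ih.1 (not_not.1 h)).weaken _) (head _ _)
  | imp φ ψ ih1 ih2 =>
    constructor
    · intro h
      by_cases hφ : φ.Holds δ
      · exact .mp _ _ (ih2.1 (h hφ)) (.prov _ (.c1 ψ φ))
      · exact deduction (by_contra ((head φ _).weaken _) (((ih1.2 hφ).weaken _).weaken _))
    · intro h
      obtain ⟨hφ, hψ⟩ := Classical.not_imp.1 h
      exact neg_intro (.mp _ _ ((ih1.1 hφ).weaken _) (head _ _)) ((ih2.2 hψ).weaken _)

-- The derivations are available for all valuations, so the atom `a` can be given both values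
-- without touching the literals of `S`; a case distinction on `a` then discharges its literal.
open Classical in
theorem elim_literals (S : Finset Θ)
    (h : ∀ δ : Θ → Bool, DerivC (CForm.literal δ '' (S : Set Θ)) φ) :
    DerivC (∅ : Set (CForm Θ)) φ := by
  induction S using Finset.induction_on with
  | empty => simpa using h fun _ => true
  | insert a S ha ih =>
    refine ih fun δ => ?_
    have key : ∀ b : Bool, CForm.literal (Function.update δ a b) '' (S : Set Θ) =
        CForm.literal δ '' (S : Set Θ) := fun b => by
      refine image_congr fun θ hθ => ?_
      have : θ ≠ a := fun h => ha (by simpa [h] using hθ)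
      simp [CForm.literal, this]
    have h1 := h (Function.update δ a true)
    have h2 := h (Function.update δ a false)
    rw [Finset.coe_insert, image_insert_eq, key] at h1 h2
    simp only [CForm.literal, Function.update_self] at h1 h2
    exact by_cases (φ := .atom a) h1 (by simpa using h2)

end DerivC

theorem ProvC.holds {Θ : Type u} {φ : CForm Θ} (h : ProvC φ) (δ : Θ → Bool) : φ.Holds δ := by
  induction h with
  | c1 φ ψ => simp only [CForm.Holds]; tauto
  | c2 η φ ψ => simp only [CForm.Holds]; tauto
  | c3 φ ψ => simp only [CForm.Holds]; tauto
  | mp φ ψ _ _ h1 h2 => exact h2 h1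

theorem provC_iff_holds {Θ : Type u} [Fintype Θ] {φ : CForm Θ} :
    ProvC φ ↔ ∀ δ, φ.Holds δ := by
  refine ⟨fun h δ => h.holds δ, fun h => DerivC.provC ?_⟩
  refine DerivC.elim_literals Finset.univ fun δ => ?_
  simpa using (DerivC.of_literals δ φ).1 (h δ)

namespace CForm

variable {Θ : Type u} (δ : Θ → Bool)

theorem holds_or (φ ψ : CForm Θ) : (or φ ψ).Holds δ ↔ φ.Holds δ ∨ ψ.Holds δ := by
  simp only [or, Holds]; tauto

theorem holds_and (φ ψ : CForm Θ) : (and φ ψ).Holds δ ↔ φ.Holds δ ∧ ψ.Holds δ := by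
  simp only [and, or, Holds]; tauto

theorem holds_iff (φ ψ : CForm Θ) : (iff φ ψ).Holds δ ↔ (φ.Holds δ ↔ ψ.Holds δ) := by
  simp only [iff, holds_and, Holds]; tauto

theorem holds_top [Inhabited Θ] : (top : CForm Θ).Holds δ := id

theorem not_holds_bot [Inhabited Θ] : ¬ (bot : CForm Θ).Holds δ := not_not_intro (holds_top δ)

theorem holds_literal (δ δ' : Θ → Bool) (θ : Θ) : (literal δ θ).Holds δ' ↔ δ θ = δ' θ := by
  unfold literal
  cases h : δ θ <;> cases h' : δ' θ <;> simp [Holds, h']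

theorem holds_state [Fintype Θ] [Inhabited Θ] (δ δ' : Θ → Bool) :
    (state δ).Holds δ' ↔ δ = δ' := by
  have key : ∀ l : List Θ, (l.foldr (fun θ φ => and (literal δ θ) φ) top).Holds δ' ↔
      ∀ θ ∈ l, δ θ = δ' θ := fun l => by
    induction l with
    | nil => simpa using holds_top δ'
    | cons a l ih => simp [holds_and, holds_literal, ih]
  rw [state, key, funext_iff]
  simp

end CForm

/-! ### Probabilities over the classical logic -/

section

variable {Θ : Type u} [Fintype Θ] [Inhabited Θ]

namespace IsProbC

variable {π : CForm Θ → ℝ}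

theorem congr_holds (hπ : IsProbC π) {φ ψ : CForm Θ} (h : ∀ δ, φ.Holds δ ↔ ψ.Holds δ) :
    π φ = π ψ :=
  hπ.equivalence _ _ (provC_iff_holds.2 fun δ => (CForm.holds_iff δ φ ψ).2 (h δ))

-- Distinct complete conjunctions exclude each other, so `π` adds up along a disjunction of them. By
-- completeness every formula is equivalent to such a disjunction, whence `eq_sum`.
open Classical in
theorem exists_eq_sum (hπ : IsProbC π) (S : Finset (Θ → Bool)) :
    ∃ φ : CForm Θ, (∀ δ, φ.Holds δ ↔ δ ∈ S) ∧ π φ = ∑ δ ∈ S, π (CForm.state δ) := by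
  induction S using Finset.induction_on with
  | empty => exact ⟨.bot, fun δ => by simpa using CForm.not_holds_bot δ, by simpa using hπ.coherence⟩
  | insert a S ha ih =>
    obtain ⟨φ, hφ, hs⟩ := ih
    refine ⟨.or (CForm.state a) φ, fun δ => ?_, ?_⟩
    · rw [CForm.holds_or, CForm.holds_state, hφ, Finset.mem_insert, eq_comm]
    · have h1 := hπ.additivity (CForm.state a) φ
      have h2 : π (.and (CForm.state a) φ) = π .bot := hπ.congr_holds fun δ => by
        rw [CForm.holds_and, CForm.holds_state, hφ]
        refine iff_of_false ?_ (CForm.not_holds_bot δ)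
        rintro ⟨rfl, h⟩
        exact ha h
      rw [h2, hπ.coherence, zero_add] at h1
      rw [h1, hs, Finset.sum_insert ha]

open Classical in
theorem eq_sum (hπ : IsProbC π) (φ : CForm Θ) :
    π φ = ∑ δ : Θ → Bool, if φ.Holds δ then π (CForm.state δ) else 0 := by
  obtain ⟨ψ, hψ, hs⟩ := hπ.exists_eq_sum (Finset.univ.filter fun δ => φ.Holds δ)
  rw [hπ.congr_holds (ψ := ψ) fun δ => by simp [hψ], hs, Finset.sum_filter]

open Classical in
theorem sum_state (hπ : IsProbC π) : ∑ δ : Θ → Bool, π (CForm.state δ) = 1 := by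
  have h := hπ.eq_sum .top
  rw [hπ.finiteness] at h
  simpa [CForm.holds_top] using h.symm

theorem state_pos (hπ : StrictlyPositive π) (δ : Θ → Bool) : 0 < π (CForm.state δ) := by
  refine hπ _ fun h => ?_
  have := (CForm.holds_iff δ _ _).1 (h.holds δ)
  exact CForm.not_holds_bot δ (this.1 ((CForm.holds_state δ δ).2 rfl))

end IsProbC

open Classical in
theorem isProbC_sum (g : (Θ → Bool) → ℝ) (h0 : ∀ δ, 0 ≤ g δ) (h1 : ∑ δ, g δ = 1) :
    IsProbC fun φ : CForm Θ => ∑ δ : Θ → Bool, if φ.Holds δ then g δ else 0 where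
  nonneg φ := Finset.sum_nonneg fun δ _ => by split_ifs <;> simp [h0]
  equivalence φ ψ h := by
    refine Finset.sum_congr rfl fun δ _ => ?_
    rw [if_congr ((CForm.holds_iff δ φ ψ).1 (h.holds δ)) rfl rfl]
  additivity φ ψ := by
    simp only [← Finset.sum_add_distrib, CForm.holds_and, CForm.holds_or]
    refine Finset.sum_congr rfl fun δ _ => ?_
    by_cases a : φ.Holds δ <;> by_cases b : ψ.Holds δ <;> simp [a, b]
  coherence := by simp [CForm.not_holds_bot]
  finiteness := by simpa [CForm.holds_top] using h1

open Classical in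
theorem sum_perturbed_states {π : CForm Θ → ℝ} (hπ : IsProbC π) (e : ℝ) :
    ∑ δ : Θ → Bool, (e / 2 ^ Fintype.card Θ + (1 - e) * π (CForm.state δ)) = 1 := by
  rw [Finset.sum_add_distrib, ← Finset.mul_sum, hπ.sum_state]
  simp
  field_simp
  ring_nf

theorem perturbed_state_pos {π : CForm Θ → ℝ} (hπ : IsProbC π) {e : ℝ} (he : e ∈ Ioc (0 : ℝ) 1)
    (δ : Θ → Bool) : 0 < e / 2 ^ Fintype.card Θ + (1 - e) * π (CForm.state δ) := by
  have h1 : 0 < e / 2 ^ Fintype.card Θ := div_pos he.1 (by positivity)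
  have h2 : 0 ≤ (1 - e) * π (CForm.state δ) :=
    mul_nonneg (by linarith [he.2]) (hπ.nonneg _)
  linarith

open Classical in
theorem perturb_isProbC {π : CForm Θ → ℝ} (hπ : IsProbC π) {e : ℝ} (he : e ∈ Ioc (0 : ℝ) 1) :
    IsProbC (perturb π e) :=
  isProbC_sum _ (fun δ => (perturbed_state_pos hπ he δ).le) (sum_perturbed_states hπ e)

open Classical in
theorem perturb_strictlyPositive {π : CForm Θ → ℝ} (hπ : IsProbC π) {e : ℝ}
    (he : e ∈ Ioc (0 : ℝ) 1) : StrictlyPositive (perturb π e) := by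
  intro φ h
  have h' : ∃ δ, φ.Holds δ := by
    by_contra! hn
    exact h (provC_iff_holds.2 fun δ => (CForm.holds_iff δ _ _).2
      (iff_of_false (hn δ) (CForm.not_holds_bot δ)))
  obtain ⟨δ, hδ⟩ := h'
  refine Finset.sum_pos' (fun δ _ => ?_) ⟨δ, Finset.mem_univ _, ?_⟩
  · split_ifs
    exacts [(perturbed_state_pos hπ he δ).le, le_rfl]
  · rw [if_pos hδ]
    exact perturbed_state_pos hπ he δ

theorem perturb_state (π : CForm Θ → ℝ) (e : ℝ) (δ : Θ → Bool) :
    perturb π e (CForm.state δ) = e / 2 ^ Fintype.card Θ + (1 - e) * π (CForm.state δ) := by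
  simp [perturb, CForm.holds_state]

theorem eq_perturb {π π' : CForm Θ → ℝ} {e : ℝ} (hπ' : IsProbC π')
    (h : ∀ δ : Θ → Bool, π' (CForm.state δ) =
      e / 2 ^ Fintype.card Θ + (1 - e) * π (CForm.state δ)) : π' = perturb π e := by
  funext φ
  rw [hπ'.eq_sum, perturb]
  simp only [h]

theorem tendsto_perturb {π : CForm Θ → ℝ} (hπ : IsProbC π) (φ : CForm Θ) :
    Tendsto (fun e => perturb π e φ) (𝓝[>] 0) (𝓝 (π φ)) := by
  have h : Continuous fun e => perturb π e φ := by
    unfold perturb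
    refine continuous_finsetSum _ fun δ _ => ?_
    split_ifs <;> fun_prop
  have h0 : perturb π 0 φ = π φ := by
    rw [hπ.eq_sum]
    simp [perturb]
  rw [← h0]
  exact (h.tendsto 0).mono_left nhdsWithin_le_nhds

end

/-! ### One step of the construction -/

namespace World

variable {Θ : Type u}

/-- First component of a pair. -/
def fst : World Θ → World Θ
  | val δ => val δ
  | pair x _ => x

@[simp] theorem fst_pair (x y : World Θ) : (pair x y).fst = x := rfl

@[simp] theorem swap_pair (x y : World Θ) : (pair x y).swap = pair y x := rfl

@[simp] theorem swap_swap (w : World Θ) : w.swap.swap = w := by cases w <;> rfl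

theorem mem_swap_image {A : Set (World Θ)} {w : World Θ} : w ∈ swap '' A ↔ w.swap ∈ A := by
  constructor
  · rintro ⟨v, hv, rfl⟩
    simpa using hv
  · exact fun h => ⟨_, h, swap_swap w⟩

@[simp] theorem mem_idT {A : Set (World Θ)} {w : World Θ} : w ∈ idT A ↔ w ∈ A ∨ w.swap ∈ A := by
  rw [idT, mem_union, mem_swap_image]

theorem mem_prod {A B : Set (World Θ)} {x y : World Θ} : pair x y ∈ prod A B ↔ x ∈ A ∧ y ∈ B := by
  simp [prod]

theorem val_notMem_prod {A B : Set (World Θ)} {δ : Θ → Bool} : val δ ∉ prod A B := by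
  simp [prod]

end World

namespace Stage

open World

variable {Θ : Type u}

/-- A step in which `b` is a proper non-empty part of a finite `Ω`, and in which the `Π_i` partition
`b` and the `Γ_i` partition `∼b`. -/
structure Good (S : Stage Θ) : Prop where
  finite : S.Ω.Finite
  b_subset : S.b ⊆ S.Ω
  b_nonempty : S.b.Nonempty
  compl_nonempty : (S.Ω \ S.b).Nonempty
  fst_subset : ∀ c ∈ S.cells, c.1 ⊆ S.b
  snd_subset : ∀ c ∈ S.cells, c.2 ⊆ S.Ω \ S.b
  -- Cells with both parts empty do occur, since a reprocessed pair is indexed by all `(ω, ω')`; a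
  -- cell with one empty part would leave points without partner.
  nonempty_iff : ∀ c ∈ S.cells, c.1.Nonempty ↔ c.2.Nonempty
  exists_fst : ∀ x ∈ S.b, ∃ c ∈ S.cells, x ∈ c.1
  exists_snd : ∀ x ∈ S.Ω \ S.b, ∃ c ∈ S.cells, x ∈ c.2
  fst_unique : ∀ c ∈ S.cells, ∀ d ∈ S.cells, ∀ x ∈ c.1, x ∈ d.1 → c = d
  snd_unique : ∀ c ∈ S.cells, ∀ d ∈ S.cells, ∀ x ∈ c.2, x ∈ d.2 → c = d

/-- `x` and `y` are in opposite parts of the same cell. -/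
def Linked (S : Stage Θ) (x y : World Θ) : Prop :=
  ∃ c ∈ S.cells, (x ∈ c.1 ∧ y ∈ c.2) ∨ (x ∈ c.2 ∧ y ∈ c.1)

theorem Linked.symm {S : Stage Θ} {x y : World Θ} (h : S.Linked x y) : S.Linked y x := by
  obtain ⟨c, hc, h⟩ := h
  exact ⟨c, hc, by tauto⟩

theorem pair_mem_mu {S : Stage Θ} {A : Set (World Θ)} {x y : World Θ} :
    pair x y ∈ S.mu A ↔ x ∈ A ∧ S.Linked x y := by
  simp only [mu, mem_iUnion, mem_union, World.mem_prod, mem_inter_iff, Linked, exists_prop]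
  constructor
  · rintro ⟨c, hc, h⟩
    exact ⟨by tauto, c, hc, by tauto⟩
  · rintro ⟨hx, c, hc, h⟩
    exact ⟨c, hc, by tauto⟩

theorem val_notMem_mu {S : Stage Θ} {A : Set (World Θ)} {δ : Θ → Bool} : val δ ∉ S.mu A := by
  simp [mu, val_notMem_prod]

namespace Good

variable {S : Stage Θ}

theorem linked_mem (hS : S.Good) {x y : World Θ} (h : S.Linked x y) : x ∈ S.Ω := by
  obtain ⟨c, hc, h | h⟩ := h
  · exact hS.b_subset (hS.fst_subset c hc h.1)
  · exact (hS.snd_subset c hc h.1).1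

theorem linked_opposite (hS : S.Good) {x y : World Θ} (h : S.Linked x y) :
    y ∈ S.b ↔ x ∉ S.b := by
  obtain ⟨c, hc, h | h⟩ := h
  · exact iff_of_false (hS.snd_subset c hc h.2).2 (not_not_intro (hS.fst_subset c hc h.1))
  · exact iff_of_true (hS.fst_subset c hc h.2) (hS.snd_subset c hc h.1).2

theorem exists_linked (hS : S.Good) {x : World Θ} (hx : x ∈ S.Ω) : ∃ y, S.Linked x y := by
  by_cases h : x ∈ S.b
  · obtain ⟨c, hc, hxc⟩ := hS.exists_fst x h
    obtain ⟨y, hy⟩ := (hS.nonempty_iff c hc).1 ⟨x, hxc⟩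
    exact ⟨y, c, hc, .inl ⟨hxc, hy⟩⟩
  · obtain ⟨c, hc, hxc⟩ := hS.exists_snd x ⟨hx, h⟩
    obtain ⟨y, hy⟩ := (hS.nonempty_iff c hc).2 ⟨x, hxc⟩
    exact ⟨y, c, hc, .inr ⟨hxc, hy⟩⟩

theorem pair_mem_nextΩ (hS : S.Good) {x y : World Θ} : pair x y ∈ S.nextΩ ↔ S.Linked x y := by
  rw [nextΩ, pair_mem_mu]
  exact ⟨fun h => h.2, fun h => ⟨hS.linked_mem h, h⟩⟩

/-- `μ` is the inverse image under the first projection, which is onto by `exists_fst_eq`. All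
Boolean properties of `μ` and its injectivity come from these two facts. -/
theorem mem_mu (hS : S.Good) {A : Set (World Θ)} {w : World Θ} :
    w ∈ S.mu A ↔ w ∈ S.nextΩ ∧ w.fst ∈ A := by
  cases w with
  | val δ => exact iff_of_false val_notMem_mu fun h => val_notMem_mu h.1
  | pair x y => rw [pair_mem_mu, hS.pair_mem_nextΩ, fst_pair, and_comm]

theorem fst_mem (hS : S.Good) {w : World Θ} (h : w ∈ S.nextΩ) : w.fst ∈ S.Ω :=
  (hS.mem_mu.1 h).2

theorem swap_mem (hS : S.Good) {w : World Θ} (h : w ∈ S.nextΩ) : w.swap ∈ S.nextΩ := by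
  cases w with
  | val δ => exact h
  | pair x y => exact hS.pair_mem_nextΩ.2 (hS.pair_mem_nextΩ.1 h).symm

theorem swap_fst_mem_b (hS : S.Good) {w : World Θ} (h : w ∈ S.nextΩ) :
    w.swap.fst ∈ S.b ↔ w.fst ∉ S.b := by
  cases w with
  | val δ => exact (val_notMem_mu h).elim
  | pair x y => exact hS.linked_opposite (hS.pair_mem_nextΩ.1 h)

theorem exists_fst_eq (hS : S.Good) {x : World Θ} (hx : x ∈ S.Ω) : ∃ w ∈ S.nextΩ, w.fst = x := by
  obtain ⟨y, h⟩ := hS.exists_linked hx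
  exact ⟨_, hS.pair_mem_nextΩ.2 h, rfl⟩

theorem mu_subset (hS : S.Good) (A : Set (World Θ)) : S.mu A ⊆ S.nextΩ :=
  fun _ h => (hS.mem_mu.1 h).1

theorem mu_empty : S.mu ∅ = ∅ := by simp [mu, World.prod]

theorem mu_diff (hS : S.Good) (A : Set (World Θ)) : S.mu (S.Ω \ A) = S.nextΩ \ S.mu A := by
  ext w
  simp only [hS.mem_mu, Set.mem_sdiff]
  have := hS.fst_mem (w := w)
  tauto

theorem subset_of_mu_subset (hS : S.Good) {A B : Set (World Θ)} (hA : A ⊆ S.Ω)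
    (h : S.mu A ⊆ S.mu B) : A ⊆ B := by
  intro x hx
  obtain ⟨w, hw, rfl⟩ := hS.exists_fst_eq (hA hx)
  exact (hS.mem_mu.1 (h (hS.mem_mu.2 ⟨hw, hx⟩))).2

theorem mu_injOn (hS : S.Good) : InjOn S.mu (𝒫 S.Ω) := fun _ hA _ hB h =>
  (hS.subset_of_mu_subset hA h.subset).antisymm (hS.subset_of_mu_subset hB h.symm.subset)

theorem mu_inj (hS : S.Good) {A B : Set (World Θ)} (hA : A ⊆ S.Ω) (hB : B ⊆ S.Ω) :
    S.mu A = S.mu B ↔ A = B := hS.mu_injOn.eq_iff hA hB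

theorem mu_eq_empty (hS : S.Good) {A : Set (World Θ)} (hA : A ⊆ S.Ω) : S.mu A = ∅ ↔ A = ∅ := by
  rw [← hS.mu_inj hA (empty_subset _), mu_empty]

theorem nextΩ_finite (hS : S.Good) : S.nextΩ.Finite := by
  refine ((hS.finite.prod hS.finite).image fun p => pair p.1 p.2).subset ?_
  intro w h
  cases w with
  | val δ => exact (val_notMem_mu h).elim
  | pair x y =>
    have h := hS.pair_mem_nextΩ.1 h
    exact ⟨(x, y), ⟨hS.linked_mem h, hS.linked_mem h.symm⟩, rfl⟩

theorem ncard_le (hS : S.Good) : S.Ω.ncard ≤ S.nextΩ.ncard := by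
  have : S.Ω ⊆ fst '' S.nextΩ := fun x hx => hS.exists_fst_eq hx
  exact (ncard_le_ncard this (hS.nextΩ_finite.image _)).trans (ncard_image_le hS.nextΩ_finite)

theorem nontrivial_b (hS : S.Good) : S.b ≠ ∅ ∧ S.b ≠ S.Ω := by
  refine ⟨hS.b_nonempty.ne_empty, fun h => ?_⟩
  have := hS.compl_nonempty
  simp [h] at this

/-- With its companion below, this puts the two middle clauses of `nextF` in the common form `idT (B
∩ D)` for a half `D`. -/
theorem iUnion_fst_snd (hS : S.Good) : ⋃ c ∈ S.cells, World.prod c.1 c.2 = S.mu S.b := by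
  ext w
  cases w with
  | val δ => simp [val_notMem_prod, val_notMem_mu]
  | pair x y =>
    simp only [mem_iUnion, World.mem_prod, pair_mem_mu, exists_prop, Linked]
    constructor
    · rintro ⟨c, hc, h⟩
      exact ⟨hS.fst_subset c hc h.1, c, hc, .inl h⟩
    · rintro ⟨hx, c, hc, h | h⟩
      · exact ⟨c, hc, h⟩
      · exact ((hS.snd_subset c hc h.1).2 hx).elim

theorem iUnion_snd_fst (hS : S.Good) : ⋃ c ∈ S.cells, World.prod c.2 c.1 = S.nextΩ \ S.mu S.b := by
  rw [← hS.mu_diff]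
  ext w
  cases w with
  | val δ => simp [val_notMem_prod, val_notMem_mu]
  | pair x y =>
    simp only [mem_iUnion, World.mem_prod, pair_mem_mu, exists_prop, Linked]
    constructor
    · rintro ⟨c, hc, h⟩
      exact ⟨hS.snd_subset c hc h.1, c, hc, .inr h⟩
    · rintro ⟨hx, c, hc, h | h⟩
      · exact (hx.2 (hS.fst_subset c hc h.1)).elim
      · exact ⟨c, hc, h⟩

end Good

/-- `D` is one of the two propositions `μ(b)`, `∼μ(b)` processed by the step. -/
def IsHalf (S : Stage Θ) (D : Set (World Θ)) : Prop :=
  D = S.mu S.b ∨ D = S.nextΩ \ S.mu S.b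

namespace Good

variable {S : Stage Θ} {A B C D : Set (World Θ)}

theorem half_subset (hS : S.Good) (hD : S.IsHalf D) : D ⊆ S.nextΩ := by
  rcases hD with rfl | rfl
  exacts [hS.mu_subset _, sdiff_subset]

theorem half_ne (hS : S.Good) (hD : S.IsHalf D) : D ≠ ∅ ∧ D ≠ S.nextΩ := by
  have h1 := (hS.mu_eq_empty hS.b_subset).not.2 hS.nontrivial_b.1
  have h2 : S.mu S.b ≠ S.nextΩ := (hS.mu_inj hS.b_subset Subset.rfl).not.2 hS.nontrivial_b.2
  rcases hD with rfl | rfl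
  · exact ⟨h1, h2⟩
  · refine ⟨fun h => h2 ((hS.mu_subset _).antisymm (sdiff_eq_empty.1 h)), fun h => h1 ?_⟩
    rw [sdiff_eq_left] at h
    exact h.symm.eq_bot_of_le (hS.mu_subset _)

/-- The two components of a point of `Ω_{n+1}` lie on opposite sides of `b_n`, and the side of the
first one decides the half. -/
theorem swap_mem_half (hS : S.Good) (hD : S.IsHalf D) {w : World Θ} (hw : w ∈ S.nextΩ) :
    w.swap ∈ D ↔ w ∉ D := by
  have h1 := hS.swap_fst_mem_b hw
  have h2 := hS.swap_mem hw
  rcases hD with rfl | rfl <;> simp only [Set.mem_sdiff, hS.mem_mu] <;> tauto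

theorem half_compl (hS : S.Good) (hD : S.IsHalf D) : S.IsHalf (S.nextΩ \ D) := by
  rcases hD with rfl | rfl
  · exact .inr rfl
  · exact .inl (sdiff_sdiff_cancel_left (hS.mu_subset _))

theorem idT_subset (hS : S.Good) (hB : B ⊆ S.nextΩ) : idT B ⊆ S.nextΩ := by
  intro w hw
  rcases mem_idT.1 hw with h | h
  · exact hB h
  · simpa using hS.swap_mem (hB h)

theorem half_ne_mu (hS : S.Good) (hD : S.IsHalf D) (hA : A ⊆ S.Ω) (h1 : A ≠ S.b)
    (h2 : A ≠ S.Ω \ S.b) : D ≠ S.mu A := by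
  rcases hD with rfl | rfl
  · exact fun h => h1 ((hS.mu_inj hA hS.b_subset).1 h.symm)
  · rw [← hS.mu_diff]
    exact fun h => h2 ((hS.mu_inj hA sdiff_subset).1 h.symm)

/-- The clauses of `nextF` exclude each other: a half is neither trivial nor the image of a set
other than `b` and `∼b`. This makes the graph a partial function and allows reading it off one
clause at a time. -/
theorem nextF_half (hS : S.Good) (hD : S.IsHalf D) :
    S.nextF B D C ↔ B ⊆ S.nextΩ ∧ C = idT (B ∩ D) := by
  have hne := hS.half_ne hD
  have hdis : S.mu S.b ≠ S.nextΩ \ S.mu S.b := fun h => by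
    obtain ⟨x, hx⟩ := nonempty_iff_ne_empty.2 (hS.half_ne (.inl rfl)).1
    exact (h.subset hx).2 hx
  constructor
  · rintro (⟨-, h | h, -⟩ | ⟨hB, h, hC⟩ | ⟨hB, h, hC⟩ |
      ⟨B₀, A₀, C₀, -, hA, hb, hb', -, -, -, -, h, -⟩)
    · exact (hne.1 h).elim
    · exact (hne.2 h).elim
    · rw [hS.iUnion_fst_snd] at hC
      exact ⟨hB, by rw [hC, h]⟩
    · rw [hS.iUnion_snd_fst] at hC
      exact ⟨hB, by rw [hC, h]⟩
    · exact (hS.half_ne_mu hD hA hb hb' h).elim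
  · rintro ⟨hB, hC⟩
    rcases hD with rfl | rfl
    · exact .inr (.inl ⟨hB, rfl, by rw [hC, hS.iUnion_fst_snd]⟩)
    · exact .inr (.inr (.inl ⟨hB, rfl, by rw [hC, hS.iUnion_snd_fst]⟩))

theorem nextF_trivial (hS : S.Good) (hA : A = ∅ ∨ A = S.nextΩ) :
    S.nextF B A C ↔ B ⊆ S.nextΩ ∧ C = B := by
  have key : ∀ D, S.IsHalf D → A ≠ D := by
    rintro D hD rfl
    have := hS.half_ne hD
    tauto
  constructor
  · rintro (⟨hB, -, hC⟩ | ⟨-, h, -⟩ | ⟨-, h, -⟩ | ⟨B₀, A₀, C₀, -, hA₀, -, -, h1, h2, -, -, rfl, -⟩)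
    · exact ⟨hB, hC⟩
    · exact (key _ (.inl rfl) h).elim
    · exact (key _ (.inr rfl) h).elim
    · rw [hS.mu_eq_empty hA₀, nextΩ, hS.mu_inj hA₀ Subset.rfl] at hA
      tauto
  · exact fun h => .inl ⟨h.1, hA, h.2⟩

theorem nextF_mu (hS : S.Good) (hA : A ⊆ S.Ω) (h1 : A ≠ S.b) (h2 : A ≠ S.Ω \ S.b) (h3 : A ≠ ∅)
    (h4 : A ≠ S.Ω) : S.nextF B (S.mu A) C ↔
      ∃ B₀ C₀, B₀ ⊆ S.Ω ∧ S.f B₀ A C₀ ∧ B = S.mu B₀ ∧ C = S.mu C₀ := by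
  constructor
  · rintro (⟨-, h | h, -⟩ | ⟨-, h, -⟩ | ⟨-, h, -⟩ |
      ⟨B₀, A₀, C₀, hB₀, hA₀, -, -, -, -, hf, hB, h, hC⟩)
    · exact (h3 ((hS.mu_eq_empty hA).1 h)).elim
    · exact (h4 ((hS.mu_inj hA Subset.rfl).1 h)).elim
    · exact (hS.half_ne_mu (.inl rfl) hA h1 h2 h.symm).elim
    · exact (hS.half_ne_mu (.inr rfl) hA h1 h2 h.symm).elim
    · obtain rfl := (hS.mu_inj hA hA₀).1 h
      exact ⟨B₀, C₀, hB₀, hf, hB, hC⟩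
  · rintro ⟨B₀, C₀, hB₀, hf, hB, hC⟩
    exact .inr (.inr (.inr ⟨B₀, A, C₀, hB₀, hA, h1, h2, h3, h4, hf, hB, rfl, hC⟩))

end Good

end Stage

/-! ### The sequence of steps -/

section Sequence

open World

variable {Θ : Type u}

theorem history_of_le (b : ℕ → Set (World Θ)) {k n : ℕ} (h : k ≤ n) :
    history b n k = history b k k := by
  induction n with
  | zero => rw [Nat.le_zero.1 h]
  | succ n ih =>
    rcases h.eq_or_lt with rfl | h
    · rfl
    · rw [← ih (Nat.lt_succ_iff.1 h)]
      exact if_pos (Nat.lt_succ_iff.1 h)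

theorem liftTo_congr {H H' : ℕ → Stage Θ} {n : ℕ} (h : ∀ k < n, H k = H' k) (m : ℕ)
    (A : Set (World Θ)) : liftTo H m n A = liftTo H' m n A := by
  induction n with
  | zero => rfl
  | succ n ih => simp only [liftTo, ih fun k hk => h k (by omega), h n (by omega)]

theorem cellsAt_congr {H H' : ℕ → Stage Θ} {n : ℕ} (h : ∀ k < n, H k = H' k)
    (Ω : Set (World Θ)) (f : Set (World Θ) → Set (World Θ) → Set (World Θ) → Prop)
    (b : Set (World Θ)) : cellsAt H n Ω f b = cellsAt H' n Ω f b := by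
  have h1 : earlier H n Ω b = earlier H' n Ω b := by
    ext m
    simp only [earlier, mem_ofPred_eq]
    refine and_congr_right fun hm => ?_
    rw [liftTo_congr h, h m hm]
  ext c
  simp only [cellsAt, mem_ofPred_eq, h1, liftTo_congr h]
  refine or_congr_left (exists_congr fun ν => and_congr_right fun hν => ?_)
  rw [h ν hν.1.1]

variable (lam : ℕ → ℕ → Set (World Θ))

/-- The cells of step `n + 1` consult only steps up to `n`, where the truncated history agrees with
`stage lam`. -/
theorem stage_succ (n : ℕ) : stage lam (n + 1) = mkStage (stage lam) (n + 1)
    (stage lam n).nextΩ (stage lam n).nextF (lam (n + 1) (2 * (n + 1))) := by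
  have h : stage lam (n + 1) = mkStage (history (fun k => lam k (2 * k)) n) (n + 1)
      (stage lam n).nextΩ (stage lam n).nextF (lam (n + 1) (2 * (n + 1))) :=
    if_neg (Nat.not_succ_le_self n)
  rw [h, mkStage, mkStage, cellsAt_congr]
  exact fun k hk => history_of_le _ (Nat.lt_succ_iff.1 hk)

theorem stage_Ω_succ (n : ℕ) : (stage lam (n + 1)).Ω = (stage lam n).nextΩ := by
  rw [stage_succ]; rfl

theorem stage_f_succ (n : ℕ) : (stage lam (n + 1)).f = (stage lam n).nextF := by
  rw [stage_succ]; rfl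

theorem stage_b (n : ℕ) : (stage lam n).b = lam n (2 * n) := by
  cases n with
  | zero => rfl
  | succ n => rw [stage_succ]; rfl

theorem liftTo_self (H : ℕ → Stage Θ) (n : ℕ) (A : Set (World Θ)) : liftTo H n n A = A := by
  cases n with
  | zero => rfl
  | succ n => exact if_neg (Nat.not_succ_le_self n)

theorem liftTo_succ (H : ℕ → Stage Θ) {m n : ℕ} (h : m ≤ n) (A : Set (World Θ)) :
    liftTo H m (n + 1) A = (H n).mu (liftTo H m n A) := if_pos h

theorem liftTo_mu (H : ℕ → Stage Θ) {m n : ℕ} (h : m < n) (A : Set (World Θ)) :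
    liftTo H (m + 1) n ((H m).mu A) = liftTo H m n A := by
  induction n, h using Nat.le_induction with
  | base => rw [liftTo_self, liftTo_succ H le_rfl, liftTo_self]
  | succ n h ih => rw [liftTo_succ H h, ih, liftTo_succ H (by omega)]

theorem liftTo_liftTo (H : ℕ → Stage Θ) {k m n : ℕ} (h : k ≤ m) (h' : m ≤ n)
    (A : Set (World Θ)) : liftTo H m n (liftTo H k m A) = liftTo H k n A := by
  induction n, h' using Nat.le_induction with
  | base => rw [liftTo_self]
  | succ n h' ih => rw [liftTo_succ H h', ih, liftTo_succ H (by omega)]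

/-- Nothing precedes step `0`, so its explicit single cell is the first-time case of `cellsAt`. -/
theorem stage_cells (n : ℕ) : (stage lam n).cells =
    cellsAt (stage lam) n (stage lam n).Ω (stage lam n).f (stage lam n).b := by
  cases n with
  | zero =>
    have h : ∀ Ω b, earlier (stage lam) 0 Ω b = ∅ := fun Ω b =>
      eq_empty_of_forall_notMem fun m hm => Nat.not_lt_zero m hm.1
    ext c
    simp only [cellsAt, h, mem_ofPred_eq, true_and]
    refine ⟨fun hc => .inr hc, ?_⟩
    rintro (⟨ν, hν, -⟩ | hc)
    · exact hν.1.elim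
    · exact hc
  | succ n => rw [stage_succ]; rfl

variable {lam}

theorem stage_congr {lam' : ℕ → ℕ → Set (World Θ)} {n : ℕ} (h : ∀ k ≤ n, lam k = lam' k) :
    stage lam n = stage lam' n := by
  induction n using Nat.strong_induction_on with
  | _ n ih =>
    cases n with
    | zero =>
      simp only [stage, history]
      rw [h 0 le_rfl]
    | succ n =>
      have h' : ∀ k < n + 1, stage lam k = stage lam' k := fun k hk =>
        ih k hk fun j hj => h j (by omega)
      rw [stage_succ, stage_succ, mkStage, mkStage, cellsAt_congr h', h' n (by omega),
        h (n + 1) le_rfl]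

/-- The strict inequality matters: `Ω_n` does not depend on `λ_n`, so `λ_n` can be chosen once the
earlier lists are fixed. -/
theorem stage_Ω_congr {lam' : ℕ → ℕ → Set (World Θ)} {n : ℕ} (h : ∀ k < n, lam k = lam' k) :
    (stage lam n).Ω = (stage lam' n).Ω := by
  cases n with
  | zero => rfl
  | succ n => rw [stage_Ω_succ, stage_Ω_succ, stage_congr fun k hk => h k (by omega)]

/-! ### Lifting sets along the iterated first projection. -/

section Lift

variable {n : ℕ} (hG : ∀ k < n, (stage lam k).Good)
include hG

theorem iterate_fst_mem {m : ℕ} (h : m ≤ n) {w : World Θ} (hw : w ∈ (stage lam n).Ω) :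
    fst^[n - m] w ∈ (stage lam m).Ω := by
  induction n, h using Nat.le_induction generalizing w with
  | base => simpa using hw
  | succ n h ih =>
    rw [Nat.succ_sub h, Function.iterate_succ_apply]
    rw [stage_Ω_succ] at hw
    exact ih (fun k hk => hG k (by omega)) ((hG n (by omega)).fst_mem hw)

/-- `A_{[n]}` is the inverse image of `A` under the `(n - m)`-fold first projection; the Boolean
properties of lifting follow. -/
theorem mem_liftTo {m : ℕ} (h : m ≤ n) {A : Set (World Θ)} (hA : A ⊆ (stage lam m).Ω)
    {w : World Θ} :
    w ∈ liftTo (stage lam) m n A ↔ w ∈ (stage lam n).Ω ∧ fst^[n - m] w ∈ A := by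
  induction n, h using Nat.le_induction generalizing w with
  | base =>
    rw [liftTo_self, Nat.sub_self]
    exact ⟨fun h => ⟨hA h, h⟩, fun h => h.2⟩
  | succ n h ih =>
    have hn := hG n (by omega)
    rw [liftTo_succ _ h, hn.mem_mu, ih fun k hk => hG k (by omega), Nat.succ_sub h,
      Function.iterate_succ_apply, stage_Ω_succ]
    have := hn.fst_mem (w := w)
    tauto

theorem exists_iterate_fst {m : ℕ} (h : m ≤ n) {x : World Θ} (hx : x ∈ (stage lam m).Ω) :
    ∃ w ∈ (stage lam n).Ω, fst^[n - m] w = x := by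
  induction n, h using Nat.le_induction with
  | base => exact ⟨x, hx, by simp⟩
  | succ n h ih =>
    obtain ⟨v, hv, rfl⟩ := ih fun k hk => hG k (by omega)
    obtain ⟨w, hw, rfl⟩ := (hG n (by omega)).exists_fst_eq hv
    refine ⟨w, by rwa [stage_Ω_succ], ?_⟩
    rw [Nat.succ_sub h, Function.iterate_succ_apply]

variable {m : ℕ} {A B : Set (World Θ)}

theorem liftTo_subset (h : m ≤ n) (hA : A ⊆ (stage lam m).Ω) :
    liftTo (stage lam) m n A ⊆ (stage lam n).Ω := fun _ hw => ((mem_liftTo hG h hA).1 hw).1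

theorem liftTo_Ω (h : m ≤ n) : liftTo (stage lam) m n (stage lam m).Ω = (stage lam n).Ω := by
  ext w
  rw [mem_liftTo hG h Subset.rfl]
  exact ⟨fun hw => hw.1, fun hw => ⟨hw, iterate_fst_mem hG h hw⟩⟩

theorem liftTo_empty (h : m ≤ n) : liftTo (stage lam) m n ∅ = ∅ := by
  ext w
  simp [mem_liftTo hG h (empty_subset _)]

theorem liftTo_inter (h : m ≤ n) (hA : A ⊆ (stage lam m).Ω) (hB : B ⊆ (stage lam m).Ω) :
    liftTo (stage lam) m n A ∩ liftTo (stage lam) m n B = liftTo (stage lam) m n (A ∩ B) := by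
  ext w
  simp only [mem_inter_iff, mem_liftTo hG h hA, mem_liftTo hG h hB,
    mem_liftTo hG h (inter_subset_left.trans hA)]
  tauto

theorem liftTo_diff (h : m ≤ n) (hA : A ⊆ (stage lam m).Ω) :
    liftTo (stage lam) m n ((stage lam m).Ω \ A) =
      (stage lam n).Ω \ liftTo (stage lam) m n A := by
  ext w
  rw [mem_liftTo hG h sdiff_subset]
  simp only [Set.mem_sdiff, mem_liftTo hG h hA]
  have := iterate_fst_mem hG h (w := w)
  tauto

theorem liftTo_mono (h : m ≤ n) (hB : B ⊆ (stage lam m).Ω) (hAB : A ⊆ B) :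
    liftTo (stage lam) m n A ⊆ liftTo (stage lam) m n B := fun _ hw =>
  have hw := (mem_liftTo hG h (hAB.trans hB)).1 hw
  (mem_liftTo hG h hB).2 ⟨hw.1, hAB hw.2⟩

theorem liftTo_inj (h : m ≤ n) (hA : A ⊆ (stage lam m).Ω) (hB : B ⊆ (stage lam m).Ω) :
    liftTo (stage lam) m n A = liftTo (stage lam) m n B ↔ A = B := by
  refine ⟨fun hAB => ?_, fun hAB => by rw [hAB]⟩
  ext x
  by_cases hx : x ∈ (stage lam m).Ω
  · obtain ⟨w, hw, rfl⟩ := exists_iterate_fst hG h hx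
    have := Set.ext_iff.1 hAB w
    simpa only [mem_liftTo hG h hA, mem_liftTo hG h hB, hw, true_and] using this
  · exact iff_of_false (fun h => hx (hA h)) fun h => hx (hB h)

theorem liftTo_nonempty (h : m ≤ n) (hA : A ⊆ (stage lam m).Ω) :
    (liftTo (stage lam) m n A).Nonempty ↔ A.Nonempty := by
  rw [nonempty_iff_ne_empty, nonempty_iff_ne_empty]
  refine not_congr ?_
  rw [← liftTo_inj hG h hA (empty_subset _), liftTo_empty hG h]

end Lift

/-- The pair `{b_ν, ∼b_ν}` is not processed again between the steps `ν` and `n`. -/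
def Quiet (lam : ℕ → ℕ → Set (World Θ)) (ν n : ℕ) : Prop :=
  ∀ m, ν < m → m < n → liftTo (stage lam) ν m (stage lam ν).b ≠ (stage lam m).b ∧
    liftTo (stage lam) ν m (stage lam ν).b ≠ (stage lam m).Ω \ (stage lam m).b

theorem Quiet.of_le {ν n n' : ℕ} (h : Quiet lam ν n) (hn : n' ≤ n) : Quiet lam ν n' :=
  fun m hm hm' => h m hm (by omega)

/-! ### The domain and the values of the partial conditionals. -/

section Values

variable {n : ℕ} (hG : ∀ k < n, (stage lam k).Good)
include hG

theorem stage_f_trivial {B A C : Set (World Θ)} (hA : A = ∅ ∨ A = (stage lam n).Ω) :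
    (stage lam n).f B A C ↔ B ⊆ (stage lam n).Ω ∧ C = B := by
  cases n with
  | zero => exact ⟨fun h => ⟨h.1, h.2.2⟩, fun h => ⟨h.1, hA, h.2⟩⟩
  | succ n =>
    rw [stage_Ω_succ] at hA ⊢
    rw [stage_f_succ, (hG n (by omega)).nextF_trivial hA]

/-- A half processed at the step `ν`, lifted to a later step. -/
theorem liftTo_half_ne {ν : ℕ} (hν : ν < n) {D : Set (World Θ)} (hD : (stage lam ν).IsHalf D) :
    liftTo (stage lam) (ν + 1) n D ⊆ (stage lam n).Ω ∧ liftTo (stage lam) (ν + 1) n D ≠ ∅ ∧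
      liftTo (stage lam) (ν + 1) n D ≠ (stage lam n).Ω := by
  have h1 := (hG ν hν).half_subset hD
  have h2 := (hG ν hν).half_ne hD
  rw [← stage_Ω_succ] at h1 h2
  refine ⟨liftTo_subset hG hν h1, fun h => h2.1 ?_, fun h => h2.2 ?_⟩
  · rwa [← liftTo_inj hG hν h1 (empty_subset _), liftTo_empty hG hν]
  · rwa [← liftTo_inj hG hν h1 Subset.rfl, liftTo_Ω hG hν]

theorem liftTo_half {ν : ℕ} (hν : ν < n) {D : Set (World Θ)} (hD : (stage lam ν).IsHalf D) :
    liftTo (stage lam) (ν + 1) n D = liftTo (stage lam) ν n (stage lam ν).b ∨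
      liftTo (stage lam) (ν + 1) n D =
        (stage lam n).Ω \ liftTo (stage lam) ν n (stage lam ν).b := by
  have hb := (hG ν hν).b_subset
  rcases hD with rfl | rfl
  · exact .inl (liftTo_mu _ hν _)
  · rw [← (hG ν hν).mu_diff, liftTo_mu _ hν, liftTo_diff hG hν.le hb]
    exact .inr rfl

/-- As long as the pair is quiet, its lift is neither trivial nor the pair being processed, so only
the last clause of `nextF` acts and transports the graph by `μ`. The domain therefore stays the
lifts of subsets of `Ω_{ν+1}`. -/
theorem stage_f_lift {ν : ℕ} (hν : ν < n) (hq : Quiet lam ν n) {D : Set (World Θ)}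
    (hD : (stage lam ν).IsHalf D) {B C : Set (World Θ)} :
    (stage lam n).f B (liftTo (stage lam) (ν + 1) n D) C ↔
      ∃ B' ⊆ (stage lam (ν + 1)).Ω, B = liftTo (stage lam) (ν + 1) n B' ∧
        C = liftTo (stage lam) (ν + 1) n (idT (B' ∩ D)) := by
  induction n, hν using Nat.le_induction generalizing B C with
  | base =>
    simp only [liftTo_self]
    rw [stage_f_succ, (hG ν (by omega)).nextF_half hD, stage_Ω_succ]
    constructor
    · exact fun h => ⟨B, h.1, rfl, h.2⟩
    · rintro ⟨_, h1, rfl, h2⟩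
      exact ⟨h1, h2⟩
  | succ n hν ih =>
    have hG' : ∀ k < n, (stage lam k).Good := fun k hk => hG k (by omega)
    have hn := hG n (by omega)
    have hb := liftTo_subset hG' (Nat.le_of_lt hν) (hG ν (by omega)).b_subset
    obtain ⟨h0, h3, h4⟩ := liftTo_half_ne hG' hν hD
    have hq' := hq n hν (by omega)
    have h12 : liftTo (stage lam) (ν + 1) n D ≠ (stage lam n).b ∧
        liftTo (stage lam) (ν + 1) n D ≠ (stage lam n).Ω \ (stage lam n).b := by
      rcases liftTo_half hG' hν hD with h | h <;> rw [h]
      · exact hq'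
      · refine ⟨fun h => hq'.2 ?_, fun h => hq'.1 ?_⟩
        · rw [← h, sdiff_sdiff_cancel_left hb]
        · rw [← sdiff_sdiff_cancel_left hb, h, sdiff_sdiff_cancel_left hn.b_subset]
    rw [liftTo_succ _ hν, stage_f_succ, hn.nextF_mu h0 h12.1 h12.2 h3 h4]
    constructor
    · rintro ⟨B₀, C₀, -, hf, rfl, rfl⟩
      obtain ⟨B', hB', rfl, rfl⟩ := (ih hG' (hq.of_le (by omega))).1 hf
      exact ⟨B', hB', (liftTo_succ _ hν _).symm, (liftTo_succ _ hν _).symm⟩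
    · rintro ⟨B', hB', rfl, rfl⟩
      exact ⟨_, _, liftTo_subset hG' hν hB',
        (ih hG' (hq.of_le (by omega))).2 ⟨B', hB', rfl, rfl⟩, liftTo_succ _ hν _,
        liftTo_succ _ hν _⟩

/-- The conditional is only ever defined at trivial conditions and at conditions processed before.
-/
theorem stage_f_cases {B A C : Set (World Θ)} (hf : (stage lam n).f B A C) :
    A = ∅ ∨ A = (stage lam n).Ω ∨ ∃ m < n, A = liftTo (stage lam) m n (stage lam m).b ∨
      A = (stage lam n).Ω \ liftTo (stage lam) m n (stage lam m).b := by
  induction n generalizing B A C with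
  | zero => exact hf.2.1.imp_right .inl
  | succ n ih =>
    have hG' : ∀ k < n, (stage lam k).Good := fun k hk => hG k (by omega)
    have hn := hG n (by omega)
    rw [stage_f_succ] at hf
    rw [stage_Ω_succ]
    rcases hf with ⟨-, h | h, -⟩ | ⟨-, h, -⟩ | ⟨-, h, -⟩ |
      ⟨B₀, A₀, C₀, hB₀, hA₀, -, -, h3, h4, hf, -, rfl, -⟩
    · exact .inl h
    · exact .inr (.inl h)
    · exact .inr (.inr ⟨n, by omega, .inl (by rw [liftTo_succ _ le_rfl, liftTo_self, h])⟩)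
    · exact .inr (.inr ⟨n, by omega, .inr (by rw [liftTo_succ _ le_rfl, liftTo_self, h])⟩)
    · obtain h | h | ⟨m, hm, h⟩ := ih hG' hf
      · exact (h3 h).elim
      · exact (h4 h).elim
      · refine .inr (.inr ⟨m, by omega, ?_⟩)
        rw [liftTo_succ _ hm.le]
        rcases h with rfl | rfl
        · exact .inl rfl
        · exact .inr (hn.mu_diff _)

theorem exists_greatest {A : Set (World Θ)} (hA : A ⊆ (stage lam n).Ω)
    (h : ∃ m < n, A = liftTo (stage lam) m n (stage lam m).b ∨
      A = (stage lam n).Ω \ liftTo (stage lam) m n (stage lam m).b) :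
    ∃ ν, IsGreatest (earlier (stage lam) n (stage lam n).Ω A) ν := by
  obtain ⟨m, hm, h⟩ := h
  have hb := liftTo_subset hG hm.le (hG m hm).b_subset
  have hmem : m ∈ earlier (stage lam) n (stage lam n).Ω A := by
    refine ⟨hm, ?_⟩
    rcases h with rfl | rfl
    · rfl
    · rw [sdiff_sdiff_cancel_left hb, pair_comm]
  have hbdd : BddAbove (earlier (stage lam) n (stage lam n).Ω A) := ⟨n, fun k hk => hk.1.le⟩
  exact ⟨_, Nat.sSup_mem ⟨m, hmem⟩ hbdd, fun k hk => le_csSup hbdd hk⟩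

theorem mem_earlier {m : ℕ} {A : Set (World Θ)} (hA : A ⊆ (stage lam n).Ω) :
    m ∈ earlier (stage lam) n (stage lam n).Ω A ↔ m < n ∧
      (liftTo (stage lam) m n (stage lam m).b = A ∨
        liftTo (stage lam) m n (stage lam m).b = (stage lam n).Ω \ A) := by
  refine and_congr_right fun hm => ?_
  rw [pair_eq_pair_iff]
  have hb := liftTo_subset hG hm.le (hG m hm).b_subset
  constructor
  · rintro (h | h)
    exacts [.inl h.1, .inr h.1]
  · rintro (h | h)
    · exact .inl ⟨h, by rw [h]⟩
    · exact .inr ⟨h, by rw [h, sdiff_sdiff_cancel_left hA]⟩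

theorem quiet_of_isGreatest {ν : ℕ} {A : Set (World Θ)} (hA : A ⊆ (stage lam n).Ω)
    (h : IsGreatest (earlier (stage lam) n (stage lam n).Ω A) ν) : Quiet lam ν n := by
  intro m hνm hmn
  have hb := (hG m hmn).b_subset
  have hν := (mem_earlier hG hA).1 h.1
  -- By maximality of `ν`. A return of the pair at step `m`, lifted to step `n`, would contradict
  -- this.
  have key : m ∉ earlier (stage lam) n (stage lam n).Ω A := fun hm => by
    have := h.2 hm
    omega
  rw [mem_earlier hG hA] at key
  constructor <;> intro h' <;> refine key ⟨hmn, ?_⟩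
  · rw [← h', liftTo_liftTo _ hνm.le hmn.le]
    exact hν.2
  · have : (stage lam m).b =
        (stage lam m).Ω \ liftTo (stage lam) ν m (stage lam ν).b := by
      rw [h', sdiff_sdiff_cancel_left hb]
    rw [this, liftTo_diff hG hmn.le, liftTo_liftTo _ hνm.le hmn.le]
    · rcases hν.2 with h | h <;> rw [h]
      · exact .inr rfl
      · exact .inl (sdiff_sdiff_cancel_left hA)
    · rw [h']; exact sdiff_subset

end Values

end Sequence

/-! ### Steps driven by task lists -/

section Tasks

open World

variable {Θ : Type u}

/-- The conditions on the list `λ_n`, relative to the lists before it. -/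
structure TaskAt (lam : ℕ → ℕ → Set (World Θ)) (n : ℕ) : Prop where
  bij : BijOn (lam n) (Ico (2 * n) (listEnd lam n))
    (𝒫 (stage lam n).Ω \ {∅, (stage lam n).Ω})
  paired : ∀ t, 2 * n ≤ 2 * t → 2 * t + 1 < listEnd lam n →
    lam n (2 * t) = (stage lam n).Ω \ lam n (2 * t + 1)
  shift : ∀ m, n = m + 1 → ∀ t, 2 * n ≤ t → t < listEnd lam m →
    lam n t = (stage lam m).mu (lam m t)
  last : ∀ m, n = m + 1 → lam n (listEnd lam n - 2) = (stage lam m).mu (stage lam m).b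

theorem isTaskList_iff {lam : ℕ → ℕ → Set (World Θ)} :
    IsTaskList lam ↔ ∀ n, TaskAt lam n := by
  constructor
  · intro h n
    exact ⟨h.bij n, h.paired n, by rintro m rfl; exact h.shift m, by rintro m rfl; exact h.last m⟩
  · intro h
    exact ⟨fun n => (h n).bij, fun n => (h n).paired, fun n => (h (n + 1)).shift n rfl,
      fun n => (h (n + 1)).last n rfl⟩

theorem listEnd_congr {lam lam' : ℕ → ℕ → Set (World Θ)} {n : ℕ} (h : ∀ k < n, lam k = lam' k) :
    listEnd lam n = listEnd lam' n := by
  rw [listEnd, listEnd, stage_Ω_congr h]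

theorem TaskAt.congr {lam lam' : ℕ → ℕ → Set (World Θ)} {n : ℕ} (h : ∀ k ≤ n, lam k = lam' k)
    (hl : TaskAt lam n) : TaskAt lam' n := by
  have h1 := stage_Ω_congr (lam := lam) (lam' := lam') (n := n) fun k hk => h k hk.le
  have h2 := listEnd_congr (lam := lam) (lam' := lam') (n := n) fun k hk => h k hk.le
  have h3 := h n le_rfl
  refine ⟨?_, ?_, ?_, ?_⟩
  · rw [← h1, ← h2, ← h3]; exact hl.bij
  · rw [← h1, ← h2, ← h3]; exact hl.paired
  · rintro m rfl
    rw [← h3, ← h m (by omega), ← listEnd_congr (lam := lam) fun k hk => h k (by omega),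
      ← stage_congr (lam := lam) fun k hk => h k (by omega)]
    exact hl.shift m rfl
  · rintro m rfl
    rw [← h3, ← h2, ← stage_congr (lam := lam) fun k hk => h k (by omega)]
    exact hl.last m rfl

variable {lam : ℕ → ℕ → Set (World Θ)}

theorem cells_first {n : ℕ}
    (h : earlier (stage lam) n (stage lam n).Ω (stage lam n).b = ∅)
    {c : Set (World Θ) × Set (World Θ)} :
    c ∈ (stage lam n).cells ↔ c = ((stage lam n).b, (stage lam n).Ω \ (stage lam n).b) := by
  rw [stage_cells]
  constructor
  · rintro (⟨ν, hν, -⟩ | h')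
    · exact (h.subset hν.1).elim
    · exact h'.2
  · exact fun hc => .inr ⟨h, hc⟩

variable [Fintype Θ]

theorem initΩ_finite : (initΩ Θ).Finite := by
  classical
  exact finite_range _

theorem stage_Ω_finite {n : ℕ} (hG : ∀ k < n, (stage lam k).Good) :
    (stage lam n).Ω.Finite := by
  cases n with
  | zero => exact initΩ_finite
  | succ n => rw [stage_Ω_succ]; exact (hG n (by omega)).nextΩ_finite

variable [Inhabited Θ]

theorem two_le_ncard_initΩ : 2 ≤ (initΩ Θ).ncard := by
  refine (one_lt_ncard_iff initΩ_finite).2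
    ⟨.val fun _ => true, .val fun _ => false, mem_range_self _, mem_range_self _, fun h => ?_⟩
  have := congrFun (World.val.inj h) default
  simp at this

theorem two_le_ncard_Ω {n : ℕ} (hG : ∀ k < n, (stage lam k).Good) :
    2 ≤ (stage lam n).Ω.ncard := by
  induction n with
  | zero => exact two_le_ncard_initΩ
  | succ n ih =>
    rw [stage_Ω_succ]
    exact (ih fun k hk => hG k (by omega)).trans (hG n (by omega)).ncard_le

/-- `j` counts the complementary pairs in the list; it is positive because `Ω_n` has at least two
points. -/
theorem listEnd_eq {n : ℕ} (hG : ∀ k < n, (stage lam k).Good) :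
    ∃ j, 1 ≤ j ∧ listEnd lam n = 2 * n + 2 * j ∧ 2 * j + 2 = 2 ^ (stage lam n).Ω.ncard := by
  obtain ⟨c, hc⟩ := Nat.exists_eq_add_of_le (two_le_ncard_Ω hG)
  have h1 : 1 ≤ 2 ^ c := Nat.one_le_two_pow
  have h2 : 2 ^ (2 + c) = 4 * 2 ^ c := by rw [pow_add]; norm_num
  -- With `2 + c` points, `2 ^ (2 + c) - 2 = 2 * (2 * 2 ^ c - 1)`.
  refine ⟨2 * 2 ^ c - 1, by omega, ?_, ?_⟩
  · rw [listEnd, ncard_powerset _ (stage_Ω_finite hG), hc, h2]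
    omega
  · rw [hc, h2]; omega

/-- The surplus of two leaves the final positions free for the pair just processed, clear of the
shifted entries. -/
theorem listEnd_mono {n : ℕ} (hG : ∀ k ≤ n, (stage lam k).Good) :
    listEnd lam n + 2 ≤ listEnd lam (n + 1) := by
  obtain ⟨i, -, hi, hi'⟩ := listEnd_eq fun k hk => hG k (le_of_lt hk)
  obtain ⟨j, -, hj, hj'⟩ := listEnd_eq (n := n + 1) fun k hk => hG k (by omega)
  have := (hG n le_rfl).ncard_le
  rw [← stage_Ω_succ] at this
  have := Nat.pow_le_pow_right (n := 2) (by norm_num) this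
  omega

/-! ### A reprocessed pair comes back in its original order. -/

section Orientation

variable {n : ℕ} (hG : ∀ k < n, (stage lam k).Good) (hT : ∀ k ≤ n, TaskAt lam k)
include hG hT

theorem task_compl : lam n (2 * n + 1) = (stage lam n).Ω \ (stage lam n).b ∧
    (stage lam n).b ∈ 𝒫 (stage lam n).Ω \ {∅, (stage lam n).Ω} := by
  obtain ⟨j, hj, he, -⟩ := listEnd_eq hG
  have h1 := (hT n le_rfl).bij.mapsTo (x := 2 * n + 1) ⟨by omega, by omega⟩
  have h2 := (hT n le_rfl).bij.mapsTo (x := 2 * n) ⟨by omega, by omega⟩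
  have h3 := (hT n le_rfl).paired n le_rfl (by omega)
  rw [← stage_b lam] at h2 h3
  refine ⟨?_, h2⟩
  rw [h3, sdiff_sdiff_cancel_left h1.1]

/-- A processed pair is put back, in the same order, at the end of the list. -/
theorem exists_position {ν : ℕ} (hν : ν < n) (hq : Quiet lam ν n) :
    ∃ j, n ≤ j ∧ 2 * j + 1 < listEnd lam n ∧
      lam n (2 * j) = liftTo (stage lam) ν n (stage lam ν).b := by
  induction n, hν using Nat.le_induction with
  | base =>
    obtain ⟨j, hj, he, -⟩ := listEnd_eq hG
    refine ⟨ν + j, by omega, by omega, ?_⟩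
    rw [liftTo_succ _ le_rfl, liftTo_self, ← (hT _ le_rfl).last ν rfl, he]
    congr 1
    omega
  | succ n hν ih =>
    obtain ⟨j, hj, he, h⟩ := ih (fun k hk => hG k (by omega)) (fun k hk => hT k (by omega))
      (hq.of_le (by omega))
    have hne : j ≠ n := by
      rintro rfl
      rw [← stage_b lam] at h
      exact (hq j hν (by omega)).1 h.symm
    have := listEnd_mono fun k hk => hG k (Nat.lt_succ_of_le hk)
    refine ⟨j, by omega, by omega, ?_⟩
    rw [(hT _ le_rfl).shift n rfl _ (by omega) (by omega), h, liftTo_succ _ (by omega)]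

/-- The lift of `b_ν` stands at an even position. In the reversed orientation it would be `∼b_n`,
which stands at the odd position `2n + 1`, against injectivity of the list. Without this the sets
`Π_n(i)` could fall in `∼b_n`. -/
theorem b_eq_liftTo {ν : ℕ}
    (h : IsGreatest (earlier (stage lam) n (stage lam n).Ω (stage lam n).b) ν) :
    (stage lam n).b = liftTo (stage lam) ν n (stage lam ν).b := by
  obtain ⟨hc, hb⟩ := task_compl hG hT
  obtain ⟨hν, h' | h'⟩ := (mem_earlier hG hb.1).1 h.1
  · exact h'.symm
  · obtain ⟨j, hj, he, hj'⟩ := exists_position hG hT hν (quiet_of_isGreatest hG hb.1 h)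
    obtain ⟨i, hi, he', -⟩ := listEnd_eq hG
    rw [h', ← hc] at hj'
    have := (hT n le_rfl).bij.injOn ⟨by omega, by omega⟩ ⟨by omega, by omega⟩ hj'
    omega

end Orientation

/-! ### The cells of a reprocessed pair. -/

section Reprocess

variable {n ν : ℕ} (hG : ∀ k < n, (stage lam k).Good) (hT : ∀ k ≤ n, TaskAt lam k)
  (h : IsGreatest (earlier (stage lam) n (stage lam n).Ω (stage lam n).b) ν)
include hG hT h

/-- On a singleton of its half, `idT` gives `{w, Tw}`. By `stage_f_lift` the values of `f_n` used in
`cellsAt` are lifts of such sets, so each cell is computed by intersections inside `Ω_{ν+1}`. -/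
theorem mem_cells_reprocess {c : Set (World Θ) × Set (World Θ)} :
    c ∈ (stage lam n).cells ↔ ∃ w ∈ (stage lam ν).mu (stage lam ν).b,
      ∃ w' ∈ (stage lam ν).nextΩ \ (stage lam ν).mu (stage lam ν).b,
        c = (liftTo (stage lam) (ν + 1) n ({w', w'.swap} ∩ {w}),
          liftTo (stage lam) (ν + 1) n ({w, w.swap} ∩ {w'})) := by
  obtain ⟨-, hb⟩ := task_compl hG hT
  have hν : ν < n := h.1.1
  have hgν := hG ν hν
  have hq := quiet_of_isGreatest hG hb.1 h
  have e1 : (stage lam n).b =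
      liftTo (stage lam) (ν + 1) n ((stage lam ν).mu (stage lam ν).b) := by
    rw [liftTo_mu _ hν, b_eq_liftTo hG hT h]
  have hmu : (stage lam ν).mu (stage lam ν).b ⊆ (stage lam (ν + 1)).Ω := by
    rw [stage_Ω_succ]; exact hgν.mu_subset _
  have e2 : (stage lam n).Ω \ (stage lam n).b = liftTo (stage lam) (ν + 1) n
      ((stage lam ν).nextΩ \ (stage lam ν).mu (stage lam ν).b) := by
    rw [e1, ← liftTo_diff hG hν hmu, stage_Ω_succ]
  have idT_single : ∀ v : World Θ, idT {v} = {v, v.swap} := fun v => by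
    rw [idT, image_singleton, singleton_union]
  have key : ∀ D, (stage lam ν).IsHalf D → ∀ w ∈ D, ∀ C,
      (stage lam n).f (liftTo (stage lam) (ν + 1) n {w})
        (liftTo (stage lam) (ν + 1) n D) C ↔
      C = liftTo (stage lam) (ν + 1) n {w, w.swap} := by
    intro D hD w hw C
    have hwΩ : ({w} : Set (World Θ)) ⊆ (stage lam (ν + 1)).Ω := by
      rw [stage_Ω_succ]
      exact singleton_subset_iff.2 (hgν.half_subset hD hw)
    rw [stage_f_lift hG hν hq hD]
    constructor
    · rintro ⟨B', hB', h1, h2⟩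
      obtain rfl := (liftTo_inj hG hν hwΩ hB').1 h1
      rw [h2, inter_eq_left.2 (singleton_subset_iff.2 hw), idT_single]
    · rintro rfl
      exact ⟨_, hwΩ, rfl,
        by rw [inter_eq_left.2 (singleton_subset_iff.2 hw), idT_single]⟩
  have swap_sub : ∀ w ∈ (stage lam ν).nextΩ,
      ({w, w.swap} : Set (World Θ)) ⊆ (stage lam (ν + 1)).Ω ∧
        ({w} : Set (World Θ)) ⊆ (stage lam (ν + 1)).Ω := by
    intro w hw
    rw [stage_Ω_succ, insert_subset_iff, singleton_subset_iff, singleton_subset_iff]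
    exact ⟨⟨hw, hgν.swap_mem hw⟩, hw⟩
  have hne : earlier (stage lam) n (stage lam n).Ω (stage lam n).b ≠ ∅ :=
    nonempty_iff_ne_empty.1 ⟨ν, h.1⟩
  rw [stage_cells]
  constructor
  · rintro (⟨ν', hν', w, hw, w', hw', C, C', hC, hC', rfl⟩ | ⟨h0, -⟩)
    · obtain rfl := h.unique hν'
      rw [e2, key _ (.inr rfl) _ hw'] at hC
      rw [e1, key _ (.inl rfl) _ hw] at hC'
      have s1 := swap_sub w (hgν.mu_subset _ hw)
      have s2 := swap_sub w' hw'.1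
      refine ⟨w, hw, w', hw', ?_⟩
      rw [hC, hC', liftTo_inter hG hν s2.1 s1.2, liftTo_inter hG hν s1.1 s2.2]
    · exact (hne h0).elim
  · rintro ⟨w, hw, w', hw', rfl⟩
    have s1 := swap_sub w (hgν.mu_subset _ hw)
    have s2 := swap_sub w' hw'.1
    refine .inl ⟨ν, h, w, hw, w', hw', liftTo (stage lam) (ν + 1) n {w', w'.swap},
      liftTo (stage lam) (ν + 1) n {w, w.swap}, ?_, ?_, ?_⟩
    · rw [e2, key _ (.inr rfl) _ hw']
    · rw [e1, key _ (.inl rfl) _ hw]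
    · rw [liftTo_inter hG hν s2.1 s1.2, liftTo_inter hG hν s1.1 s2.2]

/-- Since `w` and `w'` are in opposite halves, `{w', Tw'}` meets `{w}` only if `w' = Tw`. The other
indices contribute empty cells, and what remains is the fibre over `w` matched with the fibre over
`Tw`. -/
theorem cells_reprocess : (∀ c ∈ (stage lam n).cells, c = (∅, ∅) ∨
      ∃ w ∈ (stage lam ν).mu (stage lam ν).b, c = (liftTo (stage lam) (ν + 1) n {w},
        liftTo (stage lam) (ν + 1) n {w.swap})) ∧
    ∀ w ∈ (stage lam ν).mu (stage lam ν).b, (liftTo (stage lam) (ν + 1) n {w},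
        liftTo (stage lam) (ν + 1) n {w.swap}) ∈ (stage lam n).cells := by
  have hν : ν < n := h.1.1
  have hgν := hG ν hν
  have hsw : ∀ w ∈ (stage lam ν).mu (stage lam ν).b,
      w.swap ∈ (stage lam ν).nextΩ \ (stage lam ν).mu (stage lam ν).b := fun w hw => by
    have hw' := hgν.mu_subset _ hw
    exact ⟨hgν.swap_mem hw', fun h => (hgν.swap_mem_half (.inl rfl) hw').1 h hw⟩
  have key : ∀ w ∈ (stage lam ν).mu (stage lam ν).b,
      (({w.swap, w.swap.swap} ∩ {w} : Set (World Θ)), ({w, w.swap} ∩ {w.swap} : Set (World Θ))) =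
        ({w}, {w.swap}) := fun w _ => by
    rw [swap_swap, inter_eq_right.2, inter_eq_right.2] <;> simp
  constructor
  · intro c hc
    obtain ⟨w, hw, w', hw', rfl⟩ := (mem_cells_reprocess hG hT h).1 hc
    by_cases he : w' = w.swap
    · subst he
      obtain ⟨k1, k2⟩ := Prod.mk.inj (key w hw)
      exact .inr ⟨w, hw, by rw [k1, k2]⟩
    · left
      have hww : w ≠ w' := by
        rintro rfl
        exact hw'.2 hw
      have he' : w ≠ w'.swap := by
        rintro rfl
        simp at he
      have k1 : ({w', w'.swap} ∩ {w} : Set (World Θ)) = ∅ := by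
        ext v
        simp only [mem_inter_iff, mem_insert_iff, mem_singleton_iff, mem_empty_iff_false, iff_false]
        rintro ⟨h1 | h1, rfl⟩
        exacts [hww h1, he' h1]
      have k2 : ({w, w.swap} ∩ {w'} : Set (World Θ)) = ∅ := by
        ext v
        simp only [mem_inter_iff, mem_insert_iff, mem_singleton_iff, mem_empty_iff_false, iff_false]
        rintro ⟨h1 | h1, rfl⟩
        exacts [hww h1.symm, he h1]
      rw [k1, k2, liftTo_empty hG hν]
  · intro w hw
    refine (mem_cells_reprocess hG hT h).2 ⟨w, hw, w.swap, hsw w hw, ?_⟩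
    obtain ⟨k1, k2⟩ := Prod.mk.inj (key w hw)
    rw [k1, k2]

end Reprocess

theorem earlier_empty_or {n : ℕ} (hG : ∀ k < n, (stage lam k).Good)
    (hT : ∀ k ≤ n, TaskAt lam k) :
    earlier (stage lam) n (stage lam n).Ω (stage lam n).b = ∅ ∨
      ∃ ν, IsGreatest (earlier (stage lam) n (stage lam n).Ω (stage lam n).b) ν := by
  obtain ⟨-, hb⟩ := task_compl hG hT
  rcases eq_empty_or_nonempty (earlier (stage lam) n (stage lam n).Ω (stage lam n).b) with h | ⟨m, h⟩
  · exact .inl h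
  · obtain ⟨hm, h⟩ := (mem_earlier hG hb.1).1 h
    refine .inr (exists_greatest hG hb.1 ⟨m, hm, ?_⟩)
    rcases h with h | h
    · exact .inl h.symm
    · right
      rw [h, sdiff_sdiff_cancel_left hb.1]

/-- For a reprocessed pair, the cell of a point is determined by its projection to `Ω_{ν+1}`, or by
the exchange of that projection if the point is in `∼b_n`. This gives existence and uniqueness of
the cell. -/
theorem good_step {n : ℕ} (hG : ∀ k < n, (stage lam k).Good) (hT : ∀ k ≤ n, TaskAt lam k) :
    (stage lam n).Good := by
  obtain ⟨-, hb⟩ := task_compl hG hT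
  have hne1 : (stage lam n).b.Nonempty := nonempty_iff_ne_empty.2 fun h => hb.2 (.inl h)
  have hne2 : ((stage lam n).Ω \ (stage lam n).b).Nonempty := by
    rw [nonempty_iff_ne_empty]
    exact fun h => hb.2 (.inr (hb.1.antisymm (sdiff_eq_empty.1 h)))
  rcases earlier_empty_or hG hT with h | ⟨ν, h⟩
  · have hc := @cells_first Θ lam n h
    exact
      { finite := stage_Ω_finite hG
        b_subset := hb.1
        b_nonempty := hne1
        compl_nonempty := hne2
        fst_subset := fun c h => by rw [hc.1 h]
        snd_subset := fun c h => by rw [hc.1 h]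
        nonempty_iff := fun c h => by rw [hc.1 h]; exact iff_of_true hne1 hne2
        exists_fst := fun x hx => ⟨_, hc.2 rfl, hx⟩
        exists_snd := fun x hx => ⟨_, hc.2 rfl, hx⟩
        fst_unique := fun c h d h' _ _ _ => by rw [hc.1 h, hc.1 h']
        snd_unique := fun c h d h' _ _ _ => by rw [hc.1 h, hc.1 h'] }
  · have hν : ν < n := h.1.1
    have hgν := hG ν hν
    obtain ⟨hc1, hc2⟩ := cells_reprocess hG hT h
    set L := liftTo (stage lam) (ν + 1) n with hL
    set D := (stage lam ν).mu (stage lam ν).b with hD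
    have hDΩ : D ⊆ (stage lam (ν + 1)).Ω := by
      rw [stage_Ω_succ]; exact hgν.mu_subset _
    have hb' : (stage lam n).b = L D := by
      rw [hL, hD, liftTo_mu _ hν, b_eq_liftTo hG hT h]
    have hsw : ∀ w ∈ D, w.swap ∈ (stage lam (ν + 1)).Ω \ D := fun w hw => by
      have hw' := hgν.mu_subset _ hw
      rw [stage_Ω_succ]
      exact ⟨hgν.swap_mem hw', fun h => (hgν.swap_mem_half (.inl rfl) hw').1 h hw⟩
    have hmem : ∀ w ∈ (stage lam (ν + 1)).Ω, ∀ x, x ∈ L {w} ↔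
        x ∈ (stage lam n).Ω ∧ fst^[n - (ν + 1)] x = w := fun w hw x =>
      mem_liftTo hG hν (singleton_subset_iff.2 hw)
    exact
      { finite := stage_Ω_finite hG
        b_subset := hb.1
        b_nonempty := hne1
        compl_nonempty := hne2
        fst_subset := fun c hc => by
          rcases hc1 c hc with rfl | ⟨w, hw, rfl⟩
          · exact empty_subset _
          · rw [hb']
            exact liftTo_mono hG hν hDΩ (singleton_subset_iff.2 hw)
        snd_subset := fun c hc => by
          rcases hc1 c hc with rfl | ⟨w, hw, rfl⟩
          · exact empty_subset _
          · rw [hb', hL, ← liftTo_diff hG hν hDΩ]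
            exact liftTo_mono hG hν sdiff_subset (singleton_subset_iff.2 (hsw w hw))
        nonempty_iff := fun c hc => by
          rcases hc1 c hc with rfl | ⟨w, hw, rfl⟩
          · rfl
          · rw [liftTo_nonempty hG hν (singleton_subset_iff.2 (hDΩ hw)),
              liftTo_nonempty hG hν (singleton_subset_iff.2 (hsw w hw).1)]
            simp
        exists_fst := fun x hx => by
          rw [hb', hL, mem_liftTo hG hν hDΩ] at hx
          exact ⟨_, hc2 _ hx.2, (hmem _ (hDΩ hx.2) x).2 ⟨hx.1, rfl⟩⟩
        exists_snd := fun x hx => by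
          rw [hb', hL, ← liftTo_diff hG hν hDΩ, mem_liftTo hG hν sdiff_subset,
            stage_Ω_succ] at hx
          have hm := (hgν.swap_mem_half (.inl rfl) hx.2.1).2 hx.2.2
          refine ⟨_, hc2 _ hm, (hmem _ (hsw _ hm).1 x).2 ⟨hx.1, ?_⟩⟩
          rw [swap_swap]
        fst_unique := fun c hc d hd x hx hx' => by
          rcases hc1 c hc with rfl | ⟨w, hw, rfl⟩
          · exact hx.elim
          rcases hc1 d hd with rfl | ⟨v, hv, rfl⟩
          · exact hx'.elim
          rw [← ((hmem w (hDΩ hw) x).1 hx).2, ← ((hmem v (hDΩ hv) x).1 hx').2]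
        snd_unique := fun c hc d hd x hx hx' => by
          rcases hc1 c hc with rfl | ⟨w, hw, rfl⟩
          · exact hx.elim
          rcases hc1 d hd with rfl | ⟨v, hv, rfl⟩
          · exact hx'.elim
          have h1 := ((hmem _ (hsw w hw).1 x).1 hx).2
          have h2 := ((hmem _ (hsw v hv).1 x).1 hx').2
          rw [← swap_swap w, ← swap_swap v, ← h1, ← h2] }

theorem good_of_tasks {n : ℕ} (hT : ∀ k ≤ n, TaskAt lam k) : (stage lam n).Good := by
  induction n using Nat.strong_induction_on with
  | _ n ih => exact good_step (fun k hk => ih k hk fun j hj => hT j (by omega)) hT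

end Tasks

/-! ### Existence of task lists -/

/-- `Q n` sees only the terms up to `n`, so later updates do not spoil it, and the diagonal of the
successive updates satisfies every condition. -/
theorem exists_seq_of_step {α : Type*} [Nonempty α] (Q : ℕ → (ℕ → α) → Prop)
    (hcongr : ∀ n l l', (∀ k ≤ n, l k = l' k) → Q n l → Q n l')
    (hstep : ∀ n l, (∀ k < n, Q k l) → ∃ x, Q n (Function.update l n x)) :
    ∃ l, ∀ n, Q n l := by
  classical
  have hstep' : ∀ n l, ∃ x, (∀ k < n, Q k l) → Q n (Function.update l n x) := fun n l => by
    by_cases h : ∀ k < n, Q k l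
    · obtain ⟨x, hx⟩ := hstep n l h
      exact ⟨x, fun _ => hx⟩
    · exact ⟨Classical.arbitrary α, fun h' => (h h').elim⟩
  choose next hnext using hstep'
  let g : ℕ → ℕ → α := fun n => Nat.rec (fun _ => Classical.arbitrary α)
    (fun n l => Function.update l n (next n l)) n
  have hg : ∀ n, g (n + 1) = Function.update (g n) n (next n (g n)) := fun n => rfl
  have hgk : ∀ k n, k < n → g n k = g (k + 1) k := by
    intro k n hk
    induction n, hk using Nat.le_induction with
    | base => rfl
    | succ n hn ih => rw [hg n, Function.update_of_ne (by omega), ih]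
  refine ⟨fun n => g (n + 1) n, fun n => ?_⟩
  induction n using Nat.strong_induction_on with
  | _ n ih =>
    refine hcongr n (g (n + 1)) _ (fun k hk => hgk k (n + 1) (by omega)) ?_
    rw [hg]
    exact hnext n _ fun k hk => hcongr k _ _ (fun i hi => (hgk i n (by omega)).symm) (ih k hk)

/-- A list of the proper non-empty parts of `Ω` in complementary pairs, extending a prescribed
partial list of representatives of these pairs. -/
theorem exists_paired_list {α : Type*} {Ω : Set α} (hfin : Ω.Finite) (hne : Ω.Nonempty) (n : ℕ)
    {j : ℕ} (hj : 2 * j + 2 = 2 ^ Ω.ncard) (S : Set ℕ) (a : ℕ → Set α)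
    (ha : ∀ i ∈ S, a i ∈ 𝒫 Ω \ {∅, Ω})
    (hinj : ∀ i ∈ S, ∀ k ∈ S, a i = a k ∨ a i = Ω \ a k → i = k) :
    ∃ l : ℕ → Set α, BijOn l (Ico (2 * n) (2 * n + 2 * j)) (𝒫 Ω \ {∅, Ω}) ∧
      (∀ t, 2 * n ≤ 2 * t → 2 * t + 1 < 2 * n + 2 * j → l (2 * t) = Ω \ l (2 * t + 1)) ∧
      ∀ i ∈ S, i < j → l (2 * n + 2 * i) = a i ∧ l (2 * n + 2 * i + 1) = Ω \ a i := by
  classical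
  obtain ⟨p, hp⟩ := hne
  set X : Set (Set α) := 𝒫 Ω \ {∅, Ω} with hX
  have hXc : ∀ A ∈ X, Ω \ A ∈ X := by
    rintro A ⟨hA, hA'⟩
    refine ⟨sdiff_subset, ?_⟩
    rintro (h | h)
    · exact hA' (.inr (hA.antisymm (sdiff_eq_empty.1 h)))
    · refine hA' (.inl ?_)
      rw [mem_singleton_iff] at h
      rw [← sdiff_sdiff_cancel_left hA, h, sdiff_self]
  have hXfin : X.Finite := hfin.finite_subsets.subset fun A hA => hA.1
  have hXcard : X.ncard = 2 * j := by
    have h1 : ({∅, Ω} : Set (Set α)).ncard = 2 :=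
      ncard_pair fun h => by rw [← h] at hp; exact hp
    have h2 : ({∅, Ω} : Set (Set α)) ⊆ 𝒫 Ω := by
      rintro A (rfl | rfl)
      exacts [empty_subset _, Subset.rfl]
    rw [hX, ncard_sdiff h2, ncard_powerset _ hfin, h1]
    omega
  -- Exactly one member of each complementary pair contains `p`, so `T` indexes the `j` pairs.
  set T : Set (Set α) := {A ∈ X | p ∈ A} with hT
  have hTfin : T.Finite := hXfin.subset (sep_subset _ _)
  have hTcard : T.ncard = j := by
    have h1 : X = T ∪ (Ω \ ·) '' T := by
      ext A
      constructor
      · intro hA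
        by_cases h : p ∈ A
        · exact .inl ⟨hA, h⟩
        · exact .inr ⟨Ω \ A, ⟨hXc A hA, hp, h⟩, sdiff_sdiff_cancel_left hA.1⟩
      · rintro (h | ⟨A, hA, rfl⟩)
        exacts [h.1, hXc A hA.1]
    have h2 : Disjoint T ((Ω \ ·) '' T) := by
      rw [Set.disjoint_left]
      rintro _ hA ⟨A, hA', rfl⟩
      exact hA.2.2 hA'.2
    have h3 : InjOn (Ω \ ·) T := fun A hA B hB h => by
      rw [← sdiff_sdiff_cancel_left hA.1.1, ← sdiff_sdiff_cancel_left hB.1.1]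
      exact congrArg (Ω \ ·) h
    have h4 := ncard_union_eq h2 hTfin (hTfin.image _)
    rw [← h1, hXcard, h3.ncard_image] at h4
    omega
  let canon : Set α → Set α := fun A => if p ∈ A then A else Ω \ A
  have hcT : ∀ A ∈ X, canon A ∈ T := fun A hA => by
    by_cases h : p ∈ A
    · simpa only [canon, if_pos h] using ⟨hA, h⟩
    · simpa only [canon, if_neg h] using ⟨hXc A hA, hp, h⟩
  have hcc : ∀ A ∈ X, canon (Ω \ A) = canon A := fun A hA => by
    by_cases h : p ∈ A
    · simp [canon, h, sdiff_sdiff_cancel_left hA.1]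
    · simp [canon, h, hp]
  have hc : ∀ A ∈ X, ∀ B ∈ X, canon A = canon B → A = B ∨ A = Ω \ B := by
    intro A hA B hB h
    by_cases h1 : p ∈ A <;> by_cases h2 : p ∈ B <;> simp only [canon, h1, h2, if_true, if_false] at h
    · exact .inl h
    · exact .inr h
    · exact .inr (by rw [← h, sdiff_sdiff_cancel_left hA.1])
    · exact .inl (by rw [← sdiff_sdiff_cancel_left hA.1, h, sdiff_sdiff_cancel_left hB.1])
  have hnc : ∀ A : Set α, A ≠ Ω \ A := fun A h => by
    have h := Set.ext_iff.1 h p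
    simp only [Set.mem_sdiff, hp, true_and] at h
    tauto
  -- The prescribed entries belong to distinct pairs; equality of cardinals extends this injection
  -- to a bijection.
  have hex : ∃ g : Fin j ≃ hTfin.toFinset,
      ∀ i ∈ Finset.univ.filter (fun i : Fin j => (i : ℕ) ∈ S), (g i : Set α) = canon (a i) := by
    refine Finset.exists_equiv_extend_of_card_eq (f := fun i : Fin j => canon (a i)) ?_ ?_ ?_
    · rw [Fintype.card_fin, ← ncard_eq_toFinset_card T hTfin, hTcard]
    · intro A hA
      obtain ⟨i, hi, rfl⟩ := Finset.mem_image.1 hA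
      exact hTfin.mem_toFinset.2 (hcT _ (ha _ (Finset.mem_filter.1 hi).2))
    · intro i hi k hk h
      have hi := (Finset.mem_filter.1 hi).2
      have hk := (Finset.mem_filter.1 hk).2
      exact Fin.ext (hinj _ hi _ hk (hc _ (ha _ hi) _ (ha _ hk) h))
  obtain ⟨g, hg⟩ := hex
  have hgT : ∀ i, (g i : Set α) ∈ T := fun i => hTfin.mem_toFinset.1 (g i).2
  -- On `S` the prescribed member is kept, which may be the one omitting `p`: the order inside a
  -- pair is part of the prescription.
  let r : ℕ → Set α := fun i => if h : i < j then (if i ∈ S then a i else g ⟨i, h⟩) else ∅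
  have hr : ∀ i (h : i < j), r i ∈ X ∧ canon (r i) = g ⟨i, h⟩ := by
    intro i h
    by_cases hS : i ∈ S
    · have : r i = a i := by simp only [r, h, hS, dif_pos, if_pos]
      rw [this, hg ⟨i, h⟩ (Finset.mem_filter.2 ⟨Finset.mem_univ _, hS⟩)]
      exact ⟨ha i hS, rfl⟩
    · have : r i = g ⟨i, h⟩ := by simp only [r, h, hS, dif_pos, if_false]
      rw [this]
      exact ⟨(hgT _).1, by simp only [canon, if_pos (hgT ⟨i, h⟩).2]⟩
  let l : ℕ → Set α := fun t => if t % 2 = 0 then r (t / 2 - n) else Ω \ r (t / 2 - n)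
  have hle : ∀ i, l (2 * n + 2 * i) = r i := fun i => by
    have h1 : (2 * n + 2 * i) % 2 = 0 := by omega
    have h2 : (2 * n + 2 * i) / 2 - n = i := by omega
    simp only [l, h1, h2, if_true]
  have hlo : ∀ i, l (2 * n + 2 * i + 1) = Ω \ r i := fun i => by
    have h1 : (2 * n + 2 * i + 1) % 2 ≠ 0 := by omega
    have h2 : (2 * n + 2 * i + 1) / 2 - n = i := by omega
    simp only [l, h1, h2, if_false]
  have hform : ∀ t ∈ Ico (2 * n) (2 * n + 2 * j), ∃ i, ∃ h : i < j,
      (t = 2 * n + 2 * i ∧ l t = r i ∨ t = 2 * n + 2 * i + 1 ∧ l t = Ω \ r i) ∧ l t ∈ X ∧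
        canon (l t) = g ⟨i, h⟩ := by
    rintro t ⟨h1, h2⟩
    obtain ⟨i, rfl | rfl⟩ : ∃ i, t = 2 * n + 2 * i ∨ t = 2 * n + 2 * i + 1 :=
      ⟨t / 2 - n, by omega⟩
    · have hi : i < j := by omega
      refine ⟨i, hi, .inl ⟨rfl, hle i⟩, ?_⟩
      rw [hle]
      exact hr i hi
    · have hi : i < j := by omega
      refine ⟨i, hi, .inr ⟨rfl, hlo i⟩, ?_⟩
      rw [hlo, hcc _ (hr i hi).1]
      exact ⟨hXc _ (hr i hi).1, (hr i hi).2⟩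
  refine ⟨l, ⟨?_, ?_, ?_⟩, ?_, ?_⟩
  · intro t ht
    obtain ⟨i, hi, -, h, -⟩ := hform t ht
    exact h
  · intro t ht t' ht' h
    obtain ⟨i, hi, h1, -, h2⟩ := hform t ht
    obtain ⟨i', hi', h1', -, h2'⟩ := hform t' ht'
    have : i = i' := by
      rw [h, h2'] at h2
      exact (Fin.mk.inj (g.injective (Subtype.ext h2))).symm
    subst this
    have := hnc (r i)
    rcases h1 with ⟨h1, h3⟩ | ⟨h1, h3⟩ <;> rcases h1' with ⟨h1', h3'⟩ | ⟨h1', h3'⟩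
    · omega
    · exact (this (h3.symm.trans (h.trans h3'))).elim
    · exact (this (h3'.symm.trans (h.symm.trans h3))).elim
    · omega
  · intro A hA
    obtain ⟨⟨i, hi⟩, h⟩ := g.surjective ⟨canon A, hTfin.mem_toFinset.2 (hcT A hA)⟩
    have h' : canon A = canon (r i) := by rw [(hr i hi).2, h]
    rcases hc A hA _ (hr i hi).1 h' with rfl | rfl
    · exact ⟨2 * n + 2 * i, ⟨by omega, by omega⟩, hle i⟩
    · exact ⟨2 * n + 2 * i + 1, ⟨by omega, by omega⟩, hlo i⟩
  · intro t h1 h2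
    obtain ⟨i, rfl⟩ := Nat.exists_eq_add_of_le (Nat.le_of_mul_le_mul_left h1 two_pos)
    rw [mul_add, hle, hlo, sdiff_sdiff_cancel_left (hr i (by omega)).1.1]
  · intro i hi hij
    have : r i = a i := by simp only [r, hij, hi, dif_pos, if_pos]
    rw [hle, hlo, this]
    exact ⟨rfl, rfl⟩

section Existence

variable {Θ : Type u}

/-- Guarantees that the entries passed on to the next list represent distinct complementary pairs.
-/
theorem task_inj {lam : ℕ → ℕ → Set (World Θ)} {n : ℕ} (hT : ∀ k ≤ n, TaskAt lam k) {k k' : ℕ}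
    (hk : n ≤ k) (hk' : n ≤ k') (he : 2 * k + 1 < listEnd lam n) (he' : 2 * k' + 1 < listEnd lam n)
    (h : lam n (2 * k) = lam n (2 * k') ∨ lam n (2 * k) = (stage lam n).Ω \ lam n (2 * k')) :
    k = k' := by
  have hb := (hT n le_rfl).bij
  rcases h with h | h
  · have := hb.injOn ⟨by omega, by omega⟩ ⟨by omega, by omega⟩ h
    omega
  · rw [(hT n le_rfl).paired k' (by omega) he',
      sdiff_sdiff_cancel_left (hb.mapsTo ⟨by omega, by omega⟩).1] at h
    have := hb.injOn ⟨by omega, by omega⟩ ⟨by omega, by omega⟩ h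
    omega

variable [Fintype Θ] [Inhabited Θ]

theorem exists_task_step (n : ℕ) (lam : ℕ → ℕ → Set (World Θ)) (hT : ∀ k < n, TaskAt lam k) :
    ∃ x, TaskAt (Function.update lam n x) n := by
  have hG : ∀ k < n, (stage lam k).Good := fun k hk => good_of_tasks fun i hi => hT i (by omega)
  have hu : ∀ x, ∀ k < n, Function.update lam n x k = lam k := fun x k hk =>
    Function.update_of_ne hk.ne _ _
  have hΩ : ∀ x, (stage (Function.update lam n x) n).Ω = (stage lam n).Ω := fun x =>
    stage_Ω_congr (hu x)
  have he : ∀ x, listEnd (Function.update lam n x) n = listEnd lam n := fun x =>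
    listEnd_congr (hu x)
  obtain ⟨j, hj, hej, hj'⟩ := listEnd_eq hG
  have hne : (stage lam n).Ω.Nonempty := by
    have := two_le_ncard_Ω hG
    exact nonempty_of_ncard_ne_zero (by omega)
  cases n with
  | zero =>
    obtain ⟨l, h1, h2, -⟩ := exists_paired_list (stage_Ω_finite hG) hne 0 hj' ∅ (fun _ => ∅)
      (by simp) (by simp)
    rw [← hej] at h1 h2
    refine ⟨l, ?_, ?_, ?_, ?_⟩
    · rw [he, hΩ, Function.update_self]; exact h1
    · rw [he, hΩ, Function.update_self]; exact h2
    · exact fun m hm => by omega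
    · exact fun m hm => by omega
  | succ m =>
    have hTm : ∀ k ≤ m, TaskAt lam k := fun k hk => hT k (by omega)
    have hgm := hG m (by omega)
    obtain ⟨i₀, hi₀, hei₀, -⟩ := listEnd_eq (lam := lam) (n := m) fun k hk => hG k (by omega)
    have hmono := listEnd_mono (lam := lam) (n := m) fun k hk => hG k (by omega)
    have hb := (hTm m le_rfl).bij
    -- `κ i` is the rank in `λ_m` of the pair prescribed at rank `i` of `λ_{m+1}`: a pending pair
    -- keeps its position, and the pair `m` just processed goes to the last rank `j - 1`.
    let κ : ℕ → ℕ := fun i => if 2 * (m + 1 + i) + 1 < listEnd lam m then m + 1 + i else m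
    let a : ℕ → Set (World Θ) := fun i => (stage lam m).mu (lam m (2 * κ i))
    have hκ : ∀ i, m ≤ κ i ∧ 2 * κ i + 1 < listEnd lam m := fun i => by
      simp only [κ]
      split_ifs <;> omega
    have hmem : ∀ i, lam m (2 * κ i) ∈ 𝒫 (stage lam m).Ω \ {∅, (stage lam m).Ω} := fun i => by
      have := hκ i
      exact hb.mapsTo ⟨by omega, by omega⟩
    have ha : ∀ i ∈ {i | 2 * (m + 1 + i) + 1 < listEnd lam m ∨ i = j - 1},
        a i ∈ 𝒫 (stage lam (m + 1)).Ω \ {∅, (stage lam (m + 1)).Ω} := by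
      intro i _
      have h := hmem i
      rw [stage_Ω_succ]
      refine ⟨hgm.mu_subset _, ?_⟩
      rintro (h' | h')
      · exact h.2 (.inl ((hgm.mu_eq_empty h.1).1 h'))
      · exact h.2 (.inr ((hgm.mu_inj h.1 Subset.rfl).1 h'))
    obtain ⟨l, h1, h2, h3⟩ := exists_paired_list (stage_Ω_finite hG) hne (m + 1) hj' _ a ha <| by
      intro i hi k hk h
      rw [stage_Ω_succ] at h
      simp only [a] at h
      rw [← hgm.mu_diff, hgm.mu_inj (hmem i).1 (hmem k).1,
        hgm.mu_inj (hmem i).1 sdiff_subset] at h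
      have h' := task_inj hTm (hκ i).1 (hκ k).1 (hκ i).2 (hκ k).2 h
      simp only [κ] at h'
      rw [mem_ofPred_eq] at hi hk
      split_ifs at h' <;> omega
    rw [← hej] at h1 h2
    have hst : ∀ x, stage (Function.update lam (m + 1) x) m = stage lam m := fun x =>
      stage_congr fun k hk => hu x k (by omega)
    refine ⟨l, ?_, ?_, ?_, ?_⟩
    · rw [he, hΩ, Function.update_self]; exact h1
    · rw [he, hΩ, Function.update_self]; exact h2
    · rintro m' hm' t ht1 ht2
      obtain rfl : m = m' := by omega
      rw [listEnd_congr fun k hk => hu l k (by omega)] at ht2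
      rw [Function.update_self, hst, hu l m (by omega)]
      obtain ⟨i, hi | hi⟩ : ∃ i, t = 2 * (m + 1) + 2 * i ∨ t = 2 * (m + 1) + 2 * i + 1 :=
        ⟨t / 2 - (m + 1), by omega⟩
      all_goals
        have hi' : 2 * (m + 1 + i) + 1 < listEnd lam m := by omega
        have h := h3 i (.inl hi') (by omega)
        have hκi : κ i = m + 1 + i := if_pos hi'
      · rw [hi, h.1]
        simp only [a, hκi, mul_add]
      · rw [hi, h.2]
        simp only [a, hκi]
        rw [(hTm m le_rfl).paired _ (by omega) hi', hgm.mu_diff, stage_Ω_succ,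
          sdiff_sdiff_cancel_left (hgm.mu_subset _)]
        simp only [mul_add]
    · intro m' hm'
      obtain rfl : m = m' := by omega
      rw [he, Function.update_self, hst]
      have h := (h3 (j - 1) (.inr rfl) (by omega)).1
      have hκi : κ (j - 1) = m := if_neg (by omega)
      simp only [a, hκi, ← stage_b lam] at h
      rw [← h, hej]
      congr 1
      omega

theorem exists_isTaskList : ∃ lam : ℕ → ℕ → Set (World Θ), IsTaskList lam := by
  obtain ⟨lam, h⟩ := exists_seq_of_step (fun n (lam : ℕ → ℕ → Set (World Θ)) => TaskAt lam n)
    (fun n _ _ h hl => hl.congr h) exists_task_step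
  exact ⟨lam, isTaskList_iff.2 h⟩

end Existence

/-! ### The limit model -/

section LimitModel

open World

variable {Θ : Type u} {lam : ℕ → ℕ → Set (World Θ)}

theorem stage_f_form {n : ℕ} (hG : ∀ k < n, (stage lam k).Good) {A B C : Set (World Θ)}
    (hA : A ⊆ (stage lam n).Ω) (hf : (stage lam n).f B A C) :
    (A = ∅ ∨ A = (stage lam n).Ω) ∨ ∃ ν, IsGreatest (earlier (stage lam) n (stage lam n).Ω A) ν ∧
      Quiet lam ν n ∧ ∃ D, (stage lam ν).IsHalf D ∧ A = liftTo (stage lam) (ν + 1) n D := by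
  rcases stage_f_cases hG hf with h | h | h
  · exact .inl (.inl h)
  · exact .inl (.inr h)
  · obtain ⟨ν, hν⟩ := exists_greatest hG hA h
    refine .inr ⟨ν, hν, quiet_of_isGreatest hG hA hν, ?_⟩
    have hνn : ν < n := hν.1.1
    have hgν := hG ν hνn
    obtain ⟨-, h | h⟩ := (mem_earlier hG hA).1 hν.1
    · exact ⟨_, .inl rfl, by rw [liftTo_mu _ hνn, h]⟩
    · refine ⟨_, .inr rfl, ?_⟩
      rw [← hgν.mu_diff, liftTo_mu _ hνn, liftTo_diff hG hνn.le hgν.b_subset, h,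
        sdiff_sdiff_cancel_left hA]

theorem stage_f_unique {n : ℕ} (hG : ∀ k < n, (stage lam k).Good) {A B C C' : Set (World Θ)}
    (hA : A ⊆ (stage lam n).Ω) (hf : (stage lam n).f B A C) (hf' : (stage lam n).f B A C') :
    C = C' := by
  rcases stage_f_form hG hA hf with h | ⟨ν, hν, hq, D, hD, rfl⟩
  · rw [stage_f_trivial hG h] at hf hf'
    rw [hf.2, hf'.2]
  · have hνn : ν < n := hν.1.1
    rw [stage_f_lift hG hνn hq hD] at hf hf'
    obtain ⟨B₁, h1, rfl, rfl⟩ := hf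
    obtain ⟨B₂, h2, h3, rfl⟩ := hf'
    rw [(liftTo_inj hG hνn h1 h2).1 h3]

theorem stage_f_subset {n : ℕ} (hG : ∀ k < n, (stage lam k).Good) {A B C : Set (World Θ)}
    (hA : A ⊆ (stage lam n).Ω) (hf : (stage lam n).f B A C) : C ⊆ (stage lam n).Ω := by
  rcases stage_f_form hG hA hf with h | ⟨ν, hν, hq, D, hD, rfl⟩
  · rw [stage_f_trivial hG h] at hf
    rw [hf.2]
    exact hf.1
  · have hνn : ν < n := hν.1.1
    rw [stage_f_lift hG hνn hq hD] at hf
    obtain ⟨B₁, h1, rfl, rfl⟩ := hf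
    refine liftTo_subset hG hνn ?_
    rw [stage_Ω_succ] at h1 ⊢
    exact (hG ν hνn).idT_subset (inter_subset_left.trans h1)

variable [Fintype Θ] [Inhabited Θ]

/-- The new exchange covers the old one, because non-empty cells are matched fibres over `w` and
`Tw`. This is the purpose of splitting `b_n` and `∼b_n` into cells. -/
theorem linked_iterate_fst {n ν : ℕ} (hT : ∀ k ≤ n, TaskAt lam k)
    (h : IsGreatest (earlier (stage lam) n (stage lam n).Ω (stage lam n).b) ν)
    {x y : World Θ} (hxy : (stage lam n).Linked x y) :
    fst^[n - (ν + 1)] y = (fst^[n - (ν + 1)] x).swap := by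
  have hG : ∀ k < n, (stage lam k).Good := fun k hk => good_of_tasks fun i hi => hT i (by omega)
  have hν : ν < n := h.1.1
  have hgν := hG ν hν
  obtain ⟨c, hc, hxy⟩ := hxy
  rcases (cells_reprocess hG hT h).1 c hc with rfl | ⟨w, hw, rfl⟩
  · rcases hxy with hxy | hxy
    exacts [hxy.1.elim, hxy.1.elim]
  · have hw := hgν.mu_subset _ hw
    have h1 : ({w} : Set (World Θ)) ⊆ (stage lam (ν + 1)).Ω := by
      rw [stage_Ω_succ]; exact singleton_subset_iff.2 hw
    have h2 : ({w.swap} : Set (World Θ)) ⊆ (stage lam (ν + 1)).Ω := by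
      rw [stage_Ω_succ]; exact singleton_subset_iff.2 (hgν.swap_mem hw)
    simp only [mem_liftTo hG hν h1, mem_liftTo hG hν h2, mem_singleton_iff] at hxy
    rcases hxy with hxy | hxy
    · rw [hxy.1.2, hxy.2.2]
    · rw [hxy.1.2, hxy.2.2, swap_swap]

/-- Coherence of the conditionals. Only a condition that is being reprocessed needs an argument:
there `f_{n+1}` is redefined, and it extends the old values since the exchange covers the one at
step `ν + 1`. -/
theorem stage_f_mu {n : ℕ} (hT : ∀ k ≤ n, TaskAt lam k) {A B C : Set (World Θ)}
    (hA : A ⊆ (stage lam n).Ω) (hB : B ⊆ (stage lam n).Ω) (hf : (stage lam n).f B A C) :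
    (stage lam (n + 1)).f ((stage lam n).mu B) ((stage lam n).mu A) ((stage lam n).mu C) := by
  have hG : ∀ k < n, (stage lam k).Good := fun k hk => good_of_tasks fun i hi => hT i (by omega)
  have hn := good_of_tasks hT
  rw [stage_f_succ]
  by_cases h0 : A = ∅ ∨ A = (stage lam n).Ω
  · obtain ⟨h1, rfl⟩ := (stage_f_trivial hG h0).1 hf
    rw [hn.nextF_trivial]
    · exact ⟨hn.mu_subset _, rfl⟩
    · rcases h0 with rfl | rfl
      exacts [.inl Stage.Good.mu_empty, .inr rfl]
  by_cases hb : A = (stage lam n).b ∨ A = (stage lam n).Ω \ (stage lam n).b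
  · have hhalf : (stage lam n).IsHalf ((stage lam n).mu A) := by
      rcases hb with rfl | rfl
      exacts [.inl rfl, .inr (hn.mu_diff _)]
    have hsame : earlier (stage lam) n (stage lam n).Ω A =
        earlier (stage lam) n (stage lam n).Ω (stage lam n).b := by
      rcases hb with rfl | rfl
      · rfl
      · simp only [earlier, sdiff_sdiff_cancel_left hn.b_subset, pair_comm]
    obtain ⟨ν, hν, hq, D, hD, hAD⟩ := (stage_f_form hG hA hf).resolve_left h0
    rw [hsame] at hν
    have hνn : ν < n := hν.1.1
    have hgν := hG ν hνn
    have hDΩ : D ⊆ (stage lam (ν + 1)).Ω := by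
      rw [stage_Ω_succ]; exact hgν.half_subset hD
    subst hAD
    obtain ⟨B', hB', rfl, rfl⟩ := (stage_f_lift hG hνn hq hD).1 hf
    have hI : idT (B' ∩ D) ⊆ (stage lam (ν + 1)).Ω := by
      rw [stage_Ω_succ] at hB' ⊢
      exact hgν.idT_subset (inter_subset_left.trans hB')
    rw [hn.nextF_half hhalf]
    refine ⟨hn.mu_subset _, ?_⟩
    ext w
    cases w with
    | val δ =>
      refine iff_of_false Stage.val_notMem_mu fun h => ?_
      rcases mem_idT.1 h with h | h
      exacts [Stage.val_notMem_mu h.1, Stage.val_notMem_mu h.1]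
    | pair x y =>
      simp only [mem_idT, mem_inter_iff, swap_pair, Stage.pair_mem_mu, mem_liftTo hG hνn hB',
        mem_liftTo hG hνn hDΩ, mem_liftTo hG hνn hI]
      constructor
      · rintro ⟨⟨hx, h⟩, hl⟩
        have hy := hn.linked_mem hl.symm
        have := linked_iterate_fst hT hν hl
        rw [this]
        exact h.imp (fun h => ⟨⟨⟨hx, h.1⟩, hl⟩, ⟨hx, h.2⟩, hl⟩)
          fun h => ⟨⟨⟨hy, h.1⟩, hl.symm⟩, ⟨hy, h.2⟩, hl.symm⟩
      · rintro (⟨⟨⟨hx, h1⟩, hl⟩, ⟨-, h2⟩, -⟩ | ⟨⟨⟨hy, h1⟩, hl⟩, ⟨-, h2⟩, -⟩)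
        · exact ⟨⟨hx, .inl ⟨h1, h2⟩⟩, hl⟩
        · rw [linked_iterate_fst hT hν hl.symm] at h1 h2
          exact ⟨⟨hn.linked_mem hl.symm, .inr ⟨h1, h2⟩⟩, hl.symm⟩
  · rw [not_or] at hb h0
    rw [hn.nextF_mu hA hb.1 hb.2 h0.1 h0.2]
    exact ⟨B, C, hB, hf, rfl, rfl⟩

theorem stage_f_liftTo {m n : ℕ} (hmn : m ≤ n) (hT : ∀ k ≤ n, TaskAt lam k)
    {A B C : Set (World Θ)} (hA : A ⊆ (stage lam m).Ω) (hB : B ⊆ (stage lam m).Ω)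
    (hf : (stage lam m).f B A C) : (stage lam n).f (liftTo (stage lam) m n B)
      (liftTo (stage lam) m n A) (liftTo (stage lam) m n C) := by
  induction n, hmn using Nat.le_induction with
  | base => simpa only [liftTo_self] using hf
  | succ n hmn ih =>
    have hT' : ∀ k ≤ n, TaskAt lam k := fun k hk => hT k (by omega)
    have hG : ∀ k < n, (stage lam k).Good := fun k hk =>
      good_of_tasks fun i hi => hT i (by omega)
    simp only [liftTo_succ _ hmn]
    exact stage_f_mu hT' (liftTo_subset hG hmn hA) (liftTo_subset hG hmn hB) (ih hT')

/-! ### Points and propositions of the limit. -/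

variable (hT : ∀ n, TaskAt lam n)
include hT

theorem stage_good (n : ℕ) : (stage lam n).Good := good_of_tasks fun k _ => hT k

omit [Fintype Θ] [Inhabited Θ] hT in
theorem Limit.mem (w : Limit lam) (n : ℕ) : w.1 n ∈ (stage lam n).Ω := (w.2 n).1

theorem Limit.fst_succ (w : Limit lam) (n : ℕ) : (w.1 (n + 1)).fst = w.1 n :=
  ((stage_good hT n).mem_mu.1 (w.2 n).2).2

theorem atInf_mu (n : ℕ) (A : Set (World Θ)) :
    atInf lam (n + 1) ((stage lam n).mu A) = atInf lam n A := by
  ext w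
  have h := w.mem (n + 1)
  rw [stage_Ω_succ] at h
  simp only [atInf, mem_ofPred_eq, (stage_good hT n).mem_mu, w.fst_succ hT, h, true_and]

theorem atInf_liftTo {m n : ℕ} (h : m ≤ n) (A : Set (World Θ)) :
    atInf lam n (liftTo (stage lam) m n A) = atInf lam m A := by
  induction n, h using Nat.le_induction with
  | base => rw [liftTo_self]
  | succ n h ih => rw [liftTo_succ _ h, atInf_mu hT, ih]

theorem exists_limit {n : ℕ} {x : World Θ} (hx : x ∈ (stage lam n).Ω) :
    ∃ w : Limit lam, w.1 n = x := by
  have hG := stage_good hT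
  have hex : ∀ k (x : World Θ), ∃ y, x ∈ (stage lam k).Ω → y ∈ (stage lam k).nextΩ ∧ y.fst = x :=
    fun k x => by
      by_cases hx : x ∈ (stage lam k).Ω
      · obtain ⟨y, hy⟩ := (hG k).exists_fst_eq hx
        exact ⟨y, fun _ => hy⟩
      · exact ⟨x, fun h => (hx h).elim⟩
  choose up hup using hex
  -- `g k` is a point of `Ω_{n+k}` above `x`. Its `n`-fold first projection lies in `Ω_k` and equals
  -- `x` for `k = n`, which gives the coordinates below and above `n` by one formula.
  let g : ℕ → World Θ := fun k => Nat.rec x (fun k y => up (n + k) y) k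
  have hg : ∀ k, g k ∈ (stage lam (n + k)).Ω := fun k => by
    induction k with
    | zero => exact hx
    | succ k ih =>
      have := (hup _ _ ih).1
      rwa [← stage_Ω_succ] at this
  have hg' : ∀ k, (g (k + 1)).fst = g k := fun k => (hup _ _ (hg k)).2
  have hmem : ∀ k, fst^[n] (g k) ∈ (stage lam k).Ω := fun k => by
    have := iterate_fst_mem (fun i _ => hG i) (Nat.le_add_left k n) (hg k)
    rwa [Nat.add_sub_cancel] at this
  have hfst : ∀ k, (fst^[n] (g (k + 1))).fst = fst^[n] (g k) := fun k => by
    rw [← Function.iterate_succ_apply' fst, Function.iterate_succ_apply, hg']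
  refine ⟨⟨fun k => fst^[n] (g k), fun k => ⟨hmem k, (hG k).mem_mu.2 ⟨?_, hfst k⟩⟩⟩, ?_⟩
  · have := hmem (k + 1)
    rwa [stage_Ω_succ] at this
  · have : ∀ k, fst^[k] (g k) = x := fun k => by
      induction k with
      | zero => rfl
      | succ k ih => rw [Function.iterate_succ_apply, hg', ih]
    exact this n

theorem atInf_subset_atInf {n : ℕ} {A B : Set (World Θ)} (hA : A ⊆ (stage lam n).Ω) :
    atInf lam n A ⊆ atInf lam n B ↔ A ⊆ B := by
  refine ⟨fun h x hx => ?_, fun h w hw => h hw⟩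
  obtain ⟨w, rfl⟩ := exists_limit hT (hA hx)
  exact h hx

theorem atInf_inj {n : ℕ} {A B : Set (World Θ)} (hA : A ⊆ (stage lam n).Ω)
    (hB : B ⊆ (stage lam n).Ω) : atInf lam n A = atInf lam n B ↔ A = B := by
  rw [Subset.antisymm_iff, atInf_subset_atInf hT hA, atInf_subset_atInf hT hB,
    ← Subset.antisymm_iff]

omit [Fintype Θ] [Inhabited Θ] hT in
theorem atInf_Ω (n : ℕ) : atInf lam n (stage lam n).Ω = univ :=
  eq_univ_of_forall fun w => w.mem n

omit [Fintype Θ] [Inhabited Θ] hT in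
theorem atInf_diff (n : ℕ) (A : Set (World Θ)) :
    atInf lam n ((stage lam n).Ω \ A) = (atInf lam n A)ᶜ := by
  ext w
  exact ⟨fun h => h.2, fun h => ⟨w.mem n, h⟩⟩

theorem exists_rep {B : Set (Limit lam)} (hB : B ∈ MInf lam) :
    ∃ N, ∀ n, N ≤ n → ∃ b ⊆ (stage lam n).Ω, B = atInf lam n b := by
  obtain ⟨N, b, hb, rfl⟩ := hB
  exact ⟨N, fun n hn => ⟨liftTo (stage lam) N n b,
    liftTo_subset (fun k _ => stage_good hT k) hn hb, (atInf_liftTo hT hn b).symm⟩⟩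

/-- Every proper non-empty part of `Ω_N` is processed at a later step. -/
theorem exists_processed {N : ℕ} {A : Set (World Θ)} (hA : A ⊆ (stage lam N).Ω)
    (h0 : A ≠ ∅) (h1 : A ≠ (stage lam N).Ω) : ∃ n, N ≤ n ∧
      (liftTo (stage lam) N n A = (stage lam n).b ∨
        liftTo (stage lam) N n A = (stage lam n).Ω \ (stage lam n).b) := by
  have hG : ∀ n, ∀ k < n, (stage lam k).Good := fun n k _ => stage_good hT k
  obtain ⟨t, ht, rfl⟩ := (hT N).bij.surjOn ⟨hA, by rintro (h | h) <;> tauto⟩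
  -- An entry keeps its position `t` while the start `2k` of the list advances, so its pair is at
  -- the head at step `t / 2`.
  have hk : ∀ k, N ≤ k → 2 * k ≤ t →
      t < listEnd lam k ∧ liftTo (stage lam) N k (lam N t) = lam k t := by
    intro k hk
    induction k, hk using Nat.le_induction with
    | base => exact fun _ => ⟨ht.2, liftTo_self _ _ _⟩
    | succ k hk ih =>
      intro hkt
      obtain ⟨h2, h3⟩ := ih (by omega)
      have := listEnd_mono (lam := lam) (n := k) fun i _ => stage_good hT i
      exact ⟨by omega, by rw [liftTo_succ _ hk, h3, (hT _).shift k rfl t hkt h2]⟩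
  have ht1 := ht.1
  refine ⟨t / 2, by omega, ?_⟩
  rw [(hk (t / 2) (by omega) (by omega)).2, ← (task_compl (hG _) fun k _ => hT k).1, stage_b]
  rcases Nat.even_or_odd' t with ⟨s, rfl | rfl⟩
  · left
    congr 1
    omega
  · right
    congr 1
    omega

/-- The step may be taken beyond any `N`, so the other propositions involved can be represented at
the step that has just processed `A`. -/
theorem exists_half {A : Set (Limit lam)} (hA : A ∈ MInf lam) (h0 : A ≠ ∅) (h1 : A ≠ univ)
    (N : ℕ) : ∃ n, N ≤ n ∧ ∃ D, (stage lam n).IsHalf D ∧ A = atInf lam (n + 1) D := by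
  obtain ⟨M, hM⟩ := exists_rep hT hA
  obtain ⟨a, ha, rfl⟩ := hM (max M N) (le_max_left _ _)
  obtain ⟨n, hn, h⟩ := exists_processed hT ha (by rintro rfl; exact h0 rfl)
    (by rintro rfl; exact h1 (atInf_Ω _))
  refine ⟨n, (le_max_right _ _).trans hn, (stage lam n).mu (liftTo (stage lam) (max M N) n a),
    ?_, ?_⟩
  · rcases h with h | h <;> rw [h]
    · exact .inl rfl
    · exact .inr ((stage_good hT n).mu_diff _)
  · rw [atInf_mu hT, atInf_liftTo hT hn]

/-! ### The conditional on the limit. -/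

theorem Represents.liftTo {A B : Set (Limit lam)} {n m : ℕ} {a b c : Set (World Θ)}
    (h : Represents lam B A n b a c) (hnm : n ≤ m) : Represents lam B A m
      (liftTo (stage lam) n m b) (liftTo (stage lam) n m a) (liftTo (stage lam) n m c) := by
  have hG : ∀ k < m, (stage lam k).Good := fun k _ => stage_good hT k
  obtain ⟨ha, hb, hA, hB, hf⟩ := h
  refine ⟨liftTo_subset hG hnm ha, liftTo_subset hG hnm hb, ?_, ?_,
    stage_f_liftTo hnm (fun k _ => hT k) ha hb hf⟩
  · rw [atInf_liftTo hT hnm, hA]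
  · rw [atInf_liftTo hT hnm, hB]

theorem Represents.unique {A B : Set (Limit lam)} {n m : ℕ} {a b c a' b' c' : Set (World Θ)}
    (h : Represents lam B A n b a c) (h' : Represents lam B A m b' a' c') :
    atInf lam n c = atInf lam m c' := by
  have hG : ∀ k < max n m, (stage lam k).Good := fun k _ => stage_good hT k
  have hn := le_max_left n m
  have hm := le_max_right n m
  obtain ⟨ha, hb, hA, hB, hf⟩ := h.liftTo hT hn
  obtain ⟨ha', hb', hA', hB', hf'⟩ := h'.liftTo hT hm
  rw [hA, atInf_inj hT ha ha'] at hA'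
  rw [hB, atInf_inj hT hb hb'] at hB'
  rw [← hA', ← hB'] at hf'
  rw [← atInf_liftTo hT hn, ← atInf_liftTo hT hm, stage_f_unique hG ha hf hf']

theorem Represents.fInf_eq {A B : Set (Limit lam)} {n : ℕ} {a b c : Set (World Θ)}
    (h : Represents lam B A n b a c) : fInf lam B A = atInf lam n c := by
  ext w
  constructor
  · rintro ⟨m, b', a', c', h', hw⟩
    rwa [h.unique hT h']
  · exact fun hw => ⟨n, b, a, c, h, hw⟩

theorem represents_trivial {A : Set (Limit lam)} (hA : A = ∅ ∨ A = univ) {n : ℕ}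
    {b : Set (World Θ)} (hb : b ⊆ (stage lam n).Ω) :
    ∃ a, Represents lam (atInf lam n b) A n b a b := by
  have hG : ∀ k < n, (stage lam k).Good := fun k _ => stage_good hT k
  rcases hA with rfl | rfl
  · exact ⟨∅, empty_subset _, hb, rfl, rfl, (stage_f_trivial hG (.inl rfl)).2 ⟨hb, rfl⟩⟩
  · exact ⟨_, Subset.rfl, hb, (atInf_Ω n).symm, rfl,
      (stage_f_trivial hG (.inr rfl)).2 ⟨hb, rfl⟩⟩

theorem represents_half {n : ℕ} {D b : Set (World Θ)} (hD : (stage lam n).IsHalf D)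
    (hb : b ⊆ (stage lam (n + 1)).Ω) :
    Represents lam (atInf lam (n + 1) b) (atInf lam (n + 1) D) (n + 1) b D (idT (b ∩ D)) := by
  have hn := stage_good hT n
  refine ⟨?_, hb, rfl, rfl, ?_⟩
  · rw [stage_Ω_succ]
    exact hn.half_subset hD
  · rw [stage_Ω_succ] at hb
    rw [stage_f_succ, hn.nextF_half hD]
    exact ⟨hb, rfl⟩

theorem fInf_trivial {A B : Set (Limit lam)} (hB : B ∈ MInf lam) (hA : A = ∅ ∨ A = univ) :
    fInf lam B A = B := by
  obtain ⟨n, b, hb, rfl⟩ := hB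
  obtain ⟨a, h⟩ := represents_trivial hT hA hb
  exact h.fInf_eq hT

theorem fInf_half {n : ℕ} {D b : Set (World Θ)} (hD : (stage lam n).IsHalf D)
    (hb : b ⊆ (stage lam (n + 1)).Ω) :
    fInf lam (atInf lam (n + 1) b) (atInf lam (n + 1) D) = atInf lam (n + 1) (idT (b ∩ D)) :=
  (represents_half hT hD hb).fInf_eq hT

/-- `f(b, D)` tests `b` at whichever of `w`, `Tw` lies in `D`. The model axioms reduce to
propositional logic through this. -/
theorem mem_idT_half {n : ℕ} {D b : Set (World Θ)} (hD : (stage lam n).IsHalf D)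
    {w : World Θ} (hw : w ∈ (stage lam (n + 1)).Ω) :
    w ∈ idT (b ∩ D) ↔ (w ∈ D ∧ w ∈ b) ∨ (w ∉ D ∧ w.swap ∈ b) := by
  rw [stage_Ω_succ] at hw
  simp only [mem_idT, mem_inter_iff, (stage_good hT n).swap_mem_half hD hw]
  tauto

theorem exists_represents {A B : Set (Limit lam)} (hA : A ∈ MInf lam) (hB : B ∈ MInf lam) :
    ∃ n b a c, Represents lam B A n b a c := by
  by_cases h : A = ∅ ∨ A = univ
  · obtain ⟨n, b, hb, rfl⟩ := hB
    obtain ⟨a, h⟩ := represents_trivial hT h hb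
    exact ⟨n, b, a, b, h⟩
  · rw [not_or] at h
    obtain ⟨N, hN⟩ := exists_rep hT hB
    obtain ⟨n, hn, D, hD, rfl⟩ := exists_half hT hA h.1 h.2 N
    obtain ⟨b, hb, rfl⟩ := hN (n + 1) (by omega)
    exact ⟨_, _, _, _, represents_half hT hD hb⟩

theorem fInf_mem {A B : Set (Limit lam)} (hA : A ∈ MInf lam) (hB : B ∈ MInf lam) :
    fInf lam B A ∈ MInf lam := by
  obtain ⟨n, b, a, c, h⟩ := exists_represents hT hA hB
  exact ⟨n, c, stage_f_subset (fun k _ => stage_good hT k) h.1 h.2.2.2.2, h.fInf_eq hT⟩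

omit [Fintype Θ] [Inhabited Θ] hT in
theorem compl_mem_MInf {A : Set (Limit lam)} (hA : A ∈ MInf lam) : Aᶜ ∈ MInf lam := by
  obtain ⟨n, a, ha, rfl⟩ := hA
  exact ⟨n, _, sdiff_subset, (atInf_diff n a).symm⟩

theorem inter_mem_MInf {A B : Set (Limit lam)} (hA : A ∈ MInf lam) (hB : B ∈ MInf lam) :
    A ∩ B ∈ MInf lam := by
  obtain ⟨N, hN⟩ := exists_rep hT hA
  obtain ⟨M, hM⟩ := exists_rep hT hB
  obtain ⟨a, ha, rfl⟩ := hN (max N M) (le_max_left _ _)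
  obtain ⟨b, hb, rfl⟩ := hM (max N M) (le_max_right _ _)
  exact ⟨_, a ∩ b, inter_subset_left.trans ha, rfl⟩

theorem union_mem_MInf {A B : Set (Limit lam)} (hA : A ∈ MInf lam) (hB : B ∈ MInf lam) :
    A ∪ B ∈ MInf lam := by
  rw [← compl_compl (A ∪ B), compl_union]
  exact compl_mem_MInf (inter_mem_MInf hT (compl_mem_MInf hA) (compl_mem_MInf hB))

omit [Fintype Θ] [Inhabited Θ] hT in
theorem univ_mem_MInf : univ ∈ MInf lam := ⟨0, _, Subset.rfl, (atInf_Ω 0).symm⟩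

omit [Fintype Θ] [Inhabited Θ] hT in
theorem empty_mem_MInf : ∅ ∈ MInf lam := ⟨0, ∅, empty_subset _, rfl⟩

omit [Fintype Θ] [Inhabited Θ] hT in
theorem hInf_mem (θ : Θ) : hInf lam θ ∈ MInf lam := by
  refine ⟨0, _, ?_, rfl⟩
  rintro _ ⟨δ, -, rfl⟩
  exact mem_range_self _

/-- To prove a property of all pairs of propositions, it suffices to treat the trivial conditions
and the pairs at a step that has just processed the condition. -/
theorem fInf_induction {P : Set (Limit lam) → Set (Limit lam) → Prop}
    (htriv : ∀ A B, B ∈ MInf lam → A = ∅ ∨ A = univ → P A B)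
    (hhalf : ∀ n D b, (stage lam n).IsHalf D → b ⊆ (stage lam (n + 1)).Ω →
      P (atInf lam (n + 1) D) (atInf lam (n + 1) b))
    {A B : Set (Limit lam)} (hA : A ∈ MInf lam) (hB : B ∈ MInf lam) : P A B := by
  by_cases h : A = ∅ ∨ A = univ
  · exact htriv A B hB h
  · rw [not_or] at h
    obtain ⟨N, hN⟩ := exists_rep hT hB
    obtain ⟨n, hn, D, hD, rfl⟩ := exists_half hT hA h.1 h.2 N
    obtain ⟨b, hb, rfl⟩ := hN (n + 1) (by omega)
    exact hhalf n D b hD hb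

theorem fInf_eq_univ {A B : Set (Limit lam)} (hA : A ∈ MInf lam) (hB : B ∈ MInf lam)
    (hAB : A ⊆ B) (h0 : A ≠ ∅) : fInf lam B A = univ := by
  revert hAB h0
  refine fInf_induction hT (P := fun A B => A ⊆ B → A ≠ ∅ → fInf lam B A = univ) ?_ ?_ hA hB
  · rintro A B hB h hAB h0
    rw [fInf_trivial hT hB h]
    exact eq_univ_of_univ_subset (h.resolve_left h0 ▸ hAB)
  · intro n D b hD hb hAB _
    have hn := stage_good hT n
    have hDΩ : D ⊆ (stage lam (n + 1)).Ω := by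
      rw [stage_Ω_succ]; exact hn.half_subset hD
    rw [atInf_subset_atInf hT hDΩ] at hAB
    rw [fInf_half hT hD hb]
    refine eq_univ_of_forall fun w => ?_
    have hw := w.mem (n + 1)
    refine (mem_idT_half hT hD hw).2 ?_
    rw [stage_Ω_succ] at hw
    have := hn.swap_mem_half hD hw
    by_cases h : w.1 (n + 1) ∈ D
    · exact .inl ⟨h, hAB h⟩
    · exact .inr ⟨h, hAB (this.2 h)⟩

theorem inter_fInf_subset {A B : Set (Limit lam)} (hA : A ∈ MInf lam) (hB : B ∈ MInf lam) :
    A ∩ fInf lam B A ⊆ B := by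
  refine fInf_induction hT (P := fun A B => A ∩ fInf lam B A ⊆ B) ?_ ?_ hA hB
  · intro A B hB h
    rw [fInf_trivial hT hB h]
    exact inter_subset_right
  · intro n D b hD hb
    rw [fInf_half hT hD hb]
    rintro w ⟨h1, h2⟩
    have h2 := (mem_idT_half hT hD (w.mem (n + 1))).1 h2
    exact (h2.resolve_right fun h => h.1 h1).2

theorem fInf_compl {A B : Set (Limit lam)} (hA : A ∈ MInf lam) (hB : B ∈ MInf lam) :
    fInf lam Bᶜ A = (fInf lam B A)ᶜ := by
  refine fInf_induction hT (P := fun A B => fInf lam Bᶜ A = (fInf lam B A)ᶜ) ?_ ?_ hA hB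
  · intro A B hB h
    rw [fInf_trivial hT hB h, fInf_trivial hT (compl_mem_MInf hB) h]
  · intro n D b hD hb
    rw [← atInf_diff, fInf_half hT hD hb, fInf_half hT hD sdiff_subset]
    ext w
    have hw := w.mem (n + 1)
    have hs : (w.1 (n + 1)).swap ∈ (stage lam (n + 1)).Ω := by
      rw [stage_Ω_succ] at hw ⊢
      exact (stage_good hT n).swap_mem hw
    rw [← atInf_diff]
    simp only [atInf, mem_ofPred_eq, Set.mem_sdiff, mem_idT_half hT hD hw, hw, hs]
    tauto

/-- Three propositions are involved, so `fInf_induction` does not apply; the step is chosen past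
representatives of both `B` and `C`. -/
theorem fInf_union_subset {A B C : Set (Limit lam)} (hA : A ∈ MInf lam) (hB : B ∈ MInf lam)
    (hC : C ∈ MInf lam) : fInf lam (B ∪ C) A ⊆ fInf lam B A ∪ fInf lam C A := by
  by_cases h : A = ∅ ∨ A = univ
  · rw [fInf_trivial hT hB h, fInf_trivial hT hC h, fInf_trivial hT (union_mem_MInf hT hB hC) h]
  · rw [not_or] at h
    obtain ⟨N, hN⟩ := exists_rep hT hB
    obtain ⟨M, hM⟩ := exists_rep hT hC
    obtain ⟨n, hn, D, hD, rfl⟩ := exists_half hT hA h.1 h.2 (max N M)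
    obtain ⟨b, hb, rfl⟩ := hN (n + 1) (by omega)
    obtain ⟨c, hc, rfl⟩ := hM (n + 1) (by omega)
    have hu : atInf lam (n + 1) b ∪ atInf lam (n + 1) c = atInf lam (n + 1) (b ∪ c) := rfl
    rw [hu, fInf_half hT hD hb, fInf_half hT hD hc, fInf_half hT hD (union_subset hb hc)]
    intro w hw
    simp only [atInf, mem_union, mem_ofPred_eq, mem_idT_half hT hD (w.mem (n + 1))] at hw ⊢
    tauto

/-- The hypothesis says that `B` is invariant under the exchange of the step processing `A`, and
that exchange also serves `∼A`. -/
theorem fInf_compl_eq {A B : Set (Limit lam)} (hA : A ∈ MInf lam) (hB : B ∈ MInf lam)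
    (h : fInf lam B A = B) : fInf lam B Aᶜ = B := by
  revert h
  refine fInf_induction hT (P := fun A B => fInf lam B A = B → fInf lam B Aᶜ = B) ?_ ?_ hA hB
  · intro A B hB h _
    refine fInf_trivial hT hB ?_
    rw [compl_empty_iff, compl_univ_iff]
    exact h.symm
  · intro n D b hD hb h
    have hn := stage_good hT n
    have hDc := hn.half_compl hD
    rw [← stage_Ω_succ] at hDc
    rw [← atInf_diff, fInf_half hT hDc hb]
    rw [fInf_half hT hD hb] at h
    have key : ∀ v ∈ (stage lam (n + 1)).Ω, v ∈ idT (b ∩ D) ↔ v ∈ b := fun v hv => by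
      obtain ⟨w, rfl⟩ := exists_limit hT hv
      exact Set.ext_iff.1 h w
    ext w
    have hw := w.mem (n + 1)
    have hw' := hw
    rw [stage_Ω_succ] at hw'
    have hs := hn.swap_mem hw'
    rw [← stage_Ω_succ] at hs
    have k1 := key _ hw
    have k2 := key _ hs
    have k3 := hn.swap_mem_half hD hw'
    rw [mem_idT_half hT hD hw] at k1
    rw [mem_idT_half hT hD hs, swap_swap] at k2
    simp only [atInf, mem_ofPred_eq, mem_idT_half hT hDc hw, Set.mem_sdiff]
    tauto

theorem isConditionalModelStar : IsConditionalModelStar (MInf lam) (hInf lam) (fInf lam) where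
  inter_mem _ hA _ hB := inter_mem_MInf hT hA hB
  compl_mem _ hA := compl_mem_MInf hA
  h_mem := hInf_mem
  f_mem _ hA _ hB := fInf_mem hT hA hB
  beta1 _ hA _ hB := fInf_eq_univ hT hA hB
  beta2 _ hA _ hB _ hC := fInf_union_subset hT hA hB hC
  beta3 _ hA _ hB := inter_fInf_subset hT hA hB
  beta4 _ hA _ hB := fInf_compl hT hA hB
  beta5w _ hA _ hB := fInf_compl_eq hT hA hB

/-! ### Soundness -/

section Soundness

omit [Fintype Θ] [Inhabited Θ] hT

theorem mem_interp_neg {φ : Form Θ} {w : Limit lam} :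
    w ∈ interp lam (.neg φ) ↔ w ∉ interp lam φ := Iff.rfl

theorem mem_interp_imp {φ ψ : Form Θ} {w : Limit lam} :
    w ∈ interp lam (.imp φ ψ) ↔ (w ∈ interp lam φ → w ∈ interp lam ψ) := imp_iff_not_or.symm

theorem mem_interp_box {φ : Form Θ} {w : Limit lam} :
    w ∈ interp lam (.box φ) ↔ ∀ v, v ∈ interp lam φ := Iff.rfl

theorem mem_interp_cond {φ ψ : Form Θ} {w : Limit lam} :
    w ∈ interp lam (.cond ψ φ) ↔ w ∈ fInf lam (interp lam ψ) (interp lam φ) := Iff.rfl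

theorem mem_interp_or {φ ψ : Form Θ} {w : Limit lam} :
    w ∈ interp lam (.or φ ψ) ↔ w ∈ interp lam φ ∨ w ∈ interp lam ψ := by
  rw [Form.or, mem_interp_imp, mem_interp_neg, or_iff_not_imp_left]

theorem interp_or (φ ψ : Form Θ) : interp lam (.or φ ψ) = interp lam φ ∪ interp lam ψ :=
  Set.ext fun _ => mem_interp_or

theorem mem_interp_and {φ ψ : Form Θ} {w : Limit lam} :
    w ∈ interp lam (.and φ ψ) ↔ w ∈ interp lam φ ∧ w ∈ interp lam ψ := by
  rw [Form.and, mem_interp_neg, mem_interp_or, mem_interp_neg, mem_interp_neg]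
  tauto

theorem interp_and (φ ψ : Form Θ) : interp lam (.and φ ψ) = interp lam φ ∩ interp lam ψ :=
  Set.ext fun _ => mem_interp_and

theorem mem_interp_iff {φ ψ : Form Θ} {w : Limit lam} :
    w ∈ interp lam (.iff φ ψ) ↔ (w ∈ interp lam φ ↔ w ∈ interp lam ψ) := by
  rw [Form.iff, mem_interp_and, mem_interp_imp, mem_interp_imp]
  tauto

theorem mem_interp_indep {φ ψ : Form Θ} {w : Limit lam} :
    w ∈ interp lam (.indep ψ φ) ↔ fInf lam (interp lam ψ) (interp lam φ) = interp lam ψ := by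
  rw [Form.indep, mem_interp_box, Set.ext_iff]
  exact forall_congr' fun v => mem_interp_iff

theorem interp_top [Inhabited Θ] : interp lam .top = univ :=
  eq_univ_of_forall fun _ => mem_interp_imp.2 id

theorem interp_bot [Inhabited Θ] : interp lam .bot = ∅ := by
  rw [Form.bot, interp, interp_top, compl_univ]

end Soundness

theorem interp_mem (φ : Form Θ) : interp lam φ ∈ MInf lam := by
  induction φ with
  | atom θ => exact hInf_mem θ
  | neg φ ih => exact compl_mem_MInf ih
  | imp φ ψ ih1 ih2 => exact union_mem_MInf hT (compl_mem_MInf ih1) ih2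
  | box φ ih =>
    by_cases h : ∀ w, w ∈ interp lam φ
    · have : interp lam (.box φ) = univ := eq_univ_of_forall fun _ => h
      rw [this]
      exact univ_mem_MInf
    · have : interp lam (.box φ) = ∅ := eq_empty_of_forall_notMem fun _ => h
      rw [this]
      exact empty_mem_MInf
  | cond ψ φ ih1 ih2 => exact fInf_mem hT ih2 ih1

/-- The model axioms concern sets in `M_∞`, hence the appeal to `interp_mem`. For `b2`, implication
is read as a union with a complement, so the union and complement axioms combine. -/
theorem ProvStar.mem_interp {φ : Form Θ} (h : ProvStar φ) (w : Limit lam) :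
    w ∈ interp lam φ := by
  have hm := interp_mem (lam := lam) hT
  induction h generalizing w with
  | c1 φ ψ => simp only [mem_interp_imp]; tauto
  | c2 η φ ψ => simp only [mem_interp_imp]; tauto
  | c3 φ ψ => simp only [mem_interp_imp, mem_interp_neg]; tauto
  | mp φ ψ _ _ h1 h2 => exact mem_interp_imp.1 (h2 w) (h1 w)
  | m1 φ _ ih => exact ih
  | m2 φ ψ =>
    simp only [mem_interp_imp, mem_interp_box]
    exact fun h1 h2 v => h1 v (h2 v)
  | m3 φ =>
    simp only [mem_interp_imp, mem_interp_box]
    exact fun h => h w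
  | b1 φ ψ =>
    simp only [mem_interp_imp, mem_interp_or, mem_interp_box, mem_interp_neg, mem_interp_cond]
    intro h
    rcases eq_empty_or_nonempty (interp lam φ) with h0 | h0
    · exact .inl fun v hv => h0.subset hv
    · rw [fInf_eq_univ hT (hm φ) (hm ψ) h h0.ne_empty]
      exact .inr mem_univ
  | b2 φ ψ η =>
    simp only [mem_interp_imp, mem_interp_cond]
    intro h1 h2
    have h := fInf_union_subset hT (hm φ) (compl_mem_MInf (hm ψ)) (hm η) h1
    rw [fInf_compl hT (hm φ) (hm ψ)] at h
    exact h.resolve_left (not_not_intro h2)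
  | b3 φ ψ =>
    simp only [mem_interp_imp, mem_interp_cond]
    exact fun h1 h2 => inter_fInf_subset hT (hm φ) (hm ψ) ⟨h2, h1⟩
  | b4 φ ψ =>
    rw [mem_interp_iff, mem_interp_neg, mem_interp_cond, mem_interp_cond, interp,
      fInf_compl hT (hm φ) (hm ψ), notMem_compl_iff]
  | b5wA φ ψ =>
    rw [mem_interp_iff, mem_interp_indep, mem_interp_indep, interp]
    refine ⟨fun h => ?_, fInf_compl_eq hT (hm φ) (hm ψ)⟩
    have := fInf_compl_eq hT (compl_mem_MInf (hm φ)) (hm ψ) h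
    rwa [compl_compl] at this
  | b5wB φ ψ η =>
    simp only [mem_interp_imp, mem_interp_box, mem_interp_iff, mem_interp_cond]
    intro h v
    rw [Set.ext h]

end LimitModel

/-! ### The weights of one step -/

namespace Stage.Good

open World

variable {Θ : Type u} {S : Stage Θ} {p : World Θ → ℝ}

/-- The cell picked by choice in `nextWeight` is `c`, as a point lies in only one cell. -/
theorem nextWeight_fst (hS : S.Good) (p : World Θ → ℝ) {c : Set (World Θ) × Set (World Θ)}
    (hc : c ∈ S.cells) {x y : World Θ} (hx : x ∈ c.1) (hy : y ∈ c.2) :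
    nextWeight S p (pair x y) = p x * p y / ∑ᶠ w ∈ c.2, p w := by
  have h : ∃ c ∈ S.cells, x ∈ c.1 ∧ y ∈ c.2 := ⟨c, hc, hx, hy⟩
  rw [nextWeight, dif_pos h,
    ← hS.fst_unique c hc h.choose h.choose_spec.1 x hx h.choose_spec.2.1]

theorem nextWeight_snd (hS : S.Good) (p : World Θ → ℝ) {c : Set (World Θ) × Set (World Θ)}
    (hc : c ∈ S.cells) {x y : World Θ} (hx : x ∈ c.1) (hy : y ∈ c.2) :
    nextWeight S p (pair y x) = p x * p y / ∑ᶠ w ∈ c.1, p w := by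
  have h' : ¬ ∃ c ∈ S.cells, y ∈ c.1 ∧ x ∈ c.2 := by
    rintro ⟨d, hd, h, -⟩
    exact (hS.snd_subset c hc hy).2 (hS.fst_subset d hd h)
  have h : ∃ c ∈ S.cells, y ∈ c.2 ∧ x ∈ c.1 := ⟨c, hc, hy, hx⟩
  rw [nextWeight, dif_neg h', dif_pos h,
    ← hS.fst_unique c hc h.choose h.choose_spec.1 x hx h.choose_spec.2.2, mul_comm]

theorem sum_pos (hS : S.Good) (hp : ∀ w ∈ S.Ω, 0 < p w) {A : Set (World Θ)} (hA : A ⊆ S.Ω)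
    (h : A.Nonempty) : 0 < ∑ᶠ w ∈ A, p w := by
  have hfin := hS.finite.subset hA
  rw [finsum_mem_eq_finite_toFinset_sum _ hfin]
  exact Finset.sum_pos (fun w hw => hp w (hA (hfin.mem_toFinset.1 hw)))
    (hfin.toFinset_nonempty.2 h)

theorem cell_sum_pos (hS : S.Good) (hp : ∀ w ∈ S.Ω, 0 < p w)
    {c : Set (World Θ) × Set (World Θ)} (hc : c ∈ S.cells) (h : c.1.Nonempty) :
    0 < ∑ᶠ w ∈ c.1, p w ∧ 0 < ∑ᶠ w ∈ c.2, p w :=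
  ⟨hS.sum_pos hp ((hS.fst_subset c hc).trans hS.b_subset) h,
    hS.sum_pos hp ((hS.snd_subset c hc).trans sdiff_subset) ((hS.nonempty_iff c hc).1 h)⟩

theorem nextWeight_pos (hS : S.Good) (hp : ∀ w ∈ S.Ω, 0 < p w) {w : World Θ}
    (hw : w ∈ S.nextΩ) : 0 < nextWeight S p w := by
  cases w with
  | val δ => exact (val_notMem_mu hw).elim
  | pair x y =>
    have hl := hS.pair_mem_nextΩ.1 hw
    have hx := hp x (hS.linked_mem hl)
    have hy := hp y (hS.linked_mem hl.symm)
    obtain ⟨c, hc, h | h⟩ := hl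
    · rw [hS.nextWeight_fst p hc h.1 h.2]
      exact div_pos (mul_pos hx hy) (hS.cell_sum_pos hp hc ⟨x, h.1⟩).2
    · rw [hS.nextWeight_snd p hc h.2 h.1]
      exact div_pos (mul_pos hy hx) (hS.cell_sum_pos hp hc ⟨y, h.2⟩).1

/-- The fibre over `x ∈ Π` is `{x} × Γ`, and the weights `p y / P(Γ)` sum to `1` over `Γ`; likewise
with `Π` and `Γ` exchanged. Positivity of `p` keeps the denominators non-zero. -/
theorem sum_mu_singleton (hS : S.Good) (hp : ∀ w ∈ S.Ω, 0 < p w) {x : World Θ}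
    (hx : x ∈ S.Ω) : ∑ᶠ w ∈ S.mu {x}, nextWeight S p w = p x := by
  have hinj : ∀ s : Set (World Θ), InjOn (pair x) s := fun s y _ z _ h => (pair.inj h).2
  by_cases hb : x ∈ S.b
  · obtain ⟨c, hc, hxc⟩ := hS.exists_fst x hb
    have hpos := (hS.cell_sum_pos hp hc ⟨x, hxc⟩).2
    have himg : S.mu {x} = pair x '' c.2 := by
      ext w
      constructor
      · intro h
        cases w with
        | val δ => exact (val_notMem_mu h).elim
        | pair x' y =>
          obtain ⟨rfl, d, hd, h | h⟩ := pair_mem_mu.1 h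
          · obtain rfl := hS.fst_unique c hc d hd _ hxc h.1
            exact ⟨y, h.2, rfl⟩
          · exact ((hS.snd_subset d hd h.1).2 hb).elim
      · rintro ⟨y, hy, rfl⟩
        exact pair_mem_mu.2 ⟨rfl, c, hc, .inl ⟨hxc, hy⟩⟩
    rw [himg, finsum_mem_image (hinj _), finsum_mem_congr rfl fun y hy =>
      (hS.nextWeight_fst p hc hxc hy).trans (mul_div_right_comm _ _ _), ← mul_finsum_mem]
    exact div_mul_cancel₀ _ hpos.ne'
  · obtain ⟨c, hc, hxc⟩ := hS.exists_snd x ⟨hx, hb⟩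
    have hpos := (hS.cell_sum_pos hp hc ((hS.nonempty_iff c hc).2 ⟨x, hxc⟩)).1
    have himg : S.mu {x} = pair x '' c.1 := by
      ext w
      constructor
      · intro h
        cases w with
        | val δ => exact (val_notMem_mu h).elim
        | pair x' y =>
          obtain ⟨rfl, d, hd, h | h⟩ := pair_mem_mu.1 h
          · exact (hb (hS.fst_subset d hd h.1)).elim
          · obtain rfl := hS.snd_unique c hc d hd _ hxc h.1
            exact ⟨y, h.2, rfl⟩
      · rintro ⟨y, hy, rfl⟩
        exact pair_mem_mu.2 ⟨rfl, c, hc, .inr ⟨hxc, hy⟩⟩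
    rw [himg, finsum_mem_image (hinj _), finsum_mem_congr rfl fun y hy =>
      (hS.nextWeight_snd p hc hy hxc).trans ((congrArg (· / _) (mul_comm _ _)).trans
        (mul_div_right_comm _ _ _)), ← mul_finsum_mem]
    exact div_mul_cancel₀ _ hpos.ne'

theorem sum_mu (hS : S.Good) (hp : ∀ w ∈ S.Ω, 0 < p w) {A : Set (World Θ)} (hA : A ⊆ S.Ω) :
    ∑ᶠ w ∈ S.mu A, nextWeight S p w = ∑ᶠ w ∈ A, p w := by
  have h : S.mu A = ⋃ x ∈ A, S.mu {x} := by
    ext w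
    simp [hS.mem_mu]
  rw [h, finsum_mem_biUnion _ (hS.finite.subset hA) fun x _ =>
    hS.nextΩ_finite.subset (hS.mu_subset _)]
  · exact finsum_mem_congr rfl fun x hx => hS.sum_mu_singleton hp (hA hx)
  · intro x _ y _ hxy
    refine Set.disjoint_left.2 fun w h1 h2 => hxy ?_
    rw [← (hS.mem_mu.1 h1).2, (hS.mem_mu.1 h2).2]

/-- The weights of `w` and `Tw` share the numerator `p x * p y`, so their ratio is `P(Π) : P(Γ)`,
which the balance hypothesis makes equal to `P(b) : P(∼b)` for every cell. -/
theorem nextWeight_swap (hS : S.Good) (hp : ∀ w ∈ S.Ω, 0 < p w)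
    (hbal : ∀ c ∈ S.cells, (∑ᶠ w ∈ c.2, p w) * ∑ᶠ w ∈ S.b, p w =
      (∑ᶠ w ∈ c.1, p w) * ∑ᶠ w ∈ S.Ω \ S.b, p w) {w : World Θ} (hw : w ∈ S.mu S.b) :
    nextWeight S p w * ∑ᶠ v ∈ S.Ω \ S.b, p v =
      (∑ᶠ v ∈ S.b, p v) * nextWeight S p w.swap := by
  cases w with
  | val δ => exact (val_notMem_mu hw).elim
  | pair x y =>
    obtain ⟨hx, c, hc, h | h⟩ := pair_mem_mu.1 hw
    · obtain ⟨h1, h2⟩ := hS.cell_sum_pos hp hc ⟨x, h.1⟩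
      rw [swap_pair, hS.nextWeight_fst p hc h.1 h.2, hS.nextWeight_snd p hc h.1 h.2,
        mul_div_assoc', div_mul_eq_mul_div, div_eq_div_iff h2.ne' h1.ne']
      linear_combination (-(p x * p y)) * hbal c hc
    · exact ((hS.snd_subset c hc h.1).2 hx).elim

end Stage.Good

/-! ### The extension of a strictly positive probability -/

section Extension

open World

variable {Θ : Type u} [Fintype Θ] [Inhabited Θ] {lam : ℕ → ℕ → Set (World Θ)}
  {π : CForm Θ → ℝ}

theorem probAt_zero (lam : ℕ → ℕ → Set (World Θ)) (π : CForm Θ → ℝ) (s : Set (Θ → Bool)) :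
    probAt lam π 0 (World.val '' s) = ∑ᶠ δ ∈ s, π (CForm.state δ) :=
  finsum_mem_image fun _ _ _ _ h => World.val.inj h

variable (hT : ∀ n, TaskAt lam n) (hπ : IsProbC π) (hpos : StrictlyPositive π)

include hT hpos in
theorem weight_pos (n : ℕ) : ∀ w ∈ (stage lam n).Ω, 0 < weight lam π n w := by
  induction n with
  | zero =>
    rintro _ ⟨δ, rfl⟩
    exact IsProbC.state_pos hpos δ
  | succ n ih =>
    intro w hw
    rw [stage_Ω_succ] at hw
    exact (stage_good hT n).nextWeight_pos ih hw

include hT hpos in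
theorem probAt_mu (n : ℕ) {A : Set (World Θ)} (hA : A ⊆ (stage lam n).Ω) :
    probAt lam π (n + 1) ((stage lam n).mu A) = probAt lam π n A :=
  (stage_good hT n).sum_mu (weight_pos hT hpos n) hA

include hT hpos in
theorem probAt_liftTo {m n : ℕ} (h : m ≤ n) {A : Set (World Θ)} (hA : A ⊆ (stage lam m).Ω) :
    probAt lam π n (liftTo (stage lam) m n A) = probAt lam π m A := by
  induction n, h using Nat.le_induction with
  | base => rw [liftTo_self]
  | succ n h ih =>
    rw [liftTo_succ _ h, probAt_mu hT hpos n (liftTo_subset (fun k _ => stage_good hT k) h hA), ih]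

include hT hπ hpos in
theorem probAt_Ω (n : ℕ) : probAt lam π n (stage lam n).Ω = 1 := by
  classical
  have h0 : probAt lam π 0 (stage lam 0).Ω = 1 := by
    have : (stage lam 0).Ω = World.val '' univ := image_univ.symm
    rw [this, probAt_zero, finsum_mem_univ, finsum_eq_sum_of_fintype]
    convert hπ.sum_state
  rw [← h0, ← probAt_liftTo hT hpos (Nat.zero_le n) Subset.rfl,
    liftTo_Ω (fun k _ => stage_good hT k) (Nat.zero_le n)]

include hT in
theorem probAt_union (π : CForm Θ → ℝ) {n : ℕ} {A B : Set (World Θ)} (hA : A ⊆ (stage lam n).Ω)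
    (hB : B ⊆ (stage lam n).Ω) : probAt lam π n (A ∪ B) + probAt lam π n (A ∩ B) =
      probAt lam π n A + probAt lam π n B :=
  finsum_mem_union_inter ((stage_good hT n).finite.subset hA) ((stage_good hT n).finite.subset hB)

include hT hπ hpos in
theorem probAt_compl {n : ℕ} {A : Set (World Θ)} (hA : A ⊆ (stage lam n).Ω) :
    probAt lam π n ((stage lam n).Ω \ A) = 1 - probAt lam π n A := by
  have h := probAt_union hT π hA (sdiff_subset (s := (stage lam n).Ω) (t := A))
  have h0 : A ∩ ((stage lam n).Ω \ A) = ∅ := by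
    ext x
    simp only [mem_inter_iff, Set.mem_sdiff, mem_empty_iff_false]
    tauto
  rw [union_sdiff_cancel hA, h0, probAt_Ω hT hπ hpos] at h
  have h1 : probAt lam π n ∅ = 0 := finsum_mem_empty
  linarith

include hT hπ hpos in
/-- The two parts of a cell have weights in the same proportion as `b_n` and `∼b_n`. -/
theorem cells_balanced (n : ℕ) : ∀ c ∈ (stage lam n).cells,
    probAt lam π n c.2 * probAt lam π n (stage lam n).b =
      probAt lam π n c.1 * probAt lam π n ((stage lam n).Ω \ (stage lam n).b) := by
  induction n using Nat.strong_induction_on with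
  | _ n ih =>
    have hG : ∀ k < n, (stage lam k).Good := fun k _ => stage_good hT k
    intro c hc
    rcases earlier_empty_or hG fun k _ => hT k with h | ⟨ν, h⟩
    · rw [(cells_first h).1 hc, mul_comm]
    · have hν : ν < n := h.1.1
      have hgν := hG ν hν
      rcases (cells_reprocess hG (fun k _ => hT k) h).1 c hc with rfl | ⟨w, hw, rfl⟩
      · have h1 : probAt lam π n ∅ = 0 := finsum_mem_empty
        rw [h1, zero_mul, zero_mul]
      · have hw' := hgν.mu_subset _ hw
        have hsw := hgν.swap_mem hw'
        rw [← stage_Ω_succ] at hw' hsw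
        have hb : probAt lam π n (stage lam n).b = probAt lam π ν (stage lam ν).b := by
          rw [b_eq_liftTo hG (fun k _ => hT k) h, probAt_liftTo hT hpos hν.le hgν.b_subset]
        rw [probAt_compl hT hπ hpos (stage_good hT n).b_subset, hb,
          ← probAt_compl hT hπ hpos hgν.b_subset,
          probAt_liftTo hT hpos hν (singleton_subset_iff.2 hw'),
          probAt_liftTo hT hpos hν (singleton_subset_iff.2 hsw)]
        -- The parts of the cell weigh as much as `w` and `Tw` at step `ν + 1`, and `b_n` as much as
        -- `b_ν`, so balance at `ν` yields balance at `n`.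
        have key := hgν.nextWeight_swap (weight_pos hT hpos ν) (ih ν hν) hw
        simp only [probAt, finsum_mem_singleton]
        rw [mul_comm]
        exact key.symm

-- The weights of `w` and `Tw` are in the ratio `P(D) : 1 - P(D)`, so `w` has the share `P(D)` of
-- their sum.
include hT hπ hpos in
theorem weight_half {n : ℕ} {D : Set (World Θ)} (hD : (stage lam n).IsHalf D) {w : World Θ}
    (hw : w ∈ D) : weight lam π (n + 1) w = probAt lam π (n + 1) D *
      (weight lam π (n + 1) w + weight lam π (n + 1) w.swap) := by
  have hn := stage_good hT n
  have hw' := hn.half_subset hD hw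
  have hc := probAt_compl hT hπ hpos hn.b_subset
  have key : ∀ v ∈ (stage lam n).mu (stage lam n).b,
      weight lam π (n + 1) v * probAt lam π n ((stage lam n).Ω \ (stage lam n).b) =
        probAt lam π n (stage lam n).b * weight lam π (n + 1) v.swap := fun v hv =>
    hn.nextWeight_swap (weight_pos hT hpos n) (cells_balanced hT hπ hpos n) hv
  rw [hc] at key
  rcases hD with rfl | rfl
  · rw [probAt_mu hT hpos n hn.b_subset]
    linear_combination key w hw
  · have hsw : w.swap ∈ (stage lam n).mu (stage lam n).b :=
      (hn.swap_mem_half (.inl rfl) hw').2 hw.2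
    have := key _ hsw
    rw [swap_swap] at this
    rw [← hn.mu_diff, probAt_mu hT hpos n sdiff_subset, hc]
    linear_combination -this

-- `idT (B ∩ D)` is the disjoint union of `B ∩ D` and its exchange, so summing `weight_half` over `B
-- ∩ D` is enough.
include hT hπ hpos in
theorem probAt_half {n : ℕ} {D B : Set (World Θ)} (hD : (stage lam n).IsHalf D) :
    probAt lam π (n + 1) (B ∩ D) =
      probAt lam π (n + 1) D * probAt lam π (n + 1) (idT (B ∩ D)) := by
  have hn := stage_good hT n
  have hfin : (B ∩ D).Finite :=
    hn.nextΩ_finite.subset (inter_subset_right.trans (hn.half_subset hD))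
  have hdis : Disjoint (B ∩ D) (swap '' (B ∩ D)) := by
    refine Set.disjoint_left.2 fun w h1 h2 => ?_
    exact (hn.swap_mem_half hD (hn.half_subset hD h1.2)).1 (mem_swap_image.1 h2).2 h1.2
  have hinj : InjOn swap (B ∩ D) := fun v _ w _ h => by rw [← swap_swap v, h, swap_swap]
  simp only [probAt]
  rw [idT, finsum_mem_union hdis hfin (hfin.image _), finsum_mem_image hinj,
    ← finsum_mem_add_distrib hfin, mul_finsum_mem]
  exact finsum_mem_congr rfl fun w hw => weight_half hT hπ hpos hD hw.2

-- Two representatives of a set become equal when lifted to a common step, and lifting preserves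
-- `P`; so the choice in `probInf` is immaterial.
include hT hpos in
theorem probInf_atInf {n : ℕ} {A : Set (World Θ)} (hA : A ⊆ (stage lam n).Ω) :
    probInf lam π (atInf lam n A) = probAt lam π n A := by
  have h : ∃ q : ℕ × Set (World Θ), q.2 ⊆ (stage lam q.1).Ω ∧
      atInf lam n A = atInf lam q.1 q.2 := ⟨(n, A), hA, rfl⟩
  rw [probInf, dif_pos h]
  obtain ⟨h1, h2⟩ := h.choose_spec
  generalize h.choose = q at h1 h2
  have hG : ∀ k < max n q.1, (stage lam k).Good := fun k _ => stage_good hT k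
  have hn := le_max_left n q.1
  have hm := le_max_right n q.1
  rw [← probAt_liftTo hT hpos hn hA, ← probAt_liftTo hT hpos hm h1]
  rw [← atInf_liftTo hT hn, ← atInf_liftTo hT hm,
    atInf_inj hT (liftTo_subset hG hn hA) (liftTo_subset hG hm h1)] at h2
  rw [h2]

include hT hπ hpos in
theorem probInf_univ : probInf lam π univ = 1 := by
  rw [← atInf_Ω 0, probInf_atInf hT hpos Subset.rfl, probAt_Ω hT hπ hpos]

include hT hpos in
theorem probInf_empty : probInf lam π ∅ = 0 := by
  have h : (∅ : Set (Limit lam)) = atInf lam 0 ∅ := rfl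
  rw [h, probInf_atInf hT hpos (empty_subset _)]
  exact finsum_mem_empty

include hT hπ hpos in
theorem isProbOn_probInf : IsProbOn (MInf lam) (probInf lam π) where
  nonneg := by
    rintro _ ⟨n, a, ha, rfl⟩
    rw [probInf_atInf hT hpos ha]
    exact finsum_mem_induction (0 ≤ ·) le_rfl (fun _ _ => add_nonneg)
      fun w hw => (weight_pos hT hpos n w (ha hw)).le
  additivity := by
    intro A hA B hB
    obtain ⟨N, hN⟩ := exists_rep hT hA
    obtain ⟨M, hM⟩ := exists_rep hT hB
    obtain ⟨a, ha, rfl⟩ := hN (max N M) (le_max_left _ _)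
    obtain ⟨b, hb, rfl⟩ := hM (max N M) (le_max_right _ _)
    have h1 : atInf lam (max N M) a ∩ atInf lam (max N M) b = atInf lam (max N M) (a ∩ b) := rfl
    have h2 : atInf lam (max N M) a ∪ atInf lam (max N M) b = atInf lam (max N M) (a ∪ b) := rfl
    rw [h1, h2, probInf_atInf hT hpos ha, probInf_atInf hT hpos hb,
      probInf_atInf hT hpos (inter_subset_left.trans ha),
      probInf_atInf hT hpos (union_subset ha hb), add_comm, probAt_union hT π ha hb]
  coherence := probInf_empty hT hpos
  finiteness := probInf_univ hT hπ hpos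

include hT hπ hpos in
theorem probInf_inter {A B : Set (Limit lam)} (hA : A ∈ MInf lam) (hB : B ∈ MInf lam) :
    probInf lam π (A ∩ B) = probInf lam π A * probInf lam π (fInf lam B A) := by
  refine fInf_induction hT (P := fun A B => probInf lam π (A ∩ B) =
    probInf lam π A * probInf lam π (fInf lam B A)) ?_ ?_ hA hB
  · intro A B hB h
    rw [fInf_trivial hT hB h]
    rcases h with rfl | rfl
    · rw [empty_inter, probInf_empty hT hpos, zero_mul]
    · rw [univ_inter, probInf_univ hT hπ hpos, one_mul]
  · intro n D b hD hb
    have hDΩ : D ⊆ (stage lam (n + 1)).Ω := by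
      rw [stage_Ω_succ]; exact (stage_good hT n).half_subset hD
    have hI : idT (b ∩ D) ⊆ (stage lam (n + 1)).Ω := by
      rw [stage_Ω_succ] at hb ⊢
      exact (stage_good hT n).idT_subset (inter_subset_left.trans hb)
    have h1 : atInf lam (n + 1) D ∩ atInf lam (n + 1) b = atInf lam (n + 1) (b ∩ D) :=
      inter_comm _ _
    rw [fInf_half hT hD hb, h1, probInf_atInf hT hpos (inter_subset_left.trans hb),
      probInf_atInf hT hpos hDΩ, probInf_atInf hT hpos hI, probAt_half hT hπ hpos hD]

include hT hπ hpos in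
theorem extend_mem_Icc (φ : Form Θ) : extend lam π φ ∈ Icc (0 : ℝ) 1 := by
  have hP := isProbOn_probInf hT hπ hpos
  have hm := interp_mem hT φ
  have h := hP.additivity _ hm _ (compl_mem_MInf hm)
  rw [inter_compl_self, union_compl_self, hP.coherence, hP.finiteness] at h
  have := hP.nonneg _ (compl_mem_MInf hm)
  refine ⟨hP.nonneg _ hm, ?_⟩
  rw [extend]
  linarith

include hT hπ hpos in
theorem isProbStar_extend : IsProbStar (extend lam π) where
  nonneg φ := (isProbOn_probInf hT hπ hpos).nonneg _ (interp_mem hT φ)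
  equivalence φ ψ h := by
    have : interp lam φ = interp lam ψ :=
      Set.ext fun w => mem_interp_iff.1 (ProvStar.mem_interp hT h w)
    rw [extend, extend, this]
  additivity φ ψ := by
    rw [extend, extend, interp_and, interp_or]
    exact (isProbOn_probInf hT hπ hpos).additivity _ (interp_mem hT φ) _ (interp_mem hT ψ)
  coherence := by rw [extend, interp_bot, probInf_empty hT hpos]
  finiteness := by rw [extend, interp_top, probInf_univ hT hπ hpos]
  multiplicativity φ ψ h := by
    -- Independence is a boxed formula: its truth at a single point already gives `f_∞(H(φ), H(ψ)) =
    -- H(φ)`, but a point is needed.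
    obtain ⟨w, -⟩ := exists_limit hT (n := 0) (mem_range_self fun _ => true)
    have h := mem_interp_indep.1 (ProvStar.mem_interp hT h w)
    have h' := probInf_inter hT hπ hpos (interp_mem hT ψ) (interp_mem hT φ)
    rw [h] at h'
    rw [extend, interp_and, inter_comm, h', mul_comm]
    rfl

omit [Inhabited Θ] [Fintype Θ] in
theorem interp_toForm (φ : CForm Θ) :
    interp lam φ.toForm = atInf lam 0 (World.val '' {δ | φ.Holds δ}) := by
  ext w
  obtain ⟨δ, hδ⟩ : ∃ δ, World.val δ = w.1 0 := w.mem 0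
  have key : ∀ s : Set (Θ → Bool), w ∈ atInf lam 0 (World.val '' s) ↔ δ ∈ s := fun s => by
    simp only [atInf, mem_ofPred_eq, ← hδ, mem_image, World.val.injEq, exists_eq_right]
  rw [key]
  induction φ with
  | atom θ =>
    simp only [CForm.toForm, interp, hInf, atInf, mem_ofPred_eq, ← hδ, World.val.injEq,
      CForm.Holds]
    constructor
    · rintro ⟨_, h, rfl⟩
      exact h
    · exact fun h => ⟨δ, h, rfl⟩
  | neg φ ih => exact not_congr ih
  | imp φ ψ ih1 ih2 =>
    rw [CForm.toForm, mem_interp_imp]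
    exact imp_congr ih1 ih2

include hT hπ hpos in
theorem extend_toForm (φ : CForm Θ) : extend lam π φ.toForm = π φ := by
  classical
  have hsub : World.val '' {δ | φ.Holds δ} ⊆ (stage lam 0).Ω := image_subset_range _ _
  rw [extend, interp_toForm, probInf_atInf hT hpos hsub, probAt_zero, hπ.eq_sum,
    finsum_mem_def, finsum_eq_sum_of_fintype]
  refine Eq.trans (Finset.sum_congr rfl fun δ _ => ?_) (by congr!)
  simp [indicator]

end Extension

/-! ### Rational dependence on the perturbation -/

/-- `g` is a rational function without poles on `(0,1]`. -/
def IsRationalOn (g : ℝ → ℝ) : Prop :=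
  ∃ p q : ℝ[X], ∀ e ∈ Ioc (0 : ℝ) 1, q.eval e ≠ 0 ∧ g e = p.eval e / q.eval e

namespace IsRationalOn

variable {g h : ℝ → ℝ}

theorem congr (hg : IsRationalOn g) (hgh : ∀ e ∈ Ioc (0 : ℝ) 1, h e = g e) : IsRationalOn h := by
  obtain ⟨p, q, hpq⟩ := hg
  exact ⟨p, q, fun e he => ⟨(hpq e he).1, (hgh e he).trans (hpq e he).2⟩⟩

theorem of_polynomial (p : ℝ[X]) : IsRationalOn fun e => p.eval e :=
  ⟨p, 1, fun e _ => by simp⟩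

theorem add (hg : IsRationalOn g) (hh : IsRationalOn h) : IsRationalOn fun e => g e + h e := by
  obtain ⟨p, q, hpq⟩ := hg
  obtain ⟨r, s, hrs⟩ := hh
  refine ⟨p * s + q * r, q * s, fun e he => ?_⟩
  obtain ⟨h1, h2⟩ := hpq e he
  obtain ⟨h3, h4⟩ := hrs e he
  simp only [eval_mul, eval_add, h2, h4, div_add_div _ _ h1 h3]
  exact ⟨mul_ne_zero h1 h3, trivial⟩

theorem mul (hg : IsRationalOn g) (hh : IsRationalOn h) : IsRationalOn fun e => g e * h e := by
  obtain ⟨p, q, hpq⟩ := hg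
  obtain ⟨r, s, hrs⟩ := hh
  refine ⟨p * r, q * s, fun e he => ?_⟩
  obtain ⟨h1, h2⟩ := hpq e he
  obtain ⟨h3, h4⟩ := hrs e he
  simp only [eval_mul, h2, h4, div_mul_div_comm]
  exact ⟨mul_ne_zero h1 h3, trivial⟩

theorem div (hg : IsRationalOn g) (hh : IsRationalOn h) (h0 : ∀ e ∈ Ioc (0 : ℝ) 1, h e ≠ 0) :
    IsRationalOn fun e => g e / h e := by
  obtain ⟨p, q, hpq⟩ := hg
  obtain ⟨r, s, hrs⟩ := hh
  refine ⟨p * s, q * r, fun e he => ?_⟩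
  obtain ⟨h1, h2⟩ := hpq e he
  obtain ⟨h3, h4⟩ := hrs e he
  have h5 : r.eval e ≠ 0 := fun h => h0 e he (by rw [h4, h, zero_div])
  simp only [eval_mul, h2, h4, div_div_div_eq]
  exact ⟨mul_ne_zero h1 h5, trivial⟩

theorem finsum_mem {α : Type*} {s : Set α} (hs : s.Finite) {g : α → ℝ → ℝ}
    (hg : ∀ a ∈ s, IsRationalOn (g a)) : IsRationalOn fun e => ∑ᶠ a ∈ s, g a e := by
  induction s, hs using Set.Finite.induction_on with
  | empty => exact (of_polynomial 0).congr fun e _ => by simp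
  | insert ha hs ih =>
    refine ((hg _ (mem_insert _ _)).add (ih fun a ha' => hg a (mem_insert_of_mem _ ha'))).congr
      fun e _ => ?_
    rw [finsum_mem_insert _ ha hs]

/-- The quotient is meromorphic at `0`. A pole would force values above `1` arbitrarily close to
`0`, and a non-negative order yields a limit. -/
theorem exists_tendsto (hg : IsRationalOn g) (hb : ∀ e ∈ Ioc (0 : ℝ) 1, g e ∈ Icc (0 : ℝ) 1) :
    ∃ L, Tendsto g (𝓝[>] 0) (𝓝 L) := by
  obtain ⟨p, q, hpq⟩ := hg
  have hIoc : Ioc (0 : ℝ) 1 ∈ 𝓝[>] (0 : ℝ) := Ioc_mem_nhdsGT one_pos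
  have hle : 𝓝[>] (0 : ℝ) ≤ 𝓝[≠] 0 := nhdsWithin_mono _ fun x hx => (ne_of_gt hx)
  have heq : (fun e => p.eval e / q.eval e) =ᶠ[𝓝[>] 0] g := by
    filter_upwards [hIoc] with e he using (hpq e he).2.symm
  have hp : MeromorphicAt (fun e : ℝ => p.eval e) 0 :=
    (AnalyticOnNhd.eval_polynomial p 0 (mem_univ _)).meromorphicAt
  have hq : MeromorphicAt (fun e : ℝ => q.eval e) 0 :=
    (AnalyticOnNhd.eval_polynomial q 0 (mem_univ _)).meromorphicAt
  have hm : MeromorphicAt (fun e => p.eval e / q.eval e) (0 : ℝ) := hp.fun_div hq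
  rcases lt_or_ge (meromorphicOrderAt (fun e => p.eval e / q.eval e) (0 : ℝ)) 0 with ho | ho
  · have h1 := ((tendsto_cobounded_of_meromorphicOrderAt_neg ho).mono_left hle).congr' heq
    have h2 := (tendsto_norm_cobounded_atTop.comp h1).eventually_gt_atTop 1
    obtain ⟨e, h3, h4⟩ := (h2.and hIoc).exists
    have h5 := hb e h4
    rw [Function.comp_apply, Real.norm_of_nonneg h5.1] at h3
    exact absurd h5.2 (not_le.2 h3)
  · obtain ⟨L, hL⟩ := tendsto_nhds_of_meromorphicOrderAt_nonneg hm ho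
    exact ⟨L, (hL.mono_left hle).congr' heq⟩

end IsRationalOn

section Perturbation

variable {Θ : Type u} [Fintype Θ] [Inhabited Θ] {lam : ℕ → ℕ → Set (World Θ)}
  {π : CForm Θ → ℝ} (hT : ∀ n, TaskAt lam n) (hπ : IsProbC π)
include hT hπ

/-- The sets `Ω_n` and the cells do not involve the probability, so one recursion serves all `e`.
Each step divides only by weights of non-empty parts of cells, and these are positive on `(0,1]`
because `π_e` is strictly positive. -/
theorem isRationalOn_weight (n : ℕ) : ∀ w ∈ (stage lam n).Ω,
    IsRationalOn fun e => weight lam (perturb π e) n w := by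
  induction n with
  | zero =>
    rintro _ ⟨δ, rfl⟩
    refine (IsRationalOn.of_polynomial (C (1 / 2 ^ Fintype.card Θ) * X +
      (1 - X) * C (π (CForm.state δ)))).congr fun e _ => ?_
    rw [weight, initWeight, perturb_state]
    simp only [eval_add, eval_mul, eval_X, eval_C, eval_sub, eval_one]
    ring
  | succ n ih =>
    intro w hw
    have hn := stage_good hT n
    have hp : ∀ e ∈ Ioc (0 : ℝ) 1, ∀ w ∈ (stage lam n).Ω, 0 < weight lam (perturb π e) n w :=
      fun e he => weight_pos hT (perturb_strictlyPositive hπ he) n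
    have hsum : ∀ A ⊆ (stage lam n).Ω,
        IsRationalOn fun e => ∑ᶠ w ∈ A, weight lam (perturb π e) n w := fun A hA =>
      IsRationalOn.finsum_mem (hn.finite.subset hA) fun w hw => ih w (hA hw)
    rw [stage_Ω_succ] at hw
    cases w with
    | val δ => exact (Stage.val_notMem_mu hw).elim
    | pair x y =>
      have hl := hn.pair_mem_nextΩ.1 hw
      have hx := ih x (hn.linked_mem hl)
      have hy := ih y (hn.linked_mem hl.symm)
      obtain ⟨c, hc, h | h⟩ := hl
      · refine ((hx.mul hy).div (hsum c.2 ((hn.snd_subset c hc).trans sdiff_subset))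
          fun e he => (hn.cell_sum_pos (hp e he) hc ⟨x, h.1⟩).2.ne').congr fun e _ => ?_
        exact hn.nextWeight_fst _ hc h.1 h.2
      · refine ((hy.mul hx).div (hsum c.1 ((hn.fst_subset c hc).trans hn.b_subset))
          fun e he => (hn.cell_sum_pos (hp e he) hc ⟨y, h.2⟩).1.ne').congr fun e _ => ?_
        exact hn.nextWeight_snd _ hc h.2 h.1

theorem isRationalOn_extend (φ : Form Θ) :
    IsRationalOn fun e => extend lam (perturb π e) φ := by
  obtain ⟨n, a, ha, h⟩ := interp_mem hT φ
  refine (IsRationalOn.finsum_mem ((stage_good hT n).finite.subset ha)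
    fun w hw => isRationalOn_weight hT hπ n w (ha hw)).congr fun e he => ?_
  rw [extend, h, probInf_atInf hT (perturb_strictlyPositive hπ he) ha]
  rfl

/-- Every clause of `IsProbStar` is a weak inequality or a polynomial identity between finitely many
values, hence survives pointwise limits. -/
theorem exists_limit_extension : ∃ P : Form Θ → ℝ, IsProbStar P ∧
    (∀ φ : CForm Θ, P φ.toForm = π φ) ∧
    ∀ φ : Form Θ, Tendsto (fun e => extend lam (perturb π e) φ) (𝓝[>] 0) (𝓝 (P φ)) := by
  have hstar : ∀ e ∈ Ioc (0 : ℝ) 1, IsProbStar (extend lam (perturb π e)) := fun e he =>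
    isProbStar_extend hT (perturb_isProbC hπ he) (perturb_strictlyPositive hπ he)
  have hev : ∀ᶠ e in 𝓝[>] (0 : ℝ), e ∈ Ioc (0 : ℝ) 1 := Ioc_mem_nhdsGT one_pos
  have hlim : ∀ φ, ∃ L, Tendsto (fun e => extend lam (perturb π e) φ) (𝓝[>] 0) (𝓝 L) := fun φ =>
    (isRationalOn_extend hT hπ φ).exists_tendsto fun e he =>
      extend_mem_Icc hT (perturb_isProbC hπ he) (perturb_strictlyPositive hπ he) φ
  choose P hP using hlim
  refine ⟨P, ?_, fun φ => ?_, hP⟩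
  · exact
      { nonneg := fun φ => ge_of_tendsto (hP φ) (hev.mono fun e he => (hstar e he).nonneg φ)
        equivalence := fun φ ψ h => tendsto_nhds_unique_of_eventuallyEq (hP φ) (hP ψ)
          (hev.mono fun e he => (hstar e he).equivalence φ ψ h)
        additivity := fun φ ψ => tendsto_nhds_unique_of_eventuallyEq ((hP _).add (hP _))
          ((hP _).add (hP _)) (hev.mono fun e he => (hstar e he).additivity φ ψ)
        coherence := tendsto_nhds_unique_of_eventuallyEq (hP _) tendsto_const_nhds
          (hev.mono fun e he => (hstar e he).coherence)
        finiteness := tendsto_nhds_unique_of_eventuallyEq (hP _) tendsto_const_nhds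
          (hev.mono fun e he => (hstar e he).finiteness)
        multiplicativity := fun φ ψ h => tendsto_nhds_unique_of_eventuallyEq (hP _)
          ((hP _).mul (hP _)) (hev.mono fun e he => (hstar e he).multiplicativity φ ψ h) }
  · exact tendsto_nhds_unique_of_eventuallyEq (hP _) (tendsto_perturb hπ φ)
      (hev.mono fun e he => extend_toForm hT (perturb_isProbC hπ he)
        (perturb_strictlyPositive hπ he) φ)

end Perturbation

theorem mainTheorem2 {Θ : Type u} [Fintype Θ] [Inhabited Θ] :
    -- the construction can be carried out
    (∃ lam : ℕ → ℕ → Set (World Θ), IsTaskList lam) ∧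
    ∀ lam : ℕ → ℕ → Set (World Θ), IsTaskList lam →
      -- the limit is a well defined conditional model
      ((∀ A ∈ MInf lam, ∀ B ∈ MInf lam, ∃ n b a c, Represents lam B A n b a c) ∧
        (∀ A B n b a c, Represents lam B A n b a c → fInf lam B A = atInf lam n c) ∧
        IsConditionalModelStar (MInf lam) (hInf lam) (fInf lam)) ∧
      -- extension of a strictly positive probability
      (∀ π : CForm Θ → ℝ, IsProbC π → StrictlyPositive π →
        (∀ δ : Θ → Bool, probAt lam π 0 {World.val δ} = π (CForm.state δ)) ∧
        (∀ n, ∀ c ∈ (stage lam n).cells, ∀ x ∈ c.1, ∀ y ∈ c.2,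
          probAt lam π (n + 1) {World.pair x y} =
            probAt lam π n {x} * probAt lam π n {y} / probAt lam π n c.2 ∧
          probAt lam π (n + 1) {World.pair y x} =
            probAt lam π n {x} * probAt lam π n {y} / probAt lam π n c.1) ∧
        (∀ n, ∀ A ⊆ (stage lam n).Ω, probInf lam π (atInf lam n A) = probAt lam π n A) ∧
        IsProbOn (MInf lam) (probInf lam π) ∧
        (∀ A ∈ MInf lam, ∀ B ∈ MInf lam,
          probInf lam π (A ∩ B) = probInf lam π A * probInf lam π (fInf lam B A)) ∧
        IsProbStar (extend lam π) ∧
        ∀ φ : CForm Θ, extend lam π φ.toForm = π φ) ∧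
      -- extension of an arbitrary probability, as a limit
      (∀ π : CForm Θ → ℝ, IsProbC π →
        (∀ e ∈ Ioc (0 : ℝ) 1, IsProbC (perturb π e) ∧ StrictlyPositive (perturb π e) ∧
          (∀ δ : Θ → Bool, perturb π e (CForm.state δ) =
            e / 2 ^ Fintype.card Θ + (1 - e) * π (CForm.state δ)) ∧
          ∀ π' : CForm Θ → ℝ, IsProbC π' →
            (∀ δ : Θ → Bool, π' (CForm.state δ) =
              e / 2 ^ Fintype.card Θ + (1 - e) * π (CForm.state δ)) →
            π' = perturb π e) ∧
        (∀ φ : Form Θ, ∃ p q : ℝ[X], ∀ e ∈ Ioc (0 : ℝ) 1,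
          q.eval e ≠ 0 ∧ extend lam (perturb π e) φ = p.eval e / q.eval e) ∧
        ∃ P : Form Θ → ℝ, IsProbStar P ∧ (∀ φ : CForm Θ, P φ.toForm = π φ) ∧
          ∀ φ : Form Θ, Tendsto (fun e => extend lam (perturb π e) φ) (𝓝[>] 0) (𝓝 (P φ))) := by
  refine ⟨exists_isTaskList, fun lam hlam => ?_⟩
  have hT := isTaskList_iff.1 hlam
  refine ⟨⟨fun A hA B hB => exists_represents hT hA hB, fun A B n b a c h => h.fInf_eq hT,
    isConditionalModelStar hT⟩, fun π hπ hpos => ⟨fun δ => ?_, fun n c hc x hx y hy => ?_,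
    fun n A hA => probInf_atInf hT hpos hA, isProbOn_probInf hT hπ hpos,
    fun A hA B hB => probInf_inter hT hπ hpos hA hB, isProbStar_extend hT hπ hpos,
    extend_toForm hT hπ hpos⟩, fun π hπ => ⟨fun e he => ⟨perturb_isProbC hπ he,
    perturb_strictlyPositive hπ he, perturb_state π e, fun π' hπ' h => eq_perturb hπ' h⟩,
    isRationalOn_extend hT hπ, exists_limit_extension hT hπ⟩⟩
  · rw [← image_singleton, probAt_zero, finsum_mem_singleton]
  · have hn := stage_good hT n
    simp only [probAt, finsum_mem_singleton]
    exact ⟨hn.nextWeight_fst _ hc hx hy, hn.nextWeight_snd _ hc hx hy⟩
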